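/- Let $d\in\{2,3\}$ and $\nu>0$. **Setting.** A rigid body is a closed, bounded, connected, simply connected set $\mathcal S^{in}\subset\mathbb R^d$ with non-empty interior and smooth boundary, with an integrable density $\rho^{in}:\mathcal S^{in}\to(0,\infty)$ and centre of mass at the origin. Its mass is $m=\int_{\mathcal S^{in}}\rho^{in}$; its inertia is $\mathcal J=\int_{\mathcal S^{in}}\rho^{in}(|x|^2\mathbb I-x\otimes x)\,dx$ if $d=3$ and $\mathcal J=\int_{\mathcal S^{in}}\rho^{in}|x|^2dx$ if $d=2$. For $\omega\in\mathbb R^{2d-3}$ we write $\omega\times x$ for the cross product if $d=3$ and for $\omega x^\perp=\omega(-x_2,x_1)$ if $d=2$. Initial data consist of $\mathcal S^{in},\rho^{in}$, a fluid velocity $u^{in}$, and $\ell^{in}\in\mathbb R^d$, $\omega^{in}\in\mathbb R^{2d-3}$, such that $\tilde u^{in}:=u^{in}$ outside $\mathcal S^{in}$, $\tilde u^{in}:=\ell^{in}+\omega^{in}\times x$ in $\mathcal S^{in}$, belongs to $L^2(\mathbb R^d)$ and satisfies the compatibility conditions $\operatorname{div}u^{in}=0$ in $\mathbb R^d\setminus\mathcal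 S^{in}$ and $u^{in}\cdot n=(\ell^{in}+\omega^{in}\times x)\cdot n$ on $\partial\mathcal S^{in}$, that is, $\operatorname{div}\tilde u^{in}=0$ in the sense of distributions on $\mathbb R^d$. Set $\tilde\rho^{in}:=\rho^{in}$ in $\mathcal S^{in}$ and $\tilde\rho^{in}:=1$ elsewhere. A triple $(u,\ell,\omega)$ with $\ell\in L^\infty(\mathbb R^+;\mathbb R^d)$, $\omega\in L^\infty(\mathbb R^+;\mathbb R^{2d-3})$, $\mathbb R^+=[0,\infty)$, determines the motion $h'=\ell$, $h(0)=0$, $Q'y=\omega\times(Qy)$ for all $y\in\mathbb R^d$, $Q(0)=\mathbb I$, the body $\mathcal S(t)=\{x: Q^T(t)(x-h(t))\in\mathcal S^{in}\}$, the fluid domain $\mathcal F(t)=\mathbb R^d\setminus\mathcal S(t)$, the density $\tilde\rho(t,x)=\rho^{in}(Q^T(t)(x-h(t)))$ in $\mathcal S(t)$, $\tilde\rho=1$ in $\mathcal F(t)$, and the global velocity $\tilde u=u$ in $\mathcal F(t)$, $\tilde u=\ell+\omega\times(x-h)$ in $\mathcal S(t)$. It is a *Hopf–Leray weak solution* associated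 with the initial data if - $u\in L^\infty(\mathbb R^+;L^2(\mathcal F(t)))$, $\tilde u\in L^2_{loc}(\mathbb R^+;H^1(\mathbb R^d))$ and $\tilde u\in C_w(\mathbb R^+;L^2(\mathbb R^d))$ (up to a null set of times); - $\operatorname{div}\tilde u=0$ in $\mathbb R^d$ and $D(\tilde u)=0$ in $\mathcal S(t)$, where $D(v)=\frac12(\nabla v+(\nabla v)^T)$; - for every $\varphi\in C_c^\infty(\mathbb R^+\times\mathbb R^d;\mathbb R^d)$ with $\operatorname{div}\varphi=0$ and $D(\varphi)=0$ in $\mathcal S(t)$, $$-\int_{\mathbb R^+}\int_{\mathbb R^d}\Big[\tilde\rho\,\tilde u\cdot(\partial_t\varphi+\tilde u\cdot\nabla\varphi)-2\nu D(\tilde u):D(\varphi)\Big]dx\,dt=\int_{\mathbb R^d}\tilde\rho^{in}\tilde u^{in}\cdot\varphi(0,\cdot)\,dx;$$ - for almost every $t\in\mathbb R^+$, $\displaystyle\int_{\mathbb R^d}\tilde\rho(t)|\tilde u(t)|^2dx+4\nu\int_0^t\!\int_{\mathbb R^d}|D(\tilde u)|^2dx\,ds\le\int_{\mathbb R^d}\tilde\rho^{in}|\tilde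 u^{in}|^2dx.$ **Theorem.** Let $(u_\varepsilon,\ell_\varepsilon,\omega_\varepsilon)$ be a sequence (or family) of Hopf–Leray weak solutions, with the same viscosity $\nu$, associated with initial data $\mathcal S^{in}_\varepsilon,\rho^{in}_\varepsilon,u^{in}_\varepsilon,\ell^{in}_\varepsilon,\omega^{in}_\varepsilon$, where $\varepsilon>0$, $\varepsilon\to0$. Denote by $m_\varepsilon$ and $\mathcal J_\varepsilon$ the mass and the inertia of the body at the initial time. Assume that - $\mathcal S^{in}_\varepsilon\subset B_0(\varepsilon)$, the ball of radius $\varepsilon$ centred at $0$; - $m_\varepsilon/\varepsilon^d\to+\infty$; - $\tilde u^{in}_\varepsilon\to u^{in}$ in $L^2(\mathbb R^d)$ for some $u^{in}\in L^2(\mathbb R^d)$, and $m_\varepsilon|\ell^{in}_\varepsilon|^2+(\mathcal J_\varepsilon\omega^{in}_\varepsilon)\cdot\omega^{in}_\varepsilon\to2E$ for some $E\in\mathbb R$; - $m_\varepsilon/\varepsilon^{1/2}\to+\infty$ if $d=3$, and $m_\varepsilon\ge C$ for some constant $C>0$ independent of $\varepsilon$ if $d=2$; - $\ell^{in}_\varepsilon\to\ell^{in}$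 in $\mathbb R^d$. Then $\ell_\varepsilon\to\ell^{in}$ in $L^\infty_{loc}(\mathbb R^+)$: for every $T>0$, $\|\ell_\varepsilon-\ell^{in}\|_{L^\infty(0,T)}\to0$, where $\ell^{in}$ is constant in time. -/

import Mathlib

open MeasureTheory Set Filter Topology
open scoped Matrix ENNReal NNReal

noncomputable section

namespace SmallBody

/-- The Euclidean space `ℝ^d`. -/
abbrev Vec (d : ℕ) : Type := EuclideanSpace ℝ (Fin d)

/-- Angular velocities: scalars if `d = 2`, vectors of `ℝ^3` if `d = 3`. -/
abbrev AngVel (d : ℕ) : Type := EuclideanSpace ℝ (Fin (2 * d - 3))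

/-- The skew-symmetric matrix identified with an angular velocity: it maps `x` to
`ω x^⊥ = ω (-x₂, x₁)` if `d = 2` and to the cross product `ω × x` if `d = 3`
(other dimensions are not used). -/
def spin : (d : ℕ) → AngVel d → Matrix (Fin d) (Fin d) ℝ
  | 2, ω => !![0, -ω ⟨0, by norm_num⟩; ω ⟨0, by norm_num⟩, 0]
  | 3, ω =>
      !![0, -ω ⟨2, by norm_num⟩, ω ⟨1, by norm_num⟩;
         ω ⟨2, by norm_num⟩, 0, -ω ⟨0, by norm_num⟩;
         -ω ⟨1, by norm_num⟩, ω ⟨0, by norm_num⟩, 0]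
  | _, _ => 0

/-- A matrix acting on a vector of `ℝ^d`. -/
def act {d : ℕ} (A : Matrix (Fin d) (Fin d) ℝ) (x : Vec d) : Vec d :=
  WithLp.toLp 2 (A *ᵥ WithLp.ofLp x)

/-- The rigid velocity field `x ↦ ℓ + ω × (x - h)`. -/
def rigidVel {d : ℕ} (ℓ : Vec d) (ω : AngVel d) (h : Vec d) (x : Vec d) : Vec d :=
  ℓ + act (spin d ω) (x - h)

/-- The boundary of the closed set `S` is smooth: near each boundary point `S` is a sublevel set
`{f ≤ 0}` of a smooth function whose differential does not vanish at that point. -/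
def HasSmoothBoundary {d : ℕ} (S : Set (Vec d)) : Prop :=
  ∀ x ∈ frontier S, ∃ f : Vec d → ℝ, ContDiff ℝ (⊤ : ℕ∞) f ∧ fderiv ℝ f x ≠ 0 ∧
    ∀ᶠ y in 𝓝 x, (y ∈ S ↔ f y ≤ 0)

/-- The mass `m = ∫_S ρ`. -/
def mass {d : ℕ} (S : Set (Vec d)) (ρ : Vec d → ℝ) : ℝ := ∫ x in S, ρ x

/-- The inertia matrix about the origin: `∫_S ρ (|x|² I - x ⊗ x)` if `d = 3`, and the scalar
`∫_S ρ |x|²` (as a `1 × 1` matrix) if `d = 2`. -/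
def inertia : (d : ℕ) → Set (Vec d) → (Vec d → ℝ) →
    Matrix (Fin (2 * d - 3)) (Fin (2 * d - 3)) ℝ
  | 2, S, ρ => Matrix.of fun _ _ => ∫ x in S, ρ x * ‖x‖ ^ 2
  | 3, S, ρ => Matrix.of fun i j : Fin 3 =>
      ∫ x in S, ρ x * ((if i = j then ‖x‖ ^ 2 else 0) - x i * x j)
  | _, _, _ => 0

/-- An admissible rigid body at its initial position `S` with density `ρ` on `S`; the centre of
mass is the origin. -/
structure IsRigidBody {d : ℕ} (S : Set (Vec d)) (ρ : Vec d → ℝ) : Prop where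
  isClosed : IsClosed S
  isBounded : Bornology.IsBounded S
  isConnected : IsConnected S
  simplyConnected : SimplyConnectedSpace S
  interior_nonempty : (interior S).Nonempty
  smoothBoundary : HasSmoothBoundary S
  density_pos : ∀ x ∈ S, 0 < ρ x
  density_integrable : IntegrableOn ρ S
  centre : ∫ x in S, ρ x • x = 0

/-- The extended density: `ρ` on the body `S`, and `1` in the fluid. -/
def extDensity {d : ℕ} (S : Set (Vec d)) (ρ : Vec d → ℝ) (x : Vec d) : ℝ :=
  open Classical in if x ∈ S then ρ x else 1

/-- The global velocity: `v` on the body `S`, and `u` in the fluid. -/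
def extVel {d : ℕ} (S : Set (Vec d)) (v u : Vec d → Vec d) (x : Vec d) : Vec d :=
  open Classical in if x ∈ S then v x else u x

/-- The Jacobian matrix `(∂_j v_i)_{ij}` of a differentiable vector field. -/
def jacobian {d : ℕ} (v : Vec d → Vec d) (x : Vec d) : Matrix (Fin d) (Fin d) ℝ :=
  Matrix.of fun i j => fderiv ℝ v x (EuclideanSpace.single j 1) i

/-- The symmetric part; applied to a velocity gradient it gives `D(u)`. -/
def symPart {d : ℕ} (A : Matrix (Fin d) (Fin d) ℝ) : Matrix (Fin d) (Fin d) ℝ :=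
  (1 / 2 : ℝ) • (A + Aᵀ)

/-- The contraction `A : B`. -/
def contract {d : ℕ} (A B : Matrix (Fin d) (Fin d) ℝ) : ℝ := ∑ i, ∑ j, A i j * B i j

/-- `v` is divergence free on `ℝ^d` in the sense of distributions. -/
def IsWeakDivFree {d : ℕ} (v : Vec d → Vec d) : Prop :=
  LocallyIntegrable v ∧
    ∀ φ : Vec d → ℝ, ContDiff ℝ (⊤ : ℕ∞) φ → HasCompactSupport φ → ∫ x, fderiv ℝ φ x (v x) = 0

/-- `G = (∂_j v_i)_{ij}` in the sense of distributions on `ℝ^d`. -/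
def HasWeakGradient {d : ℕ} (v : Vec d → Vec d) (G : Vec d → Matrix (Fin d) (Fin d) ℝ) : Prop :=
  LocallyIntegrable v ∧ (∀ i j, LocallyIntegrable fun x => G x i j) ∧
    ∀ φ : Vec d → ℝ, ContDiff ℝ (⊤ : ℕ∞) φ → HasCompactSupport φ → ∀ i j,
      ∫ x, v x i * fderiv ℝ φ x (EuclideanSpace.single j 1) = -∫ x, G x i j * φ x

/-- `v ∈ C_w([0,∞); L²)`, up to the choice of a representative in time. -/
def IsWeaklyContinuousL2 {d : ℕ} (v : ℝ → Vec d → Vec d) : Prop :=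
  ∃ w : ℝ → Lp (Vec d) 2 (volume : Measure (Vec d)),
    (∀ g : Lp (Vec d) 2 (volume : Measure (Vec d)),
      ContinuousOn (fun t => inner ℝ (w t) g) (Ici 0)) ∧
    ∀ᵐ t ∂(volume.restrict (Ioi (0 : ℝ))), w t =ᵐ[volume] v t

/-- `h` and `Q` are the position of the centre of mass and the rotation produced by the
velocities `ℓ` and `ω`, that is, `h' = ℓ`, `Q' = (ω ×) Q`, `h(0) = 0`, `Q(0) = I`. -/
structure IsMotion {d : ℕ} (ℓ : ℝ → Vec d) (ω : ℝ → AngVel d)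
    (h : ℝ → Vec d) (Q : ℝ → Matrix (Fin d) (Fin d) ℝ) : Prop where
  position : ∀ t, 0 ≤ t → h t = ∫ s in 0..t, ℓ s
  rotation : ∀ t, 0 ≤ t → Q t ∈ Matrix.orthogonalGroup (Fin d) ℝ
  rotation_continuous : ∀ i j, ContinuousOn (fun t => Q t i j) (Ici 0)
  rotation_eq : ∀ t, 0 ≤ t → ∀ i j,
    Q t i j = (1 : Matrix (Fin d) (Fin d) ℝ) i j + ∫ s in 0..t, (spin d (ω s) * Q s) i j

/-- The body at a time when its centre is `h` and its rotation is `Q`. -/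
def movedBody {d : ℕ} (S : Set (Vec d)) (h : Vec d) (Q : Matrix (Fin d) (Fin d) ℝ) :
    Set (Vec d) :=
  {x | act Qᵀ (x - h) ∈ S}

/-- The extended density at such a time. -/
def movedDensity {d : ℕ} (S : Set (Vec d)) (ρ : Vec d → ℝ) (h : Vec d)
    (Q : Matrix (Fin d) (Fin d) ℝ) : Vec d → ℝ :=
  extDensity (movedBody S h Q) fun x => ρ (act Qᵀ (x - h))

/-- The global velocity at time `t`. -/
def globalVel {d : ℕ} (S : Set (Vec d)) (u : ℝ → Vec d → Vec d) (ℓ : ℝ → Vec d)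
    (ω : ℝ → AngVel d) (h : ℝ → Vec d) (Q : ℝ → Matrix (Fin d) (Fin d) ℝ) (t : ℝ) :
    Vec d → Vec d :=
  extVel (movedBody S (h t) (Q t)) (rigidVel (ℓ t) (ω t) (h t)) (u t)

/-- The global velocity at the initial time. -/
def initialVel {d : ℕ} (S : Set (Vec d)) (u₀ : Vec d → Vec d) (ℓ₀ : Vec d) (ω₀ : AngVel d) :
    Vec d → Vec d :=
  extVel S (rigidVel ℓ₀ ω₀ 0) u₀

/-- Admissible initial data: a rigid body and a finite energy velocity satisfying the
compatibility conditions. For square integrable fields, `div u₀ = 0` in the fluid together with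
`u₀ · n = (ℓ₀ + ω₀ × x) · n` on the boundary of the body (normal trace) means that the global
velocity is divergence free in `ℝ^d` in the sense of distributions. -/
structure IsInitialData {d : ℕ} (S : Set (Vec d)) (ρ : Vec d → ℝ) (u₀ : Vec d → Vec d)
    (ℓ₀ : Vec d) (ω₀ : AngVel d) : Prop where
  body : IsRigidBody S ρ
  finiteEnergy : MemLp (initialVel S u₀ ℓ₀ ω₀) 2
  compatible : IsWeakDivFree (initialVel S u₀ ℓ₀ ω₀)

/-- Test functions: restrictions to `[0,∞) × ℝ^d` of smooth compactly supported fields that are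
divergence free in `x` and satisfy `D(φ) = 0` in the moving body. -/
structure IsTestField {d : ℕ} (S : Set (Vec d)) (h : ℝ → Vec d)
    (Q : ℝ → Matrix (Fin d) (Fin d) ℝ) (φ : ℝ × Vec d → Vec d) : Prop where
  smooth : ContDiff ℝ (⊤ : ℕ∞) φ
  compactSupport : HasCompactSupport φ
  divFree : ∀ t, 0 ≤ t → ∀ x, (jacobian (fun y => φ (t, y)) x).trace = 0
  rigid : ∀ t, 0 ≤ t → ∀ x ∈ movedBody S (h t) (Q t),
    symPart (jacobian (fun y => φ (t, y)) x) = 0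

/-- The conditions defining a Hopf–Leray weak solution, for the motion `h`, `Q` of the body and the
spatial gradient `G` of the global velocity. -/
structure IsHopfLerayWith {d : ℕ} (ν : ℝ) (S : Set (Vec d)) (ρ : Vec d → ℝ)
    (u₀ : Vec d → Vec d) (ℓ₀ : Vec d) (ω₀ : AngVel d)
    (u : ℝ → Vec d → Vec d) (ℓ : ℝ → Vec d) (ω : ℝ → AngVel d)
    (h : ℝ → Vec d) (Q : ℝ → Matrix (Fin d) (Fin d) ℝ)
    (G : ℝ → Vec d → Matrix (Fin d) (Fin d) ℝ) : Prop where
  ℓ_bounded : MemLp ℓ ∞ (volume.restrict (Ioi 0))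
  ω_bounded : MemLp ω ∞ (volume.restrict (Ioi 0))
  motion : IsMotion ℓ ω h Q
  /- joint measurability, and `u ∈ L^∞(ℝ⁺; L²(F(t)))` -/
  measurable : AEStronglyMeasurable (fun p : ℝ × Vec d => globalVel S u ℓ ω h Q p.1 p.2)
    ((volume.restrict (Ioi 0)).prod volume)
  bounded_L2 : ∃ C : ℝ≥0, ∀ᵐ t ∂(volume.restrict (Ioi (0 : ℝ))),
    eLpNorm (u t) 2 (volume.restrict (movedBody S (h t) (Q t))ᶜ) ≤ C
  /- `L²_loc(ℝ⁺; H¹)` -/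
  gradient : ∀ᵐ t ∂(volume.restrict (Ioi (0 : ℝ))),
    HasWeakGradient (globalVel S u ℓ ω h Q t) (G t)
  gradient_L2 : ∀ T : ℝ, 0 < T → ∀ i j, MemLp (fun p : ℝ × Vec d => G p.1 p.2 i j) 2
    ((volume.restrict (Ioo 0 T)).prod volume)
  weaklyContinuous : IsWeaklyContinuousL2 (globalVel S u ℓ ω h Q)
  divFree : ∀ᵐ t ∂(volume.restrict (Ioi (0 : ℝ))), IsWeakDivFree (globalVel S u ℓ ω h Q t)
  rigid : ∀ᵐ t ∂(volume.restrict (Ioi (0 : ℝ))),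
    ∀ᵐ x ∂(volume.restrict (movedBody S (h t) (Q t))), symPart (G t x) = 0
  weakForm : ∀ φ : ℝ × Vec d → Vec d, IsTestField S h Q φ →
    -(∫ t in Ioi (0 : ℝ), ∫ x,
        (movedDensity S ρ (h t) (Q t) x *
            inner ℝ (globalVel S u ℓ ω h Q t x)
              (deriv (fun s => φ (s, x)) t +
                fderiv ℝ (fun y => φ (t, y)) x (globalVel S u ℓ ω h Q t x))
          - 2 * ν * contract (symPart (G t x)) (symPart (jacobian (fun y => φ (t, y)) x))))
      = ∫ x, extDensity S ρ x * inner ℝ (initialVel S u₀ ℓ₀ ω₀ x) (φ (0, x))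
  energy : ∀ᵐ t ∂(volume.restrict (Ioi (0 : ℝ))),
    (∫ x, movedDensity S ρ (h t) (Q t) x * ‖globalVel S u ℓ ω h Q t x‖ ^ 2)
        + 4 * ν * ∫ s in 0..t, ∫ x, contract (symPart (G s x)) (symPart (G s x))
      ≤ ∫ x, extDensity S ρ x * ‖initialVel S u₀ ℓ₀ ω₀ x‖ ^ 2

/-- `(u, ℓ, ω)` is a Hopf–Leray weak solution with viscosity `ν` associated with the initial data
`S, ρ, u₀, ℓ₀, ω₀`. The motion of the body and (up to null sets) the gradient are determined by
`(u, ℓ, ω)`. -/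
def IsHopfLeraySolution {d : ℕ} (ν : ℝ) (S : Set (Vec d)) (ρ : Vec d → ℝ)
    (u₀ : Vec d → Vec d) (ℓ₀ : Vec d) (ω₀ : AngVel d)
    (u : ℝ → Vec d → Vec d) (ℓ : ℝ → Vec d) (ω : ℝ → AngVel d) : Prop :=
  ∃ (h : ℝ → Vec d) (Q : ℝ → Matrix (Fin d) (Fin d) ℝ)
    (G : ℝ → Vec d → Matrix (Fin d) (Fin d) ℝ), IsHopfLerayWith ν S ρ u₀ ℓ₀ ω₀ u ℓ ω h Q G

end SmallBody

end

open SmallBody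

/-! Test the weak formulation with `φ(t, x) = χ(t) Φ(x - H(t))`. Here `Φ` is a compactly supported
divergence free field equal to a constant `e` on the ball of radius `2ε`, `H` is a smooth curve
within `ε` of the centre of mass, and `χ' = -g` on positive times for a smooth probability density
`g` on `(0, T)`. The body stays where `Φ` is constant, so `φ` is admissible. The centre of mass
being the origin of the body frame, the body contributes exactly `-m ∫ g ℓ · e` and, at the initial
time, `m ℓ₀ · e`. Hence `m |∫ g ℓ · e - ℓ₀ · e|` is bounded by integrals over the fluid, uniformly
in `g`. Letting `g` concentrate bounds `m |ℓ(t) · e - ℓ₀ · e|` for almost every `t`, which is why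
the convergence is uniform in time.

The delicate fluid term is the convective one, `∫ |∇Φ| |v|²`. If `|∇Φ| ≤ κ w` with `w(x) = (|x|² +
r²)^(-d/4)`, it is at most `κ ∫ w |v|²`. This weighted integral is controlled by a Hardy type
inequality (`integral_weight_mul_norm_sq_le`): integrating `D(v) v` against the multiplier `w(x) x`
gives a virial identity in which only `D(v)` appears. Since `D(v)` vanishes on the body, the
right-hand side involves `v` only in the fluid, where the energy inequality bounds it; the `L²` norm
of `v` on the body is never needed. The other terms are bounded by Cauchy–Schwarz and the energy.
The velocity `H'` of the frame is at most `(E/m)^(1/2)`, with `E` a bound on the initial energy, and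
enters through `(E/m) ∫ |∇Φ|`.

Thus everything reduces to cutoffs (`IsCutoffField`) with `κ/m → 0` and `κ'/m² → 0`, where `κ'`
bounds `∫ |∇Φ|`. In dimension three a single scale gives `κ ~ ε^(1/2)` and `κ' ~ ε²`, whence the
assumption `m/ε^(1/2) → ∞`. In dimension two averaging over `N` separated scales, a discrete
logarithmic cutoff, makes `κ` and `κ'` as small as desired, so a lower bound on `m` suffices. The
two cases meet in `momentum_estimate` and `ae_norm_sub_le`. -/

noncomputable section

namespace SmallBody

/-! ### Product rule for weak derivatives of square integrable functions -/

section WeakProduct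

open scoped Convolution

variable {V : Type*} [NormedAddCommGroup V] [NormedSpace ℝ V] [FiniteDimensional ℝ V]
  [MeasurableSpace V] [BorelSpace V] {μ : Measure V} [μ.IsAddHaarMeasure]

/-- The correlation of two square integrable functions is continuous. -/
theorem continuous_correlation {h F : V → ℝ} (hh : MemLp h 2 μ) (hF : MemLp F 2 μ) :
    Continuous fun y => ∫ x, h x * F (x - y) ∂μ := by
  -- The integral is the `L²` inner product of `h` with a translate of `F`. Translations act
  -- continuously on `L²` because the exponent is finite.
  have : Fact ((2 : ℝ≥0∞) ≠ ∞) := ⟨by norm_num⟩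
  have key : Continuous fun y : V => inner ℝ (DomAddAct.mk (-y) +ᵥ hF.toLp F) (hh.toLp h) := by
    have h1 : Continuous fun y : V => DomAddAct.mk (-y) :=
      DomAddAct.continuous_mk.comp continuous_neg
    have h2 : Continuous fun y : V => (DomAddAct.mk (-y) +ᵥ hF.toLp F) :=
      h1.vadd continuous_const
    exact h2.inner continuous_const
  convert key using 2 with y
  rw [L2.inner_def]
  refine integral_congr_ae ?_
  rw [DomAddAct.mk_vadd_toLp]
  filter_upwards [hh.coeFn_toLp, MemLp.coeFn_toLp
    (hF.comp_measurePreserving (measurePreserving_vadd (-y) μ))] with x hx1 hx2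
  rw [hx1]
  erw [hx2]
  simp only [Function.comp_apply, vadd_eq_add, RCLike.inner_apply, conj_trivial]
  congr 2
  abel

/-- Mollifications of a square integrable function converge weakly. -/
theorem tendsto_integral_mul_convolution {h F : V → ℝ} (hh : MemLp h 2 μ) (hF : MemLp F 2 μ)
    {φ : ℕ → ContDiffBump (0 : V)} (hφ : Tendsto (fun n => (φ n).rOut) atTop (𝓝 0)) :
    Tendsto (fun n => ∫ x, h x * ((φ n).normed μ ⋆[ContinuousLinearMap.lsmul ℝ ℝ, μ] F) x ∂μ)
      atTop (𝓝 (∫ x, h x * F x ∂μ)) := by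
  -- By Fubini the mollified integral is the bump convolved with the reflected correlation,
  -- evaluated at `0`. Continuity of the correlation there gives the limit.
  have hc := continuous_correlation hh hF
  have hc' : Continuous fun y => ∫ x, h x * F (x - -y) ∂μ := hc.comp continuous_neg
  have lim := ContDiffBump.convolution_tendsto_right_of_continuous (μ := μ) hφ hc' 0
  simp only [neg_zero, sub_zero] at lim
  refine lim.congr fun n => ?_
  have hn : Integrable ((φ n).normed μ) μ := (φ n).integrable_normed
  have int : Integrable (Function.uncurry fun x y => h x * ((φ n).normed μ y * F (x - y)))
      (μ.prod μ) := by
    have i1 : Integrable (fun p : V × V => h p.1 ^ 2 * (φ n).normed μ p.2) (μ.prod μ) :=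
      hh.integrable_sq.mul_prod hn
    have i2 : Integrable (fun p : V × V => (φ n).normed μ p.2 * F (p.1 - p.2) ^ 2) (μ.prod μ) :=
      hn.convolution_integrand (ContinuousLinearMap.lsmul ℝ ℝ) hF.integrable_sq
    refine (i1.add i2).mono' ?_ ?_
    · refine (hh.1.comp_fst).mul ((hn.1.comp_snd).mul ?_)
      exact hF.1.comp_quasiMeasurePreserving (quasiMeasurePreserving_sub μ μ)
    · refine ae_of_all _ fun p => ?_
      have hp : 0 ≤ (φ n).normed μ p.2 := (φ n).nonneg_normed _
      simp only [Function.uncurry, Pi.add_apply, norm_mul, Real.norm_eq_abs, abs_of_nonneg hp]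
      have : |h p.1| * |F (p.1 - p.2)| ≤ h p.1 ^ 2 + F (p.1 - p.2) ^ 2 := by
        nlinarith [sq_abs (h p.1), sq_abs (F (p.1 - p.2)), sq_nonneg (|h p.1| - |F (p.1 - p.2)|),
          sq_nonneg (|h p.1|), sq_nonneg (|F (p.1 - p.2)|)]
      nlinarith [mul_le_mul_of_nonneg_left this hp]
  simp only [convolution_def, ContinuousLinearMap.lsmul_apply, smul_eq_mul, zero_sub, neg_neg]
  calc ∫ t, (φ n).normed μ t * ∫ x, h x * F (x - t) ∂μ ∂μ
      = ∫ t, ∫ x, h x * ((φ n).normed μ t * F (x - t)) ∂μ ∂μ := by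
        refine integral_congr_ae (ae_of_all _ fun t => ?_)
        simp only
        rw [← integral_const_mul]
        exact integral_congr_ae (ae_of_all _ fun x => by simp only; ring)
    _ = ∫ x, ∫ t, h x * ((φ n).normed μ t * F (x - t)) ∂μ ∂μ := (integral_integral_swap int).symm
    _ = _ := integral_congr_ae (ae_of_all _ fun x => by simp only [integral_const_mul])

/-- `f'` is the derivative of `f` in the direction `e`, in the sense of distributions. -/
def HasWeakLineDeriv (μ : Measure V) (f f' : V → ℝ) (e : V) : Prop :=
  ∀ φ : V → ℝ, ContDiff ℝ (⊤ : ℕ∞) φ → HasCompactSupport φ →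
    ∫ x, f x * fderiv ℝ φ x e ∂μ = -∫ x, f' x * φ x ∂μ

/-- The derivative falls on the kernel, and `y ↦ φ(x - y)` is itself a test function. The sign
produced by the reflection cancels the one in the definition of the weak derivative. -/
theorem HasWeakLineDeriv.fderiv_convolution {f f' : V → ℝ} {e : V}
    (hw : HasWeakLineDeriv μ f f' e) (hf : LocallyIntegrable f μ) (φ : ContDiffBump (0 : V))
    (x : V) :
    fderiv ℝ (φ.normed μ ⋆[ContinuousLinearMap.lsmul ℝ ℝ, μ] f) x e =
      (φ.normed μ ⋆[ContinuousLinearMap.lsmul ℝ ℝ, μ] f') x := by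
  have hs : ContDiff ℝ (⊤ : ℕ∞) (φ.normed μ) := φ.contDiff_normed
  have hcs : HasCompactSupport (φ.normed μ) := φ.hasCompactSupport_normed
  have hd := (hcs.hasFDerivAt_convolution_left (ContinuousLinearMap.lsmul ℝ ℝ)
    (hs.of_le (by exact_mod_cast le_top)) hf x).fderiv
  rw [hd, convolution_eq_swap]
  have hfd : HasCompactSupport (fderiv ℝ (φ.normed μ)) := hcs.fderiv ℝ
  have hex : ConvolutionExistsAt (fderiv ℝ (φ.normed μ)) f x
      (ContinuousLinearMap.precompL V (ContinuousLinearMap.lsmul ℝ ℝ)) μ :=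
    hfd.convolutionExists_left _ (hs.continuous_fderiv (by simp)) hf x
  rw [ContinuousLinearMap.integral_apply hex.integrable_swap, convolution_eq_swap]
  have hφ : ∀ y, HasFDerivAt (fun y => φ.normed μ (x - y)) (-(fderiv ℝ (φ.normed μ) (x - y))) y := by
    intro y
    have h1 := (hs.differentiable (by simp) (x - y)).hasFDerivAt
    have h2 : HasFDerivAt (fun y : V => x - y) (-(ContinuousLinearMap.id ℝ V)) y :=
      (hasFDerivAt_id y).const_sub x
    have := h1.comp y h2
    rw [ContinuousLinearMap.comp_neg, ContinuousLinearMap.comp_id] at this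
    exact this
  have := hw (fun y => φ.normed μ (x - y)) (hs.comp (contDiff_const.sub contDiff_id))
    (hcs.comp_homeomorph (Homeomorph.subLeft x))
  simp only [(hφ _).fderiv] at this
  simp only [neg_apply, mul_neg, integral_neg, neg_inj] at this
  simp only [ContinuousLinearMap.lsmul_apply, smul_eq_mul]
  calc _ = ∫ y, f y * fderiv ℝ (φ.normed μ) (x - y) e ∂μ :=
        integral_congr_ae (ae_of_all _ fun y => by
          simp [ContinuousLinearMap.precompL_apply, mul_comm])
    _ = ∫ y, f' y * φ.normed μ (x - y) ∂μ := this
    _ = _ := integral_congr_ae (ae_of_all _ fun y => by simp only; ring)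

omit [NormedSpace ℝ V] [FiniteDimensional ℝ V] [μ.IsAddHaarMeasure] in
theorem memLp_mul_of_hasCompactSupport {g ψ : V → ℝ} (hg : MemLp g 2 μ) (hψ : Continuous ψ)
    (hc : HasCompactSupport ψ) : MemLp (fun x => g x * ψ x) 2 μ := by
  have h1 : MemLp ψ ∞ μ := hψ.memLp_top_of_hasCompactSupport hc μ
  exact h1.mul hg

/-- Mollifying `f` alone is enough: `ψ` times the mollified `f` is a test function for `g`. In the
resulting identity the mollifications of `f` and `f'` are paired with fixed `L²` functions, so weak
convergence suffices. -/
theorem HasWeakLineDeriv.mul_of_hasCompactSupport {f f' g g' ψ : V → ℝ} {e : V}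
    (hwf : HasWeakLineDeriv μ f f' e) (hwg : HasWeakLineDeriv μ g g' e)
    (hf : MemLp f 2 μ) (hf' : MemLp f' 2 μ) (hg : MemLp g 2 μ) (hg' : MemLp g' 2 μ)
    (hψ : ContDiff ℝ (⊤ : ℕ∞) ψ) (hc : HasCompactSupport ψ) :
    ∫ x, f x * g x * fderiv ℝ ψ x e ∂μ = -∫ x, (f' x * g x + f x * g' x) * ψ x ∂μ := by
  obtain ⟨φ, hφ⟩ : ∃ φ : ℕ → ContDiffBump (0 : V), Tendsto (fun n => (φ n).rOut) atTop (𝓝 0) :=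
    ⟨fun n => ⟨1 / (2 * ((n : ℝ) + 1)), 1 / ((n : ℝ) + 1), by positivity, by
      apply one_div_lt_one_div_of_lt <;> nlinarith [(n.cast_nonneg : (0 : ℝ) ≤ n)]⟩,
      tendsto_one_div_add_atTop_nhds_zero_nat⟩
  have hdψ : Continuous fun x => fderiv ℝ ψ x e :=
    (hψ.continuous_fderiv (by simp)).clm_apply continuous_const
  have hdc : HasCompactSupport fun x => fderiv ℝ ψ x e := hc.fderiv_apply ℝ e
  have m1 := memLp_mul_of_hasCompactSupport hg hψ.continuous hc
  have m2 := memLp_mul_of_hasCompactSupport hg hdψ hdc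
  have m3 := memLp_mul_of_hasCompactSupport hg' hψ.continuous hc
  have hfl : LocallyIntegrable f μ := hf.locallyIntegrable (by norm_num)
  have hfl' : LocallyIntegrable f' μ := hf'.locallyIntegrable (by norm_num)
  have t1 := tendsto_integral_mul_convolution m1 hf' hφ
  have t2 := tendsto_integral_mul_convolution m2 hf hφ
  have t3 := tendsto_integral_mul_convolution m3 hf hφ
  have hcont : ∀ n (F : V → ℝ), LocallyIntegrable F μ →
      ContDiff ℝ (⊤ : ℕ∞) ((φ n).normed μ ⋆[ContinuousLinearMap.lsmul ℝ ℝ, μ] F) := fun n F hF =>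
    (φ n).hasCompactSupport_normed.contDiff_convolution_left _ (φ n).contDiff_normed hF
  have int : ∀ (G ζ v : V → ℝ), MemLp G 2 μ → Continuous ζ → HasCompactSupport ζ →
      Continuous v → Integrable (fun x => G x * ζ x * v x) μ := by
    intro G ζ v hG hζ hζc hv
    have : LocallyIntegrable G μ := hG.locallyIntegrable (by norm_num)
    have := this.integrable_smul_right_of_hasCompactSupport (g := fun x => ζ x * v x)
      (hζ.mul hv) hζc.mul_right
    refine this.congr (ae_of_all _ fun x => ?_)
    simp only [smul_eq_mul]; ring
  have eq : ∀ n, (∫ x, g x * ψ x * ((φ n).normed μ ⋆[ContinuousLinearMap.lsmul ℝ ℝ, μ] f') x ∂μ)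
      + (∫ x, g x * fderiv ℝ ψ x e *
          ((φ n).normed μ ⋆[ContinuousLinearMap.lsmul ℝ ℝ, μ] f) x ∂μ) =
      -∫ x, g' x * ψ x * ((φ n).normed μ ⋆[ContinuousLinearMap.lsmul ℝ ℝ, μ] f) x ∂μ := by
    intro n
    set v := (φ n).normed μ ⋆[ContinuousLinearMap.lsmul ℝ ℝ, μ] f with hv
    have hvs : ContDiff ℝ (⊤ : ℕ∞) v := hcont n f hfl
    have := hwg (fun x => ψ x * v x) (hψ.mul hvs) hc.mul_right
    rw [← integral_add (int g ψ _ hg hψ.continuous hc (hcont n f' hfl').continuous)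
      (int g _ v hg hdψ hdc hvs.continuous)]
    calc _ = ∫ x, g x * fderiv ℝ (fun x => ψ x * v x) x e ∂μ := by
          refine integral_congr_ae (ae_of_all _ fun x => ?_)
          have h1 := (hψ.differentiable (by simp) x).hasFDerivAt.mul
            (hvs.differentiable (by simp) x).hasFDerivAt
          have h2 : fderiv ℝ (fun x => ψ x * v x) x = _ := h1.fderiv
          have h3 := hwf.fderiv_convolution hfl (φ n) x
          simp only [h2, add_apply, smul_apply, smul_eq_mul]
          rw [← hv] at h3
          rw [h3]
          ring
      _ = _ := by
          rw [this]
          congr 1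
          exact integral_congr_ae (ae_of_all _ fun x => by simp only; ring)
  have lim := tendsto_nhds_unique ((t1.add t2).congr eq) t3.neg
  have i1 : Integrable (fun x => g x * ψ x * f' x) μ := m1.integrable_mul hf'
  have i3 : Integrable (fun x => g' x * ψ x * f x) μ := m3.integrable_mul hf
  have : ∫ x, (f' x * g x + f x * g' x) * ψ x ∂μ =
      (∫ x, g x * ψ x * f' x ∂μ) + ∫ x, g' x * ψ x * f x ∂μ := by
    rw [← integral_add i1 i3]
    exact integral_congr_ae (ae_of_all _ fun x => by simp only; ring)
  rw [this, show (∫ x, f x * g x * fderiv ℝ ψ x e ∂μ) = ∫ x, g x * fderiv ℝ ψ x e * f x ∂μ from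
    integral_congr_ae (ae_of_all _ fun x => by simp only; ring)]
  linarith

/-- The weak product rule, tested against a smooth function which is bounded together with its
derivative. -/
theorem HasWeakLineDeriv.mul_of_bounded {f f' g g' ψ : V → ℝ} {e : V}
    (hwf : HasWeakLineDeriv μ f f' e) (hwg : HasWeakLineDeriv μ g g' e)
    (hf : MemLp f 2 μ) (hf' : MemLp f' 2 μ) (hg : MemLp g 2 μ) (hg' : MemLp g' 2 μ)
    (hψ : ContDiff ℝ (⊤ : ℕ∞) ψ) {A B : ℝ} (hA : ∀ x, |ψ x| ≤ A)
    (hB : ∀ x, |fderiv ℝ ψ x e| ≤ B) :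
    ∫ x, f x * g x * fderiv ℝ ψ x e ∂μ = -∫ x, (f' x * g x + f x * g' x) * ψ x ∂μ := by
  -- Truncate `ψ` by `ζ(r x)` with `r → 0`. The derivative of the truncation carries a factor `r`,
  -- and products of `L²` functions dominate everything else.
  let ζ : ContDiffBump (0 : V) := ⟨1, 2, by norm_num, by norm_num⟩
  have hζs : ContDiff ℝ (⊤ : ℕ∞) (ζ : V → ℝ) := ζ.contDiff
  have hζ1 : ∀ y, |ζ y| ≤ 1 := fun y => by
    rw [abs_of_nonneg ζ.nonneg]; exact ζ.le_one
  obtain ⟨M, hM⟩ : ∃ M, ∀ y, ‖fderiv ℝ ζ y e‖ ≤ M :=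
    (((hζs.continuous_fderiv (by simp)).clm_apply continuous_const).bounded_above_of_compact_support
      (ζ.hasCompactSupport.fderiv_apply ℝ e))
  have hA0 : 0 ≤ A := (abs_nonneg _).trans (hA 0)
  have hM0 : 0 ≤ M := (norm_nonneg _).trans (hM 0)
  let r : ℕ → ℝ := fun n => 1 / ((n : ℝ) + 1)
  have hr0 : ∀ n, 0 < r n := fun n => by positivity
  have hr1 : ∀ n, r n ≤ 1 := fun n => by
    simp only [r]; rw [div_le_one (by positivity)]; linarith [(n.cast_nonneg : (0 : ℝ) ≤ n)]
  have hrt : Tendsto r atTop (𝓝 0) := tendsto_one_div_add_atTop_nhds_zero_nat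
  have hzd : ∀ n x, HasFDerivAt (fun x => ζ (r n • x)) (r n • fderiv ℝ ζ (r n • x)) x := by
    intro n x
    have h1 := (hζs.differentiable (by simp) (r n • x)).hasFDerivAt
    have h2 : HasFDerivAt (fun y : V => r n • y) (r n • ContinuousLinearMap.id ℝ V) x :=
      (hasFDerivAt_id x).const_smul (r n)
    have := h1.comp x h2
    rw [ContinuousLinearMap.comp_smul, ContinuousLinearMap.comp_id] at this
    exact this
  have hd : ∀ n x, fderiv ℝ (fun x => ψ x * ζ (r n • x)) x e =
      ψ x * (r n * fderiv ℝ ζ (r n • x) e) + ζ (r n • x) * fderiv ℝ ψ x e := by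
    intro n x
    have h1 := (hψ.differentiable (by simp) x).hasFDerivAt.mul (hzd n x)
    have h2 : fderiv ℝ (fun x => ψ x * ζ (r n • x)) x = _ := h1.fderiv
    simp only [h2, add_apply, smul_apply, smul_eq_mul]
  have hsm : ∀ n, ContDiff ℝ (⊤ : ℕ∞) fun x => ψ x * ζ (r n • x) := fun n =>
    hψ.mul (hζs.comp (contDiff_const.smul contDiff_id))
  have hcs : ∀ n, HasCompactSupport fun x => ψ x * ζ (r n • x) := fun n =>
    (ζ.hasCompactSupport.comp_smul (hr0 n).ne').mul_left
  have eq := fun n => hwf.mul_of_hasCompactSupport hwg hf hf' hg hg' (hsm n) (hcs n)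
  have hζt : ∀ x, Tendsto (fun n => ζ (r n • x)) atTop (𝓝 1) := by
    intro x
    have h0 : Tendsto (fun n => r n • x) atTop (𝓝 0) := by simpa using hrt.smul_const x
    have := (ζ.continuous.tendsto 0).comp h0
    rwa [ζ.one_of_mem_closedBall (by simp [ζ.rIn_pos.le])] at this
  have ifg : Integrable (fun x => f x * g x) μ := hf.integrable_mul hg
  have ifg' : Integrable (fun x => f' x * g x + f x * g' x) μ :=
    (hf'.integrable_mul hg).add (hf.integrable_mul hg')
  have l1 : Tendsto (fun n => ∫ x, f x * g x * fderiv ℝ (fun x => ψ x * ζ (r n • x)) x e ∂μ) atTop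
      (𝓝 (∫ x, f x * g x * fderiv ℝ ψ x e ∂μ)) := by
    refine tendsto_integral_of_dominated_convergence (fun x => ‖f x * g x‖ * (A * M + B)) ?_
      (ifg.norm.mul_const _) ?_ ?_
    · exact fun n => ifg.1.mul
        (((hsm n).continuous_fderiv (by simp)).clm_apply continuous_const).aestronglyMeasurable
    · refine fun n => ae_of_all _ fun x => ?_
      rw [norm_mul, hd]
      refine mul_le_mul_of_nonneg_left ?_ (norm_nonneg _)
      refine (norm_add_le _ _).trans (add_le_add ?_ ?_)
      · rw [norm_mul, norm_mul]
        refine mul_le_mul (hA x) ?_ (by positivity) hA0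
        rw [Real.norm_of_nonneg (hr0 n).le]
        calc r n * _ ≤ 1 * M := mul_le_mul (hr1 n) (hM _) (norm_nonneg _) zero_le_one
          _ = M := one_mul M
      · rw [norm_mul]
        calc _ ≤ 1 * B := mul_le_mul (hζ1 _) (hB x) (abs_nonneg _) zero_le_one
          _ = B := one_mul B
    · refine ae_of_all _ fun x => ?_
      simp only [hd]
      have h1 : Tendsto (fun n => r n * fderiv ℝ ζ (r n • x) e) atTop (𝓝 0) := by
        refine squeeze_zero_norm (a := fun n => r n * M) (fun n => ?_) (by simpa using hrt.mul_const M)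
        rw [norm_mul, Real.norm_of_nonneg (hr0 n).le]
        exact mul_le_mul_of_nonneg_left (hM _) (hr0 n).le
      have := ((h1.const_mul (ψ x)).add ((hζt x).mul_const (fderiv ℝ ψ x e))).const_mul (f x * g x)
      simpa using this
  have l2 : Tendsto (fun n => ∫ x, (f' x * g x + f x * g' x) * (ψ x * ζ (r n • x)) ∂μ) atTop
      (𝓝 (∫ x, (f' x * g x + f x * g' x) * ψ x ∂μ)) := by
    refine tendsto_integral_of_dominated_convergence
      (fun x => ‖f' x * g x + f x * g' x‖ * A) ?_ (ifg'.norm.mul_const _) ?_ ?_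
    · exact fun n => ifg'.1.mul (hsm n).continuous.aestronglyMeasurable
    · refine fun n => ae_of_all _ fun x => ?_
      rw [norm_mul, norm_mul]
      refine mul_le_mul_of_nonneg_left ?_ (norm_nonneg _)
      calc _ ≤ A * 1 := mul_le_mul (hA x) (hζ1 _) (abs_nonneg _) hA0
        _ = A := mul_one A
    · refine ae_of_all _ fun x => ?_
      have := ((hζt x).const_mul (ψ x)).const_mul (f' x * g x + f x * g' x)
      simpa using this
  exact tendsto_nhds_unique l1 (l2.neg.congr fun n => (eq n).symm)

end WeakProduct

/-! ### Virial identity and the weighted Hardy type inequality -/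

section WeightedEstimate

variable {d : ℕ}

theorem HasWeakGradient.hasWeakLineDeriv {v : Vec d → Vec d}
    {G : Vec d → Matrix (Fin d) (Fin d) ℝ} (h : HasWeakGradient v G) (i j : Fin d) :
    HasWeakLineDeriv volume (fun x => v x i) (fun x => G x i j) (EuclideanSpace.single j 1) :=
  fun φ hφ hc => h.2.2 φ hφ hc i j

theorem memLp_component {α : Type*} [MeasurableSpace α] {μ : Measure α} {p : ℝ≥0∞}
    {v : α → Vec d} (hv : MemLp v p μ) (i : Fin d) : MemLp (fun x => v x i) p μ :=
  hv.continuousLinearMap_comp (EuclideanSpace.proj i : Vec d →L[ℝ] ℝ)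

theorem clm_apply_eq_sum (L : Vec d →L[ℝ] ℝ) (x : Vec d) :
    L x = ∑ i, x i * L (EuclideanSpace.single i 1) := by
  conv_lhs => rw [← (EuclideanSpace.basisFun (Fin d) ℝ).sum_repr x]
  simp [map_sum]

/-- The weak gradient of a weakly divergence free field is trace free. -/
theorem IsWeakDivFree.trace_eq_zero {v : Vec d → Vec d}
    {G : Vec d → Matrix (Fin d) (Fin d) ℝ} (hdiv : IsWeakDivFree v) (h : HasWeakGradient v G) :
    ∀ᵐ x, ∑ i, G x i i = 0 := by
  have hloc : LocallyIntegrable (fun x => ∑ i, G x i i) := by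
    exact locallyIntegrable_finsetSum _ fun i _ => h.2.1 i i
  refine ae_eq_zero_of_integral_contDiff_smul_eq_zero hloc fun φ hφ hc => ?_
  have hvi : ∀ i, LocallyIntegrable fun x => v x i := fun i => by
    intro x
    obtain ⟨s, hs, hi⟩ := hdiv.1 x
    exact ⟨s, hs, (EuclideanSpace.proj i : Vec d →L[ℝ] ℝ).integrable_comp hi⟩
  have h0 := hdiv.2 φ hφ hc
  simp only [fun x => clm_apply_eq_sum (fderiv ℝ φ x) (v x)] at h0
  rw [integral_finsetSum] at h0
  · simp only [smul_eq_mul, Finset.mul_sum]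
    rw [integral_finsetSum]
    · have : ∀ i, ∫ x, v x i * fderiv ℝ φ x (EuclideanSpace.single i 1) = -∫ x, φ x * G x i i := by
        intro i
        rw [h.2.2 φ hφ hc i i]
        simp only [mul_comm]
      simp only [this, Finset.sum_neg_distrib, neg_eq_zero] at h0
      exact h0
    · intro i _
      simpa only [smul_eq_mul] using
        (h.2.1 i i).integrable_smul_left_of_hasCompactSupport hφ.continuous hc
  · intro i _
    simpa only [smul_eq_mul] using (hvi i).integrable_smul_right_of_hasCompactSupport
      ((hφ.continuous_fderiv (by simp)).clm_apply continuous_const) (hc.fderiv_apply ℝ _)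

/-- The virial identity: a square integrable divergence free field with square integrable
gradient, tested against the multiplier `W`; only the symmetric gradient enters. -/
theorem virial_identity {v : Vec d → Vec d} {G : Vec d → Matrix (Fin d) (Fin d) ℝ}
    (hv : MemLp v 2) (hG : ∀ i j, MemLp (fun x => G x i j) 2) (hw : HasWeakGradient v G)
    (hdiv : IsWeakDivFree v) {W : Fin d → Vec d → ℝ} (hW : ∀ i, ContDiff ℝ (⊤ : ℕ∞) (W i))
    {A B : ℝ} (hA : ∀ i x, |W i x| ≤ A)
    (hB : ∀ i j x, |fderiv ℝ (W i) x (EuclideanSpace.single j 1)| ≤ B) :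
    Integrable (fun x => ∑ i, ∑ j,
        (v x j * v x j * fderiv ℝ (W i) x (EuclideanSpace.single i 1) +
          2 * (v x i * v x j * fderiv ℝ (W i) x (EuclideanSpace.single j 1)))) ∧
    Integrable (fun x => ∑ i, ∑ j, v x j * (G x i j + G x j i) * W i x) ∧
    ∫ x, ∑ i, ∑ j, (v x j * v x j * fderiv ℝ (W i) x (EuclideanSpace.single i 1) +
        2 * (v x i * v x j * fderiv ℝ (W i) x (EuclideanSpace.single j 1))) =
      -(2 * ∫ x, ∑ i, ∑ j, v x j * (G x i j + G x j i) * W i x) := by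
  have hvc := fun i => memLp_component hv i
  have iW : ∀ (i : Fin d) (F : Vec d → ℝ), Integrable F → Integrable fun x => F x * W i x :=
    fun i F hF => hF.mul_bdd (c := A) (hW i).continuous.aestronglyMeasurable
      (ae_of_all _ (hA i))
  have idW : ∀ (i j : Fin d) (F : Vec d → ℝ), Integrable F →
      Integrable fun x => F x * fderiv ℝ (W i) x (EuclideanSpace.single j 1) :=
    fun i j F hF => hF.mul_bdd (c := B)
      (((hW i).continuous_fderiv (by simp)).clm_apply continuous_const).aestronglyMeasurable
      (ae_of_all _ (hB i j))
  have ivv : ∀ i j, Integrable fun x => v x i * v x j := fun i j => (hvc i).integrable_mul (hvc j)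
  have iGv : ∀ i j k, Integrable fun x => v x i * G x j k := fun i j k =>
    (hvc i).integrable_mul (hG j k)
  have i1 : ∀ i j, Integrable fun x =>
      v x j * v x j * fderiv ℝ (W i) x (EuclideanSpace.single i 1) := fun i j => idW i i _ (ivv j j)
  have i2 : ∀ i j, Integrable fun x =>
      v x i * v x j * fderiv ℝ (W i) x (EuclideanSpace.single j 1) := fun i j => idW i j _ (ivv i j)
  have i12 : ∀ i j, Integrable fun x =>
      v x j * v x j * fderiv ℝ (W i) x (EuclideanSpace.single i 1) +
          2 * (v x i * v x j * fderiv ℝ (W i) x (EuclideanSpace.single j 1)) := fun i j =>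
    (i1 i j).add ((i2 i j).const_mul 2)
  have i3 : ∀ i j, Integrable fun x => v x j * (G x i j + G x j i) * W i x := fun i j => by
    refine iW i _ ?_
    simp only [mul_add]
    exact (iGv j i j).add (iGv j j i)
  have i4 : ∀ i j, Integrable fun x => v x i * G x j j * W i x := fun i j => iW i _ (iGv i j j)
  refine ⟨integrable_finsetSum _ fun i _ => integrable_finsetSum _ fun j _ => i12 i j,
    integrable_finsetSum _ fun i _ => integrable_finsetSum _ fun j _ => i3 i j, ?_⟩
  -- Apply the product rule to `v_j v_j` in direction `i` and twice to `v_i v_j` in direction `j`.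
  -- The gradients combine into their symmetric part, up to `v_i ∂_j v_j`, which sums over `j` to
  -- `v_i div v = 0`.
  have key : ∀ i j, ∫ x, (v x j * v x j * fderiv ℝ (W i) x (EuclideanSpace.single i 1) +
      2 * (v x i * v x j * fderiv ℝ (W i) x (EuclideanSpace.single j 1))) =
      -(2 * ∫ x, v x j * (G x i j + G x j i) * W i x) - 2 * ∫ x, v x i * G x j j * W i x := by
    intro i j
    have e1 := (hw.hasWeakLineDeriv j i).mul_of_bounded (hw.hasWeakLineDeriv j i) (hvc j) (hG j i)
      (hvc j) (hG j i) (hW i) (hA i) (hB i i)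
    have e2 := (hw.hasWeakLineDeriv i j).mul_of_bounded (hw.hasWeakLineDeriv j j) (hvc i) (hG i j)
      (hvc j) (hG j j) (hW i) (hA i) (hB i j)
    rw [integral_add (i1 i j) ((i2 i j).const_mul 2), integral_const_mul, e1, e2]
    have f1 : ∫ x, (G x j i * v x j + v x j * G x j i) * W i x =
        2 * ∫ x, v x j * G x j i * W i x := by
      rw [← integral_const_mul]
      exact integral_congr_ae (ae_of_all _ fun x => by simp only; ring)
    have f2 : ∫ x, (G x i j * v x j + v x i * G x j j) * W i x =
        (∫ x, v x j * G x i j * W i x) + ∫ x, v x i * G x j j * W i x := by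
      rw [← integral_add (iW i _ (iGv j i j)) (i4 i j)]
      exact integral_congr_ae (ae_of_all _ fun x => by simp only; ring)
    have f3 : ∫ x, v x j * (G x i j + G x j i) * W i x =
        (∫ x, v x j * G x i j * W i x) + ∫ x, v x j * G x j i * W i x := by
      rw [← integral_add (iW i _ (iGv j i j)) (iW i _ (iGv j j i))]
      exact integral_congr_ae (ae_of_all _ fun x => by simp only; ring)
    rw [f1, f2, f3]
    ring
  have tr : ∀ i, ∑ j, ∫ x, v x i * G x j j * W i x = 0 := by
    intro i
    rw [← integral_finsetSum _ fun j _ => i4 i j]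
    refine integral_eq_zero_of_ae ?_
    filter_upwards [hdiv.trace_eq_zero hw] with x hx
    rw [← Finset.sum_mul, ← Finset.mul_sum, hx]
    simp
  rw [integral_finsetSum _ fun i _ => integrable_finsetSum _ fun j _ => i12 i j,
    integral_finsetSum _ fun i _ => integrable_finsetSum _ fun j _ => i3 i j]
  simp_rw [integral_finsetSum _ fun j (_ : j ∈ Finset.univ) => i12 _ j,
    integral_finsetSum _ fun j (_ : j ∈ Finset.univ) => i3 _ j, key, Finset.sum_sub_distrib,
    ← Finset.mul_sum, tr, Finset.sum_neg_distrib, ← Finset.mul_sum]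
  simp

theorem contract_self_nonneg (A : Matrix (Fin d) (Fin d) ℝ) : 0 ≤ contract A A :=
  Finset.sum_nonneg fun _ _ => Finset.sum_nonneg fun _ _ => mul_self_nonneg _

theorem contract_sq_le (A B : Matrix (Fin d) (Fin d) ℝ) :
    contract A B ^ 2 ≤ contract A A * contract B B := by
  simp only [contract, ← Fintype.sum_prod_type']
  have := Finset.sum_mul_sq_le_sq_mul_sq (Finset.univ : Finset (Fin d × Fin d))
    (fun p => A p.1 p.2) (fun p => B p.1 p.2)
  simpa only [pow_two] using this

theorem norm_sq_eq_sum (x : Vec d) : ‖x‖ ^ 2 = ∑ i, x i * x i := by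
  rw [EuclideanSpace.norm_sq_eq]
  exact Finset.sum_congr rfl fun i _ => by rw [Real.norm_eq_abs, sq_abs, pow_two]

/-- Cauchy–Schwarz between `A` and the rank one matrix built from `v` and `w`. -/
theorem abs_sum_mul_mul_le (A : Matrix (Fin d) (Fin d) ℝ) (v w : Vec d) :
    |∑ i, ∑ j, v j * A i j * w i| ≤ ‖v‖ * √(contract A A) * ‖w‖ := by
  have h := contract_sq_le A (Matrix.of fun i j => v j * w i)
  have h1 : contract A (Matrix.of fun i j => v j * w i) = ∑ i, ∑ j, v j * A i j * w i :=
    Finset.sum_congr rfl fun i _ => Finset.sum_congr rfl fun j _ => by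
      simp only [Matrix.of_apply]; ring
  have h2 : contract (Matrix.of fun i j => v j * w i) (Matrix.of fun i j => v j * w i) =
      ‖v‖ ^ 2 * ‖w‖ ^ 2 := by
    rw [norm_sq_eq_sum, norm_sq_eq_sum, Finset.sum_mul_sum, Finset.sum_comm]
    exact Finset.sum_congr rfl fun i _ => Finset.sum_congr rfl fun j _ => by
      simp only [Matrix.of_apply]; ring
  rw [h1, h2] at h
  refine abs_le_of_sq_le_sq (h.trans (le_of_eq ?_)) (by positivity)
  rw [mul_pow, mul_pow, Real.sq_sqrt (contract_self_nonneg A)]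
  ring

/-- The weight `(|x - c|² + a²)^(-d/4)`. -/
def weight (d : ℕ) (a : ℝ) (c x : Vec d) : ℝ := (‖x - c‖ ^ 2 + a ^ 2) ^ (-(d / 4 : ℝ))

theorem weight_nonneg (a : ℝ) (c x : Vec d) : 0 ≤ weight d a c x :=
  Real.rpow_nonneg (by positivity) _

theorem weight_le {a : ℝ} (ha : 0 < a) (c x : Vec d) :
    weight d a c x ≤ (a ^ 2) ^ (-(d / 4 : ℝ)) := by
  refine Real.rpow_le_rpow_of_nonpos (by positivity) (by nlinarith [sq_nonneg ‖x - c‖]) ?_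
  have : (0 : ℝ) ≤ d := d.cast_nonneg
  linarith

theorem continuous_weight {a : ℝ} (ha : 0 < a) (c : Vec d) : Continuous (weight d a c) := by
  refine Continuous.rpow_const (by fun_prop) fun x => Or.inl ?_
  positivity

theorem hasFDerivAt_weight {a : ℝ} (ha : 0 < a) (c x : Vec d) :
    HasFDerivAt (weight d a c)
      ((-(d / 4 : ℝ) * (‖x - c‖ ^ 2 + a ^ 2) ^ (-(d / 4 : ℝ) - 1)) •
        ((2 : ℝ) • innerSL ℝ (x - c))) x := by
  have h0 : HasFDerivAt (fun x : Vec d => x - c) (ContinuousLinearMap.id ℝ (Vec d)) x :=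
    (hasFDerivAt_id x).sub_const c
  have h1 : HasFDerivAt (fun x : Vec d => ‖x - c‖ ^ 2 + a ^ 2) ((2 : ℝ) • innerSL ℝ (x - c)) x := by
    have := (h0.norm_sq).add_const (a ^ 2)
    rw [ContinuousLinearMap.comp_id, ← Nat.cast_smul_eq_nsmul ℝ] at this
    exact_mod_cast this
  exact h1.rpow_const (Or.inl (by positivity))

/-- The weighted multiplier `W(x) = (|x - c|² + a²)^(-d/4) (x - c)`. -/
def multiplier (d : ℕ) (a : ℝ) (c : Vec d) (i : Fin d) (x : Vec d) : ℝ :=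
  (x i - c i) * weight d a c x

theorem contDiff_multiplier {a : ℝ} (ha : 0 < a) (c : Vec d) (i : Fin d) :
    ContDiff ℝ (⊤ : ℕ∞) (multiplier d a c i) := by
  have h1 : ContDiff ℝ (⊤ : ℕ∞) fun x : Vec d => x i :=
    (EuclideanSpace.proj i : Vec d →L[ℝ] ℝ).contDiff
  refine (h1.sub contDiff_const).mul ?_
  refine ContDiff.rpow_const_of_ne ?_ fun x => by positivity
  exact ((contDiff_id.sub contDiff_const).norm_sq ℝ).add contDiff_const

theorem fderiv_multiplier {a : ℝ} (ha : 0 < a) (c : Vec d) (i j : Fin d) (x : Vec d) :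
    fderiv ℝ (multiplier d a c i) x (EuclideanSpace.single j 1) =
      weight d a c x * ((if i = j then 1 else 0) -
        (d / 2 : ℝ) * (x i - c i) * (x j - c j) / (‖x - c‖ ^ 2 + a ^ 2)) := by
  have h1 : HasFDerivAt (fun x : Vec d => x i - c i) (EuclideanSpace.proj i : Vec d →L[ℝ] ℝ) x :=
    (EuclideanSpace.proj i : Vec d →L[ℝ] ℝ).hasFDerivAt.sub_const _
  have h2 : fderiv ℝ (multiplier d a c i) x = _ := (h1.mul (hasFDerivAt_weight ha c x)).fderiv
  have hσ : 0 < ‖x - c‖ ^ 2 + a ^ 2 := by positivity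
  rw [h2, Real.rpow_sub_one hσ.ne']
  simp only [add_apply, smul_apply, smul_eq_mul, innerSL_apply_apply]
  have h3 : inner ℝ (x - c) (EuclideanSpace.single j (1 : ℝ)) = x j - c j := by
    simp [EuclideanSpace.inner_single_right]
  have h4 : (EuclideanSpace.proj i : Vec d →L[ℝ] ℝ) (EuclideanSpace.single j (1 : ℝ)) =
      if i = j then 1 else 0 := by
    simp
  rw [h3, h4, weight]
  field_simp
  ring

theorem abs_coord_le (x : Vec d) (i : Fin d) : |x i| ≤ ‖x‖ := by
  simpa using PiLp.norm_apply_le x i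

theorem norm_mul_weight_le (a : ℝ) (ha : 0 < a) (c x : Vec d) :
    ‖x - c‖ * weight d a c x ≤ (‖x - c‖ ^ 2 + a ^ 2) ^ (1 / 2 - d / 4 : ℝ) := by
  have hσ : 0 < ‖x - c‖ ^ 2 + a ^ 2 := by positivity
  rw [sub_eq_add_neg (1 / 2 : ℝ), Real.rpow_add hσ, weight, ← Real.sqrt_eq_rpow]
  refine mul_le_mul_of_nonneg_right (Real.le_sqrt_of_sq_le ?_) (Real.rpow_nonneg hσ.le _)
  nlinarith

/-- Coercivity of the virial form, which decides the exponent of the weight. The form equals the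
weight times `(d + 2) |v|²` minus two terms, at most `(d/2) |v|²` and `d |v|²`. What remains is `2 -
d/2`, hence at least `1/2` when `d ≤ 3`. -/
theorem sum_multiplier_ge (hd : d = 2 ∨ d = 3) {a : ℝ} (ha : 0 < a) (c x v : Vec d) :
    1 / 2 * (weight d a c x * ‖v‖ ^ 2) ≤
      ∑ i, ∑ j, (v j * v j * fderiv ℝ (multiplier d a c i) x (EuclideanSpace.single i 1) +
        2 * (v i * v j * fderiv ℝ (multiplier d a c i) x (EuclideanSpace.single j 1))) := by
  have hσ : 0 < ‖x - c‖ ^ 2 + a ^ 2 := by positivity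
  have hw := weight_nonneg a c x
  have hq : ‖x - c‖ ^ 2 / (‖x - c‖ ^ 2 + a ^ 2) ≤ 1 := by
    rw [div_le_one hσ]; nlinarith
  have hcs : (inner ℝ v (x - c)) ^ 2 / (‖x - c‖ ^ 2 + a ^ 2) ≤ ‖v‖ ^ 2 := by
    rw [div_le_iff₀ hσ]
    have h1 := abs_real_inner_le_norm v (x - c)
    have h2 : (inner ℝ v (x - c)) ^ 2 ≤ (‖v‖ * ‖x - c‖) ^ 2 := by
      rw [← sq_abs]; exact pow_le_pow_left₀ (abs_nonneg _) h1 2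
    nlinarith [mul_nonneg (sq_nonneg ‖v‖) (sq_nonneg a)]
  have eq : ∑ i, ∑ j, (v j * v j * fderiv ℝ (multiplier d a c i) x (EuclideanSpace.single i 1) +
        2 * (v i * v j * fderiv ℝ (multiplier d a c i) x (EuclideanSpace.single j 1))) =
      weight d a c x * ((d + 2) * ‖v‖ ^ 2 -
        d / 2 * (‖x - c‖ ^ 2 / (‖x - c‖ ^ 2 + a ^ 2) * ‖v‖ ^ 2) -
        d * ((inner ℝ v (x - c)) ^ 2 / (‖x - c‖ ^ 2 + a ^ 2))) := by
    simp only [fderiv_multiplier ha]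
    set w := weight d a c x
    set σ := ‖x - c‖ ^ 2 + a ^ 2 with hs
    have e1 : ‖x - c‖ ^ 2 = ∑ i, (x i - c i) * (x i - c i) := norm_sq_eq_sum _
    have e2 : inner ℝ v (x - c) = ∑ i, (x i - c i) * v i := by simp [PiLp.inner_apply]
    rw [e2, e1, norm_sq_eq_sum v]
    clear_value w σ
    clear e1 e2 hcs hq hw hs
    rcases hd with rfl | rfl
    · simp [Fin.sum_univ_two]
      field_simp
      ring
    · simp [Fin.sum_univ_three]
      field_simp
      ring
  rw [eq]
  have hv := sq_nonneg ‖v‖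
  have h3 : 1 / 2 * ‖v‖ ^ 2 ≤ (d + 2) * ‖v‖ ^ 2 -
        d / 2 * (‖x - c‖ ^ 2 / (‖x - c‖ ^ 2 + a ^ 2) * ‖v‖ ^ 2) -
        d * ((inner ℝ v (x - c)) ^ 2 / (‖x - c‖ ^ 2 + a ^ 2)) := by
    have h4 := mul_le_mul_of_nonneg_right hq hv
    have h5 : (d : ℝ) ≤ 3 := by rcases hd with rfl | rfl <;> norm_num
    have h6 : (0 : ℝ) ≤ d := d.cast_nonneg
    nlinarith [mul_le_mul_of_nonneg_left h4 h6, mul_le_mul_of_nonneg_left hcs h6,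
      mul_nonneg (sub_nonneg.2 h5) hv]
  calc _ = weight d a c x * (1 / 2 * ‖v‖ ^ 2) := by ring
    _ ≤ _ := mul_le_mul_of_nonneg_left h3 hw

/-- The left-hand side bounds the squared length of the multiplier, and this form lets it be
absorbed. For `d = 2` the exponent is zero. For `d = 3`, with `z` the power `-1/4`, the claim is `z²
≤ z³/4 + 16`, split at `z = 4`. -/
theorem rpow_sq_le_weight (hd : d = 2 ∨ d = 3) {a : ℝ} (ha : 0 < a) (c x : Vec d) :
    ((‖x - c‖ ^ 2 + a ^ 2) ^ (1 / 2 - d / 4 : ℝ)) ^ 2 ≤ weight d a c x / 4 + 16 := by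
  have hσ : 0 < ‖x - c‖ ^ 2 + a ^ 2 := by positivity
  rcases hd with rfl | rfl
  · have := weight_nonneg a c x
    norm_num
    linarith
  · rw [weight]
    have h0 : (1 / 2 - ((3 : ℕ) : ℝ) / 4 : ℝ) = -(1 / 4) := by norm_num
    have h1 : -(((3 : ℕ) : ℝ) / 4) = -(1 / 4) * (3 : ℕ) := by norm_num
    rw [h0, h1, Real.rpow_mul_natCast hσ.le]
    set z := (‖x - c‖ ^ 2 + a ^ 2) ^ (-(1 / 4) : ℝ)
    have hz : 0 ≤ z := Real.rpow_nonneg hσ.le _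
    rcases le_total z 4 with h | h <;> nlinarith [sq_nonneg z]

/-- A Hardy type inequality for divergence free fields which are rigid in `B`: only the symmetric
gradient, and the field outside `B`, enter the right-hand side. -/
theorem integral_weight_mul_norm_sq_le (hd : d = 2 ∨ d = 3) {v : Vec d → Vec d}
    {G : Vec d → Matrix (Fin d) (Fin d) ℝ}
    (hv : MemLp v 2) (hG : ∀ i j, MemLp (fun x => G x i j) 2) (hw : HasWeakGradient v G)
    (hdiv : IsWeakDivFree v) {B : Set (Vec d)} (hB : MeasurableSet B)
    (hrig : ∀ᵐ x ∂(volume.restrict B), symPart (G x) = 0) {a : ℝ} (ha : 0 < a) (c : Vec d) :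
    Integrable (fun x => weight d a c x * ‖v x‖ ^ 2) ∧
    ∫ x, weight d a c x * ‖v x‖ ^ 2 ≤
      64 * (∫ x in Bᶜ, ‖v x‖ ^ 2) + 16 * ∫ x, contract (symPart (G x)) (symPart (G x)) := by
  have hvsq : Integrable fun x => ‖v x‖ ^ 2 := hv.integrable_norm_pow (by norm_num)
  have hwv : Integrable fun x => weight d a c x * ‖v x‖ ^ 2 := by
    refine hvsq.bdd_mul (c := (a ^ 2) ^ (-(d / 4 : ℝ)))
      (continuous_weight ha c).aestronglyMeasurable (ae_of_all _ fun x => ?_)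
    rw [Real.norm_of_nonneg (weight_nonneg a c x)]
    exact weight_le ha c x
  refine ⟨hwv, ?_⟩
  have hd2 : (2 : ℝ) ≤ d := by rcases hd with rfl | rfl <;> norm_num
  -- This bound and the next depend on `a`. They only justify the virial identity and do not enter
  -- the final constants.
  have hA : ∀ i x, |multiplier d a c i x| ≤ (a ^ 2) ^ (1 / 2 - d / 4 : ℝ) := fun i x => by
    rw [multiplier, abs_mul, abs_of_nonneg (weight_nonneg a c x)]
    calc _ ≤ ‖x - c‖ * weight d a c x :=
          mul_le_mul_of_nonneg_right (abs_coord_le (x - c) i) (weight_nonneg a c x)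
      _ ≤ _ := norm_mul_weight_le a ha c x
      _ ≤ _ := Real.rpow_le_rpow_of_nonpos (by positivity) (by nlinarith [sq_nonneg ‖x - c‖])
          (by linarith)
  have hBd : ∀ i j x, |fderiv ℝ (multiplier d a c i) x (EuclideanSpace.single j 1)| ≤
      (a ^ 2) ^ (-(d / 4 : ℝ)) * (1 + d / 2) := fun i j x => by
    rw [fderiv_multiplier ha, abs_mul, abs_of_nonneg (weight_nonneg a c x)]
    refine mul_le_mul (weight_le ha c x) ?_ (abs_nonneg _) (by positivity)
    refine (abs_sub _ _).trans (add_le_add (by split_ifs <;> simp) ?_)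
    have hσ : 0 < ‖x - c‖ ^ 2 + a ^ 2 := by positivity
    rw [abs_div, abs_of_pos hσ, div_le_iff₀ hσ, abs_mul, abs_mul, abs_of_nonneg (by positivity),
      mul_assoc]
    refine mul_le_mul_of_nonneg_left ?_ (by positivity)
    calc _ ≤ ‖x - c‖ * ‖x - c‖ := mul_le_mul (abs_coord_le (x - c) i) (abs_coord_le (x - c) j)
          (abs_nonneg _) (norm_nonneg _)
      _ ≤ _ := by nlinarith
  obtain ⟨j1, j2, id⟩ := virial_identity hv hG hw hdiv (contDiff_multiplier ha c) hA hBd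
  have hDint : Integrable fun x => contract (symPart (G x)) (symPart (G x)) := by
    refine integrable_finsetSum _ fun i _ => integrable_finsetSum _ fun j _ => ?_
    have : MemLp (fun x => symPart (G x) i j) 2 := by
      simpa [symPart] using ((hG i j).add (hG j i)).const_mul (2⁻¹ : ℝ)
    exact this.integrable_mul this
  have low : 1 / 2 * ∫ x, weight d a c x * ‖v x‖ ^ 2 ≤
      ∫ x, ∑ i, ∑ j, (v x j * v x j *
        fderiv ℝ (multiplier d a c i) x (EuclideanSpace.single i 1) +
        2 * (v x i * v x j * fderiv ℝ (multiplier d a c i) x (EuclideanSpace.single j 1))) := by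
    rw [← integral_const_mul]
    exact integral_mono (hwv.const_mul _) j1 fun x => sum_multiplier_ge hd ha c x (v x)
  -- Pointwise the integrand is at most `4 |v| |D| z ≤ |v|² z² + 4 |D|²`, with `z² ≤ w/4 + 16` and
  -- `w` the weight. On `B` it vanishes, so the constant `16` is paid only outside `B`.
  have up : -(2 * ∫ x, ∑ i, ∑ j, v x j * (G x i j + G x j i) * multiplier d a c i x) ≤
      1 / 4 * (∫ x, weight d a c x * ‖v x‖ ^ 2) + 16 * (∫ x in Bᶜ, ‖v x‖ ^ 2) +
        4 * ∫ x, contract (symPart (G x)) (symPart (G x)) := by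
    have i1 := hwv.const_mul (1 / 4)
    have i2 := (hvsq.indicator hB.compl).const_mul 16
    have i3 := hDint.const_mul 4
    have i12 : Integrable fun x => 1 / 4 * (weight d a c x * ‖v x‖ ^ 2) +
        16 * Bᶜ.indicator (fun x => ‖v x‖ ^ 2) x := i1.add i2
    have hsum : ∫ x, (1 / 4 * (weight d a c x * ‖v x‖ ^ 2) +
        16 * Bᶜ.indicator (fun x => ‖v x‖ ^ 2) x +
        4 * contract (symPart (G x)) (symPart (G x))) =
        1 / 4 * (∫ x, weight d a c x * ‖v x‖ ^ 2) + 16 * (∫ x in Bᶜ, ‖v x‖ ^ 2) +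
        4 * ∫ x, contract (symPart (G x)) (symPart (G x)) := by
      rw [integral_add i12 i3, integral_add i1 i2, integral_const_mul, integral_const_mul,
        integral_const_mul, integral_indicator hB.compl]
    rw [← hsum, ← integral_const_mul, ← integral_neg]
    refine integral_mono_ae (j2.const_mul 2).neg (i12.add i3) ?_
    rw [ae_restrict_iff' hB] at hrig
    filter_upwards [hrig] with x hx
    set D := symPart (G x) with hD
    have e1 : ∑ i, ∑ j, v x j * (G x i j + G x j i) * multiplier d a c i x =
        2 * (weight d a c x * ∑ i, ∑ j, v x j * D i j * (x - c) i) := by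
      simp only [Finset.mul_sum]
      refine Finset.sum_congr rfl fun i _ => Finset.sum_congr rfl fun j _ => ?_
      simp only [hD, symPart, multiplier, Matrix.smul_apply, Matrix.add_apply,
        Matrix.transpose_apply, smul_eq_mul, PiLp.sub_apply]
      ring
    have hw0 := weight_nonneg a c x
    have hD0 : 0 ≤ contract D D := contract_self_nonneg D
    rw [e1]
    by_cases hxB : x ∈ B
    · have hz : D = 0 := hx hxB
      have hxc : x ∉ Bᶜ := fun h => h hxB
      have hc0 : contract (0 : Matrix (Fin d) (Fin d) ℝ) 0 = 0 := by simp [contract]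
      rw [indicator_of_notMem hxc, hz, hc0]
      simp only [Matrix.zero_apply, mul_zero, zero_mul, Finset.sum_const_zero]
      have := mul_nonneg hw0 (sq_nonneg ‖v x‖)
      linarith
    · have hxc : x ∈ Bᶜ := hxB
      rw [indicator_of_mem hxc]
      have h1 := abs_sum_mul_mul_le D (v x) (x - c)
      set Y := ∑ i, ∑ j, v x j * D i j * (x - c) i
      set z := (‖x - c‖ ^ 2 + a ^ 2) ^ (1 / 2 - d / 4 : ℝ) with hz
      have hz2 : z ^ 2 ≤ weight d a c x / 4 + 16 := rpow_sq_le_weight hd ha c x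
      have h2 : ‖x - c‖ * weight d a c x ≤ z := norm_mul_weight_le a ha c x
      have h3 : -(weight d a c x * Y) ≤ ‖v x‖ * √(contract D D) * z := by
        calc -(weight d a c x * Y) ≤ weight d a c x * |Y| := by
              nlinarith [neg_abs_le Y]
          _ ≤ weight d a c x * (‖v x‖ * √(contract D D) * ‖x - c‖) :=
              mul_le_mul_of_nonneg_left h1 hw0
          _ = ‖v x‖ * √(contract D D) * (‖x - c‖ * weight d a c x) := by ring
          _ ≤ _ := mul_le_mul_of_nonneg_left h2 (by positivity)
      have h4 : √(contract D D) ^ 2 = contract D D := Real.sq_sqrt hD0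
      nlinarith [sq_nonneg (‖v x‖ * z - 2 * √(contract D D)),
        mul_le_mul_of_nonneg_left hz2 (sq_nonneg ‖v x‖)]
  -- Absorbing `1/4` of the weighted integral into the lower bound `1/2` leaves `1/4`; hence `64 = 4
  -- · 16` and `16 = 4 · 4`.
  linarith [id ▸ low]

end WeightedEstimate

/-! ### Momentum and energy of the moving rigid body -/

section Body

variable {d : ℕ}

theorem act_eq_toEuclideanCLM (A : Matrix (Fin d) (Fin d) ℝ) (x : Vec d) :
    act A x = Matrix.toEuclideanCLM (𝕜 := ℝ) A x := rfl

theorem act_mul (A B : Matrix (Fin d) (Fin d) ℝ) (x : Vec d) :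
    act (A * B) x = act A (act B x) := by
  simp [act, Matrix.mulVec_mulVec]

theorem act_one (x : Vec d) : act 1 x = x := by
  simp [act]

theorem continuous_act (A : Matrix (Fin d) (Fin d) ℝ) : Continuous (act A) :=
  (Matrix.toEuclideanCLM (𝕜 := ℝ) A).continuous

theorem act_coord (A : Matrix (Fin d) (Fin d) ℝ) (x : Vec d) (i : Fin d) :
    act A x i = ∑ j, A i j * x j := rfl

theorem norm_act {Q : Matrix (Fin d) (Fin d) ℝ} (hQ : Q ∈ Matrix.orthogonalGroup (Fin d) ℝ)
    (x : Vec d) : ‖act Q x‖ = ‖x‖ := by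
  have h1 : Qᵀ * Q = 1 := (Matrix.mem_orthogonalGroup_iff' (Fin d) ℝ).1 hQ
  have h2 : ‖act Q x‖ ^ 2 = ‖x‖ ^ 2 := by
    have e : ∀ y : Vec d, ‖y‖ ^ 2 = WithLp.ofLp y ⬝ᵥ WithLp.ofLp y := fun y => norm_sq_eq_sum y
    rw [e, e]
    simp only [act]
    rw [Matrix.dotProduct_mulVec, Matrix.vecMul_mulVec, h1, Matrix.vecMul_one]
  exact (sq_eq_sq₀ (norm_nonneg _) (norm_nonneg _)).1 h2

theorem transpose_mem_orthogonalGroup {Q : Matrix (Fin d) (Fin d) ℝ}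
    (hQ : Q ∈ Matrix.orthogonalGroup (Fin d) ℝ) : Qᵀ ∈ Matrix.orthogonalGroup (Fin d) ℝ := by
  rw [Matrix.mem_orthogonalGroup_iff]
  rw [Matrix.mem_orthogonalGroup_iff'] at hQ
  simpa using hQ

theorem act_act_transpose {Q : Matrix (Fin d) (Fin d) ℝ}
    (hQ : Q ∈ Matrix.orthogonalGroup (Fin d) ℝ) (x : Vec d) : act Q (act Qᵀ x) = x := by
  rw [← act_mul, show Q * Qᵀ = 1 from (Matrix.mem_orthogonalGroup_iff (Fin d) ℝ).1 hQ, act_one]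

/-- The action of an orthogonal matrix as a linear isometry equivalence. -/
def actIsometry {Q : Matrix (Fin d) (Fin d) ℝ} (hQ : Q ∈ Matrix.orthogonalGroup (Fin d) ℝ) :
    Vec d ≃ₗᵢ[ℝ] Vec d :=
  LinearIsometry.toLinearIsometryEquiv
    ⟨(Matrix.toEuclideanCLM (𝕜 := ℝ) Q : Vec d →L[ℝ] Vec d).toLinearMap, norm_act hQ⟩ rfl

theorem setIntegral_movedBody {Q : Matrix (Fin d) (Fin d) ℝ}
    (hQ : Q ∈ Matrix.orthogonalGroup (Fin d) ℝ) (h : Vec d) (S : Set (Vec d)) (F : Vec d → ℝ) :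
    ∫ x in movedBody S h Q, F (act Qᵀ (x - h)) = ∫ y in S, F y := by
  have hQ' := transpose_mem_orthogonalGroup hQ
  have h1 : MeasurePreserving (fun x : Vec d => act Qᵀ (x - h)) volume volume :=
    (actIsometry hQ').measurePreserving.comp (measurePreserving_sub_right volume h)
  have h2 : MeasurableEmbedding (fun x : Vec d => act Qᵀ (x - h)) :=
    (actIsometry hQ').toHomeomorph.measurableEmbedding.comp
      (Homeomorph.subRight h).measurableEmbedding
  exact h1.setIntegral_preimage_emb h2 F S

theorem integrableOn_movedBody {Q : Matrix (Fin d) (Fin d) ℝ}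
    (hQ : Q ∈ Matrix.orthogonalGroup (Fin d) ℝ) (h : Vec d) {S : Set (Vec d)} {F : Vec d → ℝ}
    (hF : IntegrableOn F S) :
    IntegrableOn (fun x => F (act Qᵀ (x - h))) (movedBody S h Q) := by
  have hQ' := transpose_mem_orthogonalGroup hQ
  have h1 : MeasurePreserving (fun x : Vec d => act Qᵀ (x - h)) volume volume :=
    (actIsometry hQ').measurePreserving.comp (measurePreserving_sub_right volume h)
  have h2 : MeasurableEmbedding (fun x : Vec d => act Qᵀ (x - h)) :=
    (actIsometry hQ').toHomeomorph.measurableEmbedding.comp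
      (Homeomorph.subRight h).measurableEmbedding
  exact (h1.integrableOn_comp_preimage h2).2 hF

theorem isClosed_movedBody {S : Set (Vec d)} (hS : IsClosed S) (h : Vec d)
    (Q : Matrix (Fin d) (Fin d) ℝ) : IsClosed (movedBody S h Q) :=
  hS.preimage ((continuous_act Qᵀ).comp (continuous_id.sub continuous_const))

theorem movedBody_subset_ball {S : Set (Vec d)} {r : ℝ} (hS : S ⊆ Metric.ball 0 r)
    {Q : Matrix (Fin d) (Fin d) ℝ} (hQ : Q ∈ Matrix.orthogonalGroup (Fin d) ℝ) (h : Vec d) :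
    movedBody S h Q ⊆ Metric.ball h r := by
  intro x hx
  have := hS hx
  rw [mem_ball_zero_iff, norm_act (transpose_mem_orthogonalGroup hQ)] at this
  rwa [mem_ball_iff_norm]

theorem movedBody_zero_one (S : Set (Vec d)) : movedBody S 0 1 = S := by
  ext x; simp [movedBody, act_one]

theorem movedDensity_zero_one (S : Set (Vec d)) (ρ : Vec d → ℝ) :
    movedDensity S ρ 0 1 = extDensity S ρ := by
  simp [movedDensity, movedBody_zero_one, act_one]

/-- Lets every fixed-time statement about a moved body apply at time zero, with `h = 0` and `Q = 1`.
-/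
theorem initialVel_eq (S : Set (Vec d)) (u : Vec d → Vec d) (ℓ : Vec d) (ω : AngVel d) :
    initialVel S u ℓ ω = extVel (movedBody S 0 1) (rigidVel ℓ ω 0) u := by
  rw [movedBody_zero_one]; rfl

theorem extVel_of_mem {B : Set (Vec d)} {v u : Vec d → Vec d} {x : Vec d} (hx : x ∈ B) :
    extVel B v u x = v x := by simp [extVel, hx]

theorem movedDensity_of_mem {S : Set (Vec d)} {ρ : Vec d → ℝ} {h : Vec d}
    {Q : Matrix (Fin d) (Fin d) ℝ} {x : Vec d} (hx : x ∈ movedBody S h Q) :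
    movedDensity S ρ h Q x = ρ (act Qᵀ (x - h)) := by simp [movedDensity, extDensity, hx]

theorem movedDensity_of_notMem {S : Set (Vec d)} {ρ : Vec d → ℝ} {h : Vec d}
    {Q : Matrix (Fin d) (Fin d) ℝ} {x : Vec d} (hx : x ∉ movedBody S h Q) :
    movedDensity S ρ h Q x = 1 := by simp [movedDensity, extDensity, hx]

/-- In the body coordinate `y = Qᵀ (x - h)` the rigid field is affine, so integrals over the moved
body become moments of `ρ` over `S`. -/
theorem rigidVel_eq {Q : Matrix (Fin d) (Fin d) ℝ} (hQ : Q ∈ Matrix.orthogonalGroup (Fin d) ℝ)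
    (ℓ : Vec d) (ω : AngVel d) (h x : Vec d) :
    rigidVel ℓ ω h x = ℓ + act (spin d ω * Q) (act Qᵀ (x - h)) := by
  rw [rigidVel, act_mul, act_act_transpose hQ]

namespace IsRigidBody

variable {S : Set (Vec d)} {ρ : Vec d → ℝ}

theorem isCompact (hS : IsRigidBody S ρ) : IsCompact S :=
  Metric.isCompact_of_isClosed_isBounded hS.isClosed hS.isBounded

theorem integrableOn_mul (hS : IsRigidBody S ρ) {F : Vec d → ℝ} (hF : Continuous F) :
    IntegrableOn (fun x => ρ x * F x) S :=
  hS.density_integrable.mul_continuousOn hF.continuousOn hS.isCompact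

/-- First moments vanish because the centre of mass is the origin. This decouples translation from
rotation, both in the momentum and in the energy. -/
theorem integral_mul_clm (hS : IsRigidBody S ρ) (L : Vec d →L[ℝ] ℝ) :
    ∫ x in S, ρ x * L x = 0 := by
  have hi : IntegrableOn (fun x => ρ x • x) S :=
    hS.density_integrable.smul_continuousOn continuous_id.continuousOn hS.isCompact
  have := L.integral_comp_comm hi
  rw [hS.centre, map_zero] at this
  simpa only [map_smul, smul_eq_mul] using this

theorem integral_mul_inner (hS : IsRigidBody S ρ) (ℓ e : Vec d) (A : Matrix (Fin d) (Fin d) ℝ) :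
    ∫ x in S, ρ x * inner ℝ (ℓ + act A x) e = mass S ρ * inner ℝ ℓ e := by
  have h0 := hS.integral_mul_clm ((innerSL ℝ e).comp (Matrix.toEuclideanCLM (𝕜 := ℝ) A))
  have hc : Continuous fun x => inner ℝ (act A x) e := (continuous_act A).inner continuous_const
  have : ∀ x, ρ x * inner ℝ (ℓ + act A x) e = ρ x * inner ℝ ℓ e + ρ x * inner ℝ (act A x) e :=
    fun x => by rw [inner_add_left]; ring
  simp only [this]
  rw [integral_add (hS.density_integrable.mul_const _) (hS.integrableOn_mul hc),
    integral_mul_const, mass]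
  convert add_zero _
  rw [← h0]
  exact integral_congr_ae (ae_of_all _ fun x => by
    simp [act_eq_toEuclideanCLM, real_inner_comm])

theorem integral_mul_norm_sq (hS : IsRigidBody S ρ) (ℓ : Vec d) (A : Matrix (Fin d) (Fin d) ℝ) :
    ∫ x in S, ρ x * ‖ℓ + act A x‖ ^ 2 =
      mass S ρ * ‖ℓ‖ ^ 2 + ∫ x in S, ρ x * ‖act A x‖ ^ 2 := by
  have h0 := hS.integral_mul_clm ((innerSL ℝ ℓ).comp (Matrix.toEuclideanCLM (𝕜 := ℝ) A))
  have hc : Continuous fun x => ‖act A x‖ ^ 2 := (continuous_act A).norm.pow 2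
  have hc1 : Continuous fun x => inner ℝ ℓ (act A x) := continuous_const.inner (continuous_act A)
  have : ∀ x, ρ x * ‖ℓ + act A x‖ ^ 2 = ρ x * ‖ℓ‖ ^ 2 + 2 * (ρ x * inner ℝ ℓ (act A x)) +
      ρ x * ‖act A x‖ ^ 2 :=
    fun x => by rw [norm_add_sq_real]; ring
  simp only [this]
  have i1 : IntegrableOn (fun x => ρ x * ‖ℓ‖ ^ 2) S := hS.density_integrable.mul_const _
  have i2 : IntegrableOn (fun x => 2 * (ρ x * inner ℝ ℓ (act A x))) S :=
    (hS.integrableOn_mul hc1).const_mul 2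
  have i12 : IntegrableOn (fun x => ρ x * ‖ℓ‖ ^ 2 + 2 * (ρ x * inner ℝ ℓ (act A x))) S := i1.add i2
  rw [integral_add i12 (hS.integrableOn_mul hc), integral_add i1 i2,
    integral_mul_const, integral_const_mul, mass]
  have : ∫ x in S, ρ x * inner ℝ ℓ (act A x) = 0 := h0
  rw [this]
  ring

theorem mass_nonneg (hS : IsRigidBody S ρ) : 0 ≤ mass S ρ :=
  setIntegral_nonneg hS.isClosed.measurableSet fun x hx => (hS.density_pos x hx).le

/-- Pointwise, `|ω × x|² = (|x|² I - x ⊗ x) ω · ω`. It is needed at the initial time, to recognise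
the kinetic energy of the body in the assumptions. -/
theorem integral_mul_norm_spin_sq (hd : d = 2 ∨ d = 3) (hS : IsRigidBody S ρ) (ω : AngVel d) :
    ∫ x in S, ρ x * ‖act (spin d ω) x‖ ^ 2 =
      (inertia d S ρ *ᵥ WithLp.ofLp ω) ⬝ᵥ WithLp.ofLp ω := by
  rcases hd with rfl | rfl
  · have h1 : ∀ x : Vec 2, ρ x * ‖act (spin 2 ω) x‖ ^ 2 = ρ x * ‖x‖ ^ 2 * (ω 0) ^ 2 := by
      intro x
      rw [norm_sq_eq_sum, norm_sq_eq_sum]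
      simp [act_coord, spin, Fin.sum_univ_two]
      ring
    simp only [h1]
    rw [integral_mul_const]
    simp [Matrix.mulVec, dotProduct, inertia]
    ring
  · have hi : ∀ i j : Fin 3, IntegrableOn
        (fun x => ρ x * ((if i = j then ‖x‖ ^ 2 else 0) - x i * x j)) S := fun i j =>
      hS.integrableOn_mul (by split_ifs <;> fun_prop)
    have h1 : ∀ x : Vec 3, ρ x * ‖act (spin 3 ω) x‖ ^ 2 =
        ∑ i : Fin 3, ∑ j : Fin 3,
          ρ x * ((if i = j then ‖x‖ ^ 2 else 0) - x i * x j) * (ω j * ω i) := by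
      intro x
      rw [norm_sq_eq_sum, norm_sq_eq_sum]
      simp [act_coord, spin, Fin.sum_univ_three]
      ring
    simp only [h1]
    rw [integral_finsetSum _ fun i _ => integrable_finsetSum _ fun j _ => (hi i j).mul_const _]
    simp only [Matrix.mulVec, dotProduct, Finset.sum_mul]
    refine Finset.sum_congr rfl fun i _ => ?_
    rw [integral_finsetSum _ fun j _ => (hi i j).mul_const _]
    refine Finset.sum_congr rfl fun j _ => ?_
    rw [integral_mul_const, ← mul_assoc]
    rfl

end IsRigidBody

section Moved

variable {S : Set (Vec d)} {ρ : Vec d → ℝ} {Q : Matrix (Fin d) (Fin d) ℝ}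

theorem integral_movedBody_momentum (hS : IsRigidBody S ρ)
    (hQ : Q ∈ Matrix.orthogonalGroup (Fin d) ℝ) (h ℓ e : Vec d) (ω : AngVel d)
    (u : Vec d → Vec d) :
    ∫ x in movedBody S h Q, movedDensity S ρ h Q x *
      inner ℝ (extVel (movedBody S h Q) (rigidVel ℓ ω h) u x) e = mass S ρ * inner ℝ ℓ e := by
  rw [← hS.integral_mul_inner ℓ e (spin d ω * Q), ← setIntegral_movedBody hQ h S]
  refine setIntegral_congr_fun (isClosed_movedBody hS.isClosed h Q).measurableSet fun x hx => ?_
  simp only [extVel_of_mem hx, movedDensity_of_mem hx, rigidVel_eq hQ]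

theorem integrableOn_movedBody_momentum (hS : IsRigidBody S ρ)
    (hQ : Q ∈ Matrix.orthogonalGroup (Fin d) ℝ) (h ℓ e : Vec d) (ω : AngVel d)
    (u : Vec d → Vec d) :
    IntegrableOn (fun x => movedDensity S ρ h Q x *
      inner ℝ (extVel (movedBody S h Q) (rigidVel ℓ ω h) u x) e) (movedBody S h Q) := by
  have := integrableOn_movedBody hQ h (hS.integrableOn_mul
    (F := fun x => inner ℝ (ℓ + act (spin d ω * Q) x) e)
    ((continuous_const.add (continuous_act _)).inner continuous_const))
  refine this.congr_fun (fun x hx => ?_) (isClosed_movedBody hS.isClosed h Q).measurableSet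
  simp only [extVel_of_mem hx, movedDensity_of_mem hx, rigidVel_eq hQ]

/-- The energy splits into the energies of the body and of the fluid. -/
theorem integral_energy_eq (hS : IsRigidBody S ρ)
    (hQ : Q ∈ Matrix.orthogonalGroup (Fin d) ℝ) (h ℓ : Vec d) (ω : AngVel d)
    (u : Vec d → Vec d) (hv : MemLp (extVel (movedBody S h Q) (rigidVel ℓ ω h) u) 2) :
    ∫ x, movedDensity S ρ h Q x * ‖extVel (movedBody S h Q) (rigidVel ℓ ω h) u x‖ ^ 2 =
      mass S ρ * ‖ℓ‖ ^ 2 + (∫ x in S, ρ x * ‖act (spin d ω * Q) x‖ ^ 2) +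
      ∫ x in (movedBody S h Q)ᶜ, ‖extVel (movedBody S h Q) (rigidVel ℓ ω h) u x‖ ^ 2 := by
  have hB := (isClosed_movedBody hS.isClosed h Q).measurableSet
  have i1 : IntegrableOn (fun x => movedDensity S ρ h Q x *
      ‖extVel (movedBody S h Q) (rigidVel ℓ ω h) u x‖ ^ 2) (movedBody S h Q) := by
    have := integrableOn_movedBody hQ h (hS.integrableOn_mul
      (F := fun x => ‖ℓ + act (spin d ω * Q) x‖ ^ 2)
      ((continuous_const.add (continuous_act _)).norm.pow 2))
    refine this.congr_fun (fun x hx => ?_) hB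
    simp only [extVel_of_mem hx, movedDensity_of_mem hx, rigidVel_eq hQ]
  have i2 : IntegrableOn (fun x => movedDensity S ρ h Q x *
      ‖extVel (movedBody S h Q) (rigidVel ℓ ω h) u x‖ ^ 2) (movedBody S h Q)ᶜ := by
    have : IntegrableOn (fun x => ‖extVel (movedBody S h Q) (rigidVel ℓ ω h) u x‖ ^ 2)
        (movedBody S h Q)ᶜ := (hv.integrable_norm_pow (by norm_num)).integrableOn
    refine this.congr_fun (fun x hx => ?_) hB.compl
    simp only [movedDensity_of_notMem hx, one_mul]
  have hint : Integrable (fun x => movedDensity S ρ h Q x *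
      ‖extVel (movedBody S h Q) (rigidVel ℓ ω h) u x‖ ^ 2) := by
    rw [← integrableOn_univ, ← union_compl_self (movedBody S h Q)]
    exact i1.union i2
  rw [← integral_add_compl hB hint, ← hS.integral_mul_norm_sq, ← setIntegral_movedBody hQ h S]
  congr 1
  · refine setIntegral_congr_fun hB fun x hx => ?_
    simp only [extVel_of_mem hx, movedDensity_of_mem hx, rigidVel_eq hQ]
  · refine setIntegral_congr_fun hB.compl fun x hx => ?_
    simp only [movedDensity_of_notMem hx, one_mul]

/-- The rotational energy is nonnegative and is dropped: no bound on `ω` is used in the estimates.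
-/
theorem body_fluid_energy_le (hS : IsRigidBody S ρ)
    (hQ : Q ∈ Matrix.orthogonalGroup (Fin d) ℝ) (h ℓ : Vec d) (ω : AngVel d)
    (u : Vec d → Vec d) (hv : MemLp (extVel (movedBody S h Q) (rigidVel ℓ ω h) u) 2) :
    mass S ρ * ‖ℓ‖ ^ 2 +
      (∫ x in (movedBody S h Q)ᶜ, ‖extVel (movedBody S h Q) (rigidVel ℓ ω h) u x‖ ^ 2) ≤
    ∫ x, movedDensity S ρ h Q x * ‖extVel (movedBody S h Q) (rigidVel ℓ ω h) u x‖ ^ 2 := by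
  rw [integral_energy_eq hS hQ h ℓ ω u hv]
  have : 0 ≤ ∫ x in S, ρ x * ‖act (spin d ω * Q) x‖ ^ 2 :=
    setIntegral_nonneg hS.isClosed.measurableSet fun x hx =>
      mul_nonneg (hS.density_pos x hx).le (sq_nonneg _)
  linarith

theorem initial_energy_eq (hd : d = 2 ∨ d = 3) {u₀ : Vec d → Vec d} {ℓ₀ : Vec d} {ω₀ : AngVel d}
    (h : IsInitialData S ρ u₀ ℓ₀ ω₀) :
    ∫ x, extDensity S ρ x * ‖initialVel S u₀ ℓ₀ ω₀ x‖ ^ 2 =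
      mass S ρ * ‖ℓ₀‖ ^ 2 + (inertia d S ρ *ᵥ WithLp.ofLp ω₀) ⬝ᵥ WithLp.ofLp ω₀ +
        ∫ x in Sᶜ, ‖initialVel S u₀ ℓ₀ ω₀ x‖ ^ 2 := by
  have hv := h.finiteEnergy
  rw [initialVel_eq] at hv ⊢
  have := integral_energy_eq h.body (one_mem _) 0 ℓ₀ ω₀ u₀ hv
  rw [movedDensity_zero_one, mul_one, h.body.integral_mul_norm_spin_sq hd] at this
  rw [this, movedBody_zero_one]

end Moved

end Body

/-! ### Divergence free cutoffs of a constant vector -/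

section Cutoff

variable {d : ℕ}

/-- A smooth cutoff of `[0, 1]` on the half line. -/
def profile (q : ℝ) : ℝ := Real.smoothTransition (2 - q)

theorem contDiff_profile : ContDiff ℝ (⊤ : ℕ∞) profile :=
  Real.smoothTransition.contDiff.comp (contDiff_const.sub contDiff_id)

theorem contDiff_deriv_profile : ContDiff ℝ (⊤ : ℕ∞) (deriv profile) :=
  (contDiff_infty_iff_deriv.1 contDiff_profile).2

theorem profile_of_le {q : ℝ} (hq : q ≤ 1) : profile q = 1 :=
  Real.smoothTransition.one_of_one_le (by linarith)

theorem profile_of_ge {q : ℝ} (hq : 2 ≤ q) : profile q = 0 :=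
  Real.smoothTransition.zero_of_nonpos (by linarith)

theorem deriv_profile_of_lt {q : ℝ} (hq : q < 1) : deriv profile q = 0 := by
  have : profile =ᶠ[𝓝 q] fun _ => 1 := by
    filter_upwards [Iio_mem_nhds hq] with y hy using profile_of_le (le_of_lt hy)
  rw [this.deriv_eq, deriv_const]

theorem deriv_profile_of_gt {q : ℝ} (hq : 2 < q) : deriv profile q = 0 := by
  have : profile =ᶠ[𝓝 q] fun _ => 0 := by
    filter_upwards [Ioi_mem_nhds hq] with y hy using profile_of_ge (le_of_lt hy)
  rw [this.deriv_eq, deriv_const]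

/-- A divergence free field which is equal to `e` in the unit ball and vanishes far away. -/
def basicField (e : Vec d) (x : Vec d) : Vec d :=
  (profile (‖x‖ ^ 2) + 2 / (d - 1) * ‖x‖ ^ 2 * deriv profile (‖x‖ ^ 2)) • e -
    (2 / (d - 1) * deriv profile (‖x‖ ^ 2) * inner ℝ e x) • x

theorem contDiff_basicField (e : Vec d) : ContDiff ℝ (⊤ : ℕ∞) (basicField e) := by
  have hn : ContDiff ℝ (⊤ : ℕ∞) fun x : Vec d => ‖x‖ ^ 2 := contDiff_norm_sq ℝ
  have h1 := contDiff_profile.comp hn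
  have h2 := contDiff_deriv_profile.comp hn
  exact ((h1.add ((contDiff_const.mul hn).mul h2)).smul contDiff_const).sub
    (((contDiff_const.mul h2).mul (contDiff_const.inner ℝ contDiff_id)).smul contDiff_id)

theorem basicField_of_lt (e : Vec d) {x : Vec d} (hx : ‖x‖ < 1) : basicField e x = e := by
  have : ‖x‖ ^ 2 < 1 := by nlinarith [norm_nonneg x]
  simp [basicField, profile_of_le this.le, deriv_profile_of_lt this]

theorem basicField_of_gt (e : Vec d) {x : Vec d} (hx : 2 < ‖x‖) : basicField e x = 0 := by
  have : 2 < ‖x‖ ^ 2 := by nlinarith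
  simp [basicField, profile_of_ge this.le, deriv_profile_of_gt this]

/-- With `c` in place of `2 / (d - 1)`, the second derivatives of the profile cancel and the
divergence is `(2 - c (d - 1)) p' (e · x)`, where `p'` is the derivative of the profile at `|x|²`.
This forces the coefficient. For `d = 3` the field is the curl of `(p/2) e × x`. -/
theorem trace_jacobian_basicField (hd : d = 2 ∨ d = 3) (e x : Vec d) :
    (jacobian (basicField e) x).trace = 0 := by
  have hn : HasFDerivAt (fun x : Vec d => ‖x‖ ^ 2) ((2 : ℝ) • innerSL ℝ x) x := by
    have := (hasStrictFDerivAt_norm_sq x).hasFDerivAt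
    rwa [← Nat.cast_smul_eq_nsmul ℝ, Nat.cast_ofNat] at this
  have hp : HasDerivAt profile (deriv profile (‖x‖ ^ 2)) (‖x‖ ^ 2) :=
    (contDiff_profile.differentiable (by simp) _).hasDerivAt
  have hp' : HasDerivAt (deriv profile) (deriv (deriv profile) (‖x‖ ^ 2)) (‖x‖ ^ 2) :=
    (contDiff_deriv_profile.differentiable (by simp) _).hasDerivAt
  have h1 := hp.comp_hasFDerivAt x hn
  have h2 := hp'.comp_hasFDerivAt x hn
  have h3 : HasFDerivAt (fun x : Vec d => inner ℝ e x) (innerSL ℝ e) x := (innerSL ℝ e).hasFDerivAt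
  have key := ((h1.add ((hn.const_mul (2 / (d - 1) : ℝ)).mul h2)).smul_const e).sub
    (((h2.const_mul (2 / (d - 1) : ℝ)).mul h3).smul (hasFDerivAt_id x))
  have hf : fderiv ℝ (basicField e) x = _ := key.fderiv
  simp only [Matrix.trace, Matrix.diag, jacobian, Matrix.of_apply, hf]
  have e0 : inner ℝ e x = ∑ i, x i * e i := by simp [PiLp.inner_apply]
  have e1 : ‖x‖ ^ 2 = ∑ i, x i * x i := norm_sq_eq_sum x
  simp only [Function.comp_apply, add_apply, sub_apply, smul_apply, smul_eq_mul,
    ContinuousLinearMap.smulRight_apply, ContinuousLinearMap.id_apply, innerSL_apply_apply,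
    EuclideanSpace.inner_single_right, PiLp.add_apply, PiLp.sub_apply, PiLp.smul_apply, id,
    Pi.mul_apply, e0]
  generalize deriv (deriv profile) (‖x‖ ^ 2) = p2
  generalize deriv profile (‖x‖ ^ 2) = p1
  rw [e1]
  rcases hd with rfl | rfl
  · simp [Fin.sum_univ_two]
    ring
  · simp [Fin.sum_univ_three]
    ring

theorem exists_basicField_bound (e : Vec d) :
    ∃ C : ℝ, 0 < C ∧ (∀ x, ‖basicField e x‖ ≤ C) ∧ ∀ x, ‖fderiv ℝ (basicField e) x‖ ≤ C := by
  have hc : HasCompactSupport (basicField e) :=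
    HasCompactSupport.intro (isCompact_closedBall (0 : Vec d) 2) fun x hx => by
      refine basicField_of_gt e ?_
      simpa using hx
  obtain ⟨C₁, h₁⟩ := (contDiff_basicField e).continuous.bounded_above_of_compact_support hc
  obtain ⟨C₂, h₂⟩ := ((contDiff_basicField e).continuous_fderiv (by simp)
    ).bounded_above_of_compact_support (hc.fderiv ℝ)
  exact ⟨max (max C₁ C₂) 1, by positivity, fun x => (h₁ x).trans (by simp),
    fun x => (h₂ x).trans (by simp)⟩

theorem fderiv_basicField_of_lt (e : Vec d) {x : Vec d} (hx : ‖x‖ < 1) :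
    fderiv ℝ (basicField e) x = 0 := by
  have : basicField e =ᶠ[𝓝 x] fun _ => e := by
    filter_upwards [Metric.isOpen_ball.mem_nhds (show x ∈ Metric.ball (0 : Vec d) 1 by simpa)]
      with y hy using basicField_of_lt e (by simpa using hy)
  rw [this.fderiv_eq, fderiv_fun_const, Pi.zero_apply]

theorem fderiv_basicField_of_gt (e : Vec d) {x : Vec d} (hx : 2 < ‖x‖) :
    fderiv ℝ (basicField e) x = 0 := by
  have : basicField e =ᶠ[𝓝 x] fun _ => 0 := by
    filter_upwards [(isOpen_lt continuous_const continuous_norm).mem_nhds hx]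
      with y hy using basicField_of_gt e hy
  rw [this.fderiv_eq, fderiv_fun_const, Pi.zero_apply]

/-- The average of `N` dilations of the basic field at the scales `4 ^ k * r`. -/
def dyadicField (e : Vec d) (N : ℕ) (r : ℝ) (x : Vec d) : Vec d :=
  (N : ℝ)⁻¹ • ∑ k ∈ Finset.range N, basicField e ((4 ^ k * r)⁻¹ • x)

theorem contDiff_dyadicField (e : Vec d) (N : ℕ) (r : ℝ) :
    ContDiff ℝ (⊤ : ℕ∞) (dyadicField e N r) :=
  ContDiff.const_smul _ (ContDiff.sum fun _ _ =>
    (contDiff_basicField e).comp (contDiff_id.const_smul _))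

theorem hasFDerivAt_dyadicField (e : Vec d) (N : ℕ) (r : ℝ) (x : Vec d) :
    HasFDerivAt (dyadicField e N r) ((N : ℝ)⁻¹ • ∑ k ∈ Finset.range N,
      ((4 ^ k * r)⁻¹ • fderiv ℝ (basicField e) ((4 ^ k * r)⁻¹ • x))) x := by
  have hs : HasFDerivAt (fun y => ∑ k ∈ Finset.range N, basicField e ((4 ^ k * r)⁻¹ • y))
      (∑ k ∈ Finset.range N,
        ((4 ^ k * r)⁻¹ • fderiv ℝ (basicField e) ((4 ^ k * r)⁻¹ • x))) x := by
    refine HasFDerivAt.fun_sum fun k _ => ?_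
    have h1 := ((contDiff_basicField e).differentiable (by simp) ((4 ^ k * r)⁻¹ • x)).hasFDerivAt
    have h2 : HasFDerivAt (fun y : Vec d => (4 ^ k * r)⁻¹ • y)
        ((4 ^ k * r)⁻¹ • ContinuousLinearMap.id ℝ (Vec d)) x := 
        (hasFDerivAt_id x).const_smul ((4 ^ k * r)⁻¹)
    have := h1.comp x h2
    rw [ContinuousLinearMap.comp_smul, ContinuousLinearMap.comp_id] at this
    exact this
  exact hs.const_smul ((N : ℝ)⁻¹)

theorem trace_jacobian_dyadicField (hd : d = 2 ∨ d = 3) (e : Vec d) (N : ℕ) (r : ℝ) (x : Vec d) :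
    (jacobian (dyadicField e N r) x).trace = 0 := by
  have h := fun y => trace_jacobian_basicField hd e y
  simp only [Matrix.trace, Matrix.diag, jacobian, Matrix.of_apply] at h ⊢
  rw [(hasFDerivAt_dyadicField e N r x).fderiv]
  simp only [smul_apply, sum_apply, PiLp.smul_apply, WithLp.ofLp_sum,
    Finset.sum_apply, smul_eq_mul]
  rw [← Finset.mul_sum, Finset.sum_comm]
  simp [← Finset.mul_sum, h]

theorem dyadicField_of_lt (e : Vec d) {N : ℕ} (hN : 0 < N) {r : ℝ} (hr : 0 < r) {x : Vec d}
    (hx : ‖x‖ < r) : dyadicField e N r x = e := by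
  have : ∀ k ∈ Finset.range N, basicField e ((4 ^ k * r)⁻¹ • x) = e := fun k _ => by
    refine basicField_of_lt e ?_
    have h4 : (1 : ℝ) ≤ 4 ^ k := one_le_pow₀ (by norm_num)
    rw [norm_smul, norm_inv, Real.norm_of_nonneg (by positivity), inv_mul_lt_iff₀ (by positivity)]
    nlinarith
  have hN' : (N : ℝ) ≠ 0 := by positivity
  rw [dyadicField, Finset.sum_congr rfl this, Finset.sum_const, Finset.card_range,
    ← Nat.cast_smul_eq_nsmul ℝ, smul_smul, inv_mul_cancel₀ hN', one_smul]

theorem dyadicField_of_gt (e : Vec d) {N : ℕ} {r : ℝ} (hr : 0 < r) {x : Vec d}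
    (hx : 4 ^ N * r < ‖x‖) : dyadicField e N r x = 0 := by
  have : ∀ k ∈ Finset.range N, basicField e ((4 ^ k * r)⁻¹ • x) = 0 := fun k hk => by
    refine basicField_of_gt e ?_
    rw [norm_smul, norm_inv, Real.norm_of_nonneg (by positivity), lt_inv_mul_iff₀ (by positivity)]
    have h4 : (4 : ℝ) ^ (k + 1) ≤ 4 ^ N :=
      pow_le_pow_right₀ (by norm_num) (Finset.mem_range.1 hk)
    rw [pow_succ] at h4
    have h5 : (0 : ℝ) < 4 ^ k := by positivity
    nlinarith [mul_le_mul_of_nonneg_right h4 hr.le, mul_pos h5 hr]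
  rw [dyadicField, Finset.sum_congr rfl this, Finset.sum_const_zero, smul_zero]

theorem norm_dyadicField_le {e : Vec d} {C : ℝ} (hC : ∀ x, ‖basicField e x‖ ≤ C) {N : ℕ}
    (hN : 0 < N) (r : ℝ) (x : Vec d) : ‖dyadicField e N r x‖ ≤ C := by
  have hN' : (0 : ℝ) < N := by positivity
  rw [dyadicField, norm_smul, norm_inv, Real.norm_natCast, inv_mul_le_iff₀ hN']
  refine (norm_sum_le _ _).trans ((Finset.sum_le_sum fun k _ => hC _).trans ?_)
  simp

/-- The annulus where the `k`-th dilation is not constant. -/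
def annulus (d : ℕ) (r : ℝ) (k : ℕ) : Set (Vec d) := {x | 4 ^ k * r ≤ ‖x‖ ∧ ‖x‖ ≤ 2 * (4 ^ k * r)}

theorem measurableSet_annulus (r : ℝ) (k : ℕ) : MeasurableSet (annulus d r k) :=
  ((isClosed_le continuous_const continuous_norm).inter
    (isClosed_le continuous_norm continuous_const)).measurableSet

theorem annulus_subset (r : ℝ) (k : ℕ) :
    annulus d r k ⊆ Metric.closedBall 0 (2 * (4 ^ k * r)) := fun x hx => by
  simpa using hx.2

/-- Consecutive scales have ratio `4`, more than the ratio `2` between the radii of one annulus. At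
each point at most one dilation has a nonzero gradient, so averaging gains a factor `1/N` pointwise.
-/
theorem annulus_disjoint {r : ℝ} (hr : 0 < r) {k l : ℕ} {x : Vec d} (hk : x ∈ annulus d r k)
    (hl : x ∈ annulus d r l) : k = l := by
  by_contra hne
  wlog h : k < l generalizing k l
  · exact this hl hk (Ne.symm hne) (lt_of_le_of_ne (not_lt.1 h) (Ne.symm hne))
  have h4 : (4 : ℝ) ^ (k + 1) ≤ 4 ^ l := pow_le_pow_right₀ (by norm_num) h
  rw [pow_succ] at h4
  have h5 : (0 : ℝ) < 4 ^ k := by positivity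
  have h6 := hk.2
  have h7 := hl.1
  nlinarith [mul_le_mul_of_nonneg_right h4 hr.le, mul_pos h5 hr]

theorem smul_fderiv_basicField_eq_zero (e : Vec d) {r : ℝ} (hr : 0 < r) {k : ℕ} {x : Vec d}
    (hx : x ∉ annulus d r k) :
    (4 ^ k * r)⁻¹ • fderiv ℝ (basicField e) ((4 ^ k * r)⁻¹ • x) = 0 := by
  have hR : 0 < 4 ^ k * r := by positivity
  have hn : ‖(4 ^ k * r)⁻¹ • x‖ = (4 ^ k * r)⁻¹ * ‖x‖ := by
    rw [norm_smul, norm_inv, Real.norm_of_nonneg hR.le]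
  have h0 : fderiv ℝ (basicField e) ((4 ^ k * r)⁻¹ • x) = 0 := by
    rcases lt_or_ge ‖x‖ (4 ^ k * r) with h | h
    · exact fderiv_basicField_of_lt e (by rwa [hn, inv_mul_lt_iff₀ hR, mul_one])
    · have h2 : 2 * (4 ^ k * r) < ‖x‖ := by
        by_contra h3
        exact hx ⟨h, not_lt.1 h3⟩
      exact fderiv_basicField_of_gt e (by rw [hn, lt_inv_mul_iff₀ hR]; linarith)
  rw [h0]
  ext1 y
  simp

theorem fderiv_dyadicField_eq_zero (e : Vec d) {N : ℕ} {r : ℝ} (hr : 0 < r) {x : Vec d}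
    (hx : ∀ k < N, x ∉ annulus d r k) : fderiv ℝ (dyadicField e N r) x = 0 := by
  rw [(hasFDerivAt_dyadicField e N r x).fderiv, Finset.sum_eq_zero fun k hk =>
    smul_fderiv_basicField_eq_zero e hr (hx k (Finset.mem_range.1 hk))]
  ext1 y
  simp

theorem norm_fderiv_dyadicField_le {e : Vec d} {C : ℝ}
    (hC : ∀ x, ‖fderiv ℝ (basicField e) x‖ ≤ C) {N : ℕ} {r : ℝ} (hr : 0 < r) {x : Vec d}
    {k : ℕ} (hkN : k < N) (hk : x ∈ annulus d r k) :
    ‖fderiv ℝ (dyadicField e N r) x‖ ≤ (N : ℝ)⁻¹ * (C / (4 ^ k * r)) := by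
  have hC0 : 0 ≤ C := (norm_nonneg _).trans (hC 0)
  have hR : 0 < 4 ^ k * r := by positivity
  rw [(hasFDerivAt_dyadicField e N r x).fderiv, Finset.sum_eq_single k]
  · rw [norm_smul, norm_smul, norm_inv, Real.norm_natCast, norm_inv, Real.norm_of_nonneg hR.le,
      div_eq_inv_mul]
    gcongr
    exact hC _
  · exact fun l _ hlk =>
      smul_fderiv_basicField_eq_zero e hr fun hx => hlk (annulus_disjoint hr hx hk)
  · intro h
    exact absurd (Finset.mem_range.2 hkN) h

/-- Each annulus contributes its pointwise bound times the volume of an enclosing ball. Used with `p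
= 2` and `p = 1`. -/
theorem integral_norm_fderiv_dyadicField_pow_le {e : Vec d} {C : ℝ}
    (hC : ∀ x, ‖fderiv ℝ (basicField e) x‖ ≤ C) (N : ℕ) {r : ℝ} (hr : 0 < r) {p : ℕ}
    (hp : p ≠ 0) :
    ∫ x, ‖fderiv ℝ (dyadicField e N r) x‖ ^ p ≤ ∑ k ∈ Finset.range N,
      ((N : ℝ)⁻¹ * (C / (4 ^ k * r))) ^ p *
        ((2 * (4 ^ k * r)) ^ d * volume.real (Metric.ball (0 : Vec d) 1)) := by
  have hC0 : 0 ≤ C := (norm_nonneg _).trans (hC 0)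
  have hvol : ∀ k, volume.real (annulus d r k) ≤
      (2 * (4 ^ k * r)) ^ d * volume.real (Metric.ball (0 : Vec d) 1) := fun k => by
    refine (measureReal_mono (annulus_subset r k) measure_closedBall_lt_top.ne).trans (le_of_eq ?_)
    rw [Measure.addHaar_real_closedBall _ _ (by positivity), finrank_euclideanSpace_fin]
  have hfin : ∀ k, volume (annulus d r k) ≠ ∞ := fun k =>
    ((measure_mono (annulus_subset r k)).trans_lt measure_closedBall_lt_top).ne
  have hint : ∀ k, Integrable ((annulus d r k).indicator fun _ =>
      ((N : ℝ)⁻¹ * (C / (4 ^ k * r))) ^ p) := fun k =>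
    (integrable_indicator_iff (measurableSet_annulus r k)).2 (integrableOn_const (hfin k))
  calc ∫ x, ‖fderiv ℝ (dyadicField e N r) x‖ ^ p
      ≤ ∫ x, ∑ k ∈ Finset.range N, (annulus d r k).indicator
          (fun _ => ((N : ℝ)⁻¹ * (C / (4 ^ k * r))) ^ p) x := by
        refine integral_mono_of_nonneg (ae_of_all _ fun x => by positivity)
          (integrable_finsetSum _ fun k _ => hint k) (ae_of_all _ fun x => ?_)
        have hnn : ∀ k ∈ Finset.range N, 0 ≤ (annulus d r k).indicator
            (fun _ => ((N : ℝ)⁻¹ * (C / (4 ^ k * r))) ^ p) x := fun k _ =>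
          indicator_nonneg (fun _ _ => by positivity) _
        by_cases h : ∃ k < N, x ∈ annulus d r k
        · obtain ⟨k, hkN, hk⟩ := h
          refine le_trans ?_ (Finset.single_le_sum hnn (Finset.mem_range.2 hkN))
          rw [indicator_of_mem hk]
          exact pow_le_pow_left₀ (norm_nonneg _) (norm_fderiv_dyadicField_le hC hr hkN hk) p
        · push Not at h
          simp only [fderiv_dyadicField_eq_zero e hr h, norm_zero, zero_pow hp]
          exact Finset.sum_nonneg hnn
    _ = ∑ k ∈ Finset.range N, volume.real (annulus d r k) *
          ((N : ℝ)⁻¹ * (C / (4 ^ k * r))) ^ p := by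
        rw [integral_finsetSum _ fun k _ => hint k]
        refine Finset.sum_congr rfl fun k _ => ?_
        rw [integral_indicator_const _ (measurableSet_annulus r k), smul_eq_mul]
    _ ≤ _ := by
        refine Finset.sum_le_sum fun k _ => ?_
        rw [mul_comm]
        exact mul_le_mul_of_nonneg_left (hvol k) (by positivity)

theorem integral_norm_dyadicField_sq_le {e : Vec d} {C : ℝ} (hC : ∀ x, ‖basicField e x‖ ≤ C)
    {N : ℕ} (hN : 0 < N) {r : ℝ} (hr : 0 < r) :
    ∫ x, ‖dyadicField e N r x‖ ^ 2 ≤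
      C ^ 2 * ((4 ^ N * r) ^ d * volume.real (Metric.ball (0 : Vec d) 1)) := by
  have hb : MeasurableSet (Metric.closedBall (0 : Vec d) (4 ^ N * r)) := measurableSet_closedBall
  calc ∫ x, ‖dyadicField e N r x‖ ^ 2
      ≤ ∫ x, (Metric.closedBall (0 : Vec d) (4 ^ N * r)).indicator (fun _ => C ^ 2) x := by
        refine integral_mono_of_nonneg (ae_of_all _ fun x => by positivity)
          ((integrable_indicator_iff hb).2 (integrableOn_const measure_closedBall_lt_top.ne))
          (ae_of_all _ fun x => ?_)
        by_cases h : x ∈ Metric.closedBall (0 : Vec d) (4 ^ N * r)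
        · rw [indicator_of_mem h]
          exact pow_le_pow_left₀ (norm_nonneg _) (norm_dyadicField_le hC hN r x) 2
        · rw [indicator_of_notMem h]
          simp only [dyadicField_of_gt e hr (show 4 ^ N * r < ‖x‖ by simpa using h), norm_zero,
            zero_pow two_ne_zero, le_refl]
    _ = _ := by
        rw [integral_indicator_const _ hb, Measure.addHaar_real_closedBall _ _ (by positivity),
          finrank_euclideanSpace_fin, smul_eq_mul, mul_comm]

/-- A divergence free field which is equal to `e` in the ball of radius `r`, with quantitative
smallness: `κ` controls the field in `H¹` and its gradient pointwise, `κ'` the gradient in `L¹`. -/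
structure IsCutoffField (Φ : Vec d → Vec d) (e : Vec d) (r κ κ' : ℝ) : Prop where
  smooth : ContDiff ℝ (⊤ : ℕ∞) Φ
  compactSupport : HasCompactSupport Φ
  divFree : ∀ x, (jacobian Φ x).trace = 0
  eq_of_lt : ∀ x, ‖x‖ < r → Φ x = e
  grad_le : ∀ x, ‖fderiv ℝ Φ x‖ ≤ κ * weight d r 0 x
  sq_le : ∫ x, ‖Φ x‖ ^ 2 ≤ κ ^ 2
  grad_sq_le : ∫ x, ‖fderiv ℝ Φ x‖ ^ 2 ≤ κ ^ 2
  grad_abs_le : ∫ x, ‖fderiv ℝ Φ x‖ ≤ κ'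

theorem hasCompactSupport_dyadicField (e : Vec d) (N : ℕ) {r : ℝ} (hr : 0 < r) :
    HasCompactSupport (dyadicField e N r) :=
  HasCompactSupport.intro (isCompact_closedBall (0 : Vec d) (4 ^ N * r)) fun x hx =>
    dyadicField_of_gt e hr (by simpa using hx)

/-- Reduces the cutoff properties to numerical inequalities at the scales `R = 4 ^ k * r`. The `5`
in `h0` comes from `|x|² + r² ≤ (2R)² + R²` on the annulus, as `r ≤ R`. -/
theorem isCutoffField_dyadicField (hd : d = 2 ∨ d = 3) {e : Vec d} {C : ℝ}
    (hC : ∀ x, ‖basicField e x‖ ≤ C) (hC' : ∀ x, ‖fderiv ℝ (basicField e) x‖ ≤ C)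
    {N : ℕ} (hN : 0 < N) {r : ℝ} (hr : 0 < r) {κ κ' : ℝ} (hκ : 0 ≤ κ)
    (h0 : ∀ k < N, (N : ℝ)⁻¹ * (C / (4 ^ k * r)) ≤ κ * (5 * (4 ^ k * r) ^ 2) ^ (-(d / 4 : ℝ)))
    (h1 : C ^ 2 * ((4 ^ N * r) ^ d * volume.real (Metric.ball (0 : Vec d) 1)) ≤ κ ^ 2)
    (h2 : ∑ k ∈ Finset.range N, ((N : ℝ)⁻¹ * (C / (4 ^ k * r))) ^ 2 *
        ((2 * (4 ^ k * r)) ^ d * volume.real (Metric.ball (0 : Vec d) 1)) ≤ κ ^ 2)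
    (h3 : ∑ k ∈ Finset.range N, ((N : ℝ)⁻¹ * (C / (4 ^ k * r))) ^ 1 *
        ((2 * (4 ^ k * r)) ^ d * volume.real (Metric.ball (0 : Vec d) 1)) ≤ κ') :
    IsCutoffField (dyadicField e N r) e r κ κ' where
  smooth := contDiff_dyadicField e N r
  compactSupport := hasCompactSupport_dyadicField e N hr
  divFree := trace_jacobian_dyadicField hd e N r
  eq_of_lt _ hx := dyadicField_of_lt e hN hr hx
  grad_le x := by
    by_cases h : ∃ k < N, x ∈ annulus d r k
    · obtain ⟨k, hkN, hk⟩ := h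
      refine (norm_fderiv_dyadicField_le hC' hr hkN hk).trans ((h0 k hkN).trans ?_)
      refine mul_le_mul_of_nonneg_left ?_ hκ
      rw [weight, sub_zero]
      refine Real.rpow_le_rpow_of_nonpos (by positivity) ?_
        (neg_nonpos.2 (div_nonneg d.cast_nonneg (by norm_num)))
      have h4 : (1 : ℝ) ≤ 4 ^ k := one_le_pow₀ (by norm_num)
      have h5 : r ≤ 4 ^ k * r := by nlinarith
      have h6 := hk.2
      nlinarith [norm_nonneg x]
    · push Not at h
      rw [fderiv_dyadicField_eq_zero e hr h, norm_zero]
      exact mul_nonneg hκ (weight_nonneg _ _ _)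
  sq_le := (integral_norm_dyadicField_sq_le hC hN hr).trans h1
  grad_sq_le := (integral_norm_fderiv_dyadicField_pow_le hC' N hr two_ne_zero).trans h2
  grad_abs_le := by
    simpa only [pow_one] using
      (integral_norm_fderiv_dyadicField_pow_le hC' N hr one_ne_zero).trans h3

/-- Cutoff fields in dimension three, at a single scale. -/
theorem exists_isCutoffField_three (e : Vec 3) :
    ∃ C : ℝ, 0 < C ∧ ∀ r : ℝ, 0 < r → r ≤ 1 →
      ∃ Φ : Vec 3 → Vec 3, IsCutoffField Φ e r (C * √r) (C * r ^ 2) := by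
  obtain ⟨C, hC0, hC, hC'⟩ := exists_basicField_bound e
  set V := volume.real (Metric.ball (0 : Vec 3) 1) with hV
  have hV0 : 0 ≤ V := measureReal_nonneg
  -- One scale is enough, since the gradient is of size `1/r = √r · r^(-3/2)` at distance comparable
  -- to `r`. The summands serve, in order, the pointwise, `L¹` and `L²` bounds; the final `1` makes
  -- the constant at most its square.
  refine ⟨5 * C + 64 * C * V + 64 * C ^ 2 * V + 1, by positivity, fun r hr hr1 => ⟨dyadicField e 1 r,
    isCutoffField_dyadicField (Or.inr rfl) hC hC' one_pos hr (by positivity) ?_ ?_ ?_ ?_⟩⟩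
  · intro k hk
    obtain rfl : k = 0 := by omega
    have h1 : (5 * r ^ 2 : ℝ) ^ (-((3 : ℕ) / 4 : ℝ)) = 5 ^ (-(3 / 4) : ℝ) * r ^ (-(3 / 2) : ℝ) := by
      rw [Real.mul_rpow (by norm_num) (by positivity), ← Real.rpow_natCast r 2,
        ← Real.rpow_mul hr.le]
      norm_num
    have h2 : √r * r ^ (-(3 / 2) : ℝ) = r⁻¹ := by
      rw [Real.sqrt_eq_rpow, ← Real.rpow_add hr, ← Real.rpow_neg_one]
      norm_num
    have h3 : (5 : ℝ)⁻¹ ≤ 5 ^ (-(3 / 4) : ℝ) := by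
      rw [← Real.rpow_neg_one]
      exact Real.rpow_le_rpow_of_exponent_le (by norm_num) (by norm_num)
    simp only [Nat.cast_one, inv_one, pow_zero, one_mul]
    rw [h1]
    calc C / r = 5 * C * 5⁻¹ * r⁻¹ := by field_simp
      _ ≤ (5 * C + 64 * C * V + 64 * C ^ 2 * V + 1) * 5 ^ (-(3 / 4) : ℝ) * r⁻¹ := by
          gcongr
          nlinarith [mul_nonneg hC0.le hV0, mul_nonneg (sq_nonneg C) hV0]
      _ = _ := by rw [← h2]; ring
  · rw [mul_pow _ √r, Real.sq_sqrt hr.le, pow_one]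
    have h1 : 64 * C ^ 2 * V * r ≤ (5 * C + 64 * C * V + 64 * C ^ 2 * V + 1) ^ 2 * r := by
      refine mul_le_mul_of_nonneg_right ?_ hr.le
      nlinarith [mul_nonneg hC0.le hV0, mul_nonneg (sq_nonneg C) hV0]
    have h2 : r ^ 3 ≤ r := by
      calc r ^ 3 ≤ r ^ 1 := pow_le_pow_of_le_one hr.le hr1 (by norm_num)
        _ = r := pow_one r
    calc C ^ 2 * ((4 * r) ^ 3 * V) = 64 * C ^ 2 * V * r ^ 3 := by ring
      _ ≤ 64 * C ^ 2 * V * r := by gcongr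
      _ ≤ _ := h1
  · rw [mul_pow _ √r, Real.sq_sqrt hr.le]
    simp only [Finset.sum_range_one, Nat.cast_one, inv_one, pow_zero, one_mul]
    calc (C / r) ^ 2 * ((2 * r) ^ 3 * V) = 8 * C ^ 2 * V * r := by field_simp; ring
      _ ≤ _ := by
        refine mul_le_mul_of_nonneg_right ?_ hr.le
        nlinarith [mul_nonneg hC0.le hV0, mul_nonneg (sq_nonneg C) hV0]
  · simp only [Finset.sum_range_one, Nat.cast_one, inv_one, pow_zero, one_mul, pow_one]
    calc C / r * ((2 * r) ^ 3 * V) = 8 * C * V * r ^ 2 := by field_simp; ring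
      _ ≤ _ := by
        refine mul_le_mul_of_nonneg_right ?_ (by positivity)
        nlinarith [mul_nonneg hC0.le hV0, mul_nonneg (sq_nonneg C) hV0]

/-- Cutoff fields in dimension two: averages over many scales are as small as desired. -/
theorem exists_isCutoffField_two (e : Vec 2) {η : ℝ} (hη : 0 < η) :
    ∀ᶠ r in 𝓝[>] (0 : ℝ), ∃ Φ : Vec 2 → Vec 2, IsCutoffField Φ e r η η := by
  obtain ⟨C, hC0, hC, hC'⟩ := exists_basicField_bound e
  set V := volume.real (Metric.ball (0 : Vec 2) 1) with hV
  have hV0 : 0 ≤ V := measureReal_nonneg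
  -- The first threshold gives the pointwise bound, with `3` above `√5`. The second gives the `L²`
  -- bound on the gradient: by scale invariance in the plane each annulus is charged `4 C² V / N²`,
  -- so the total is `4 C² V / N`.
  obtain ⟨N, hN⟩ := exists_nat_gt (max (3 * C / η) (4 * C ^ 2 * V / η ^ 2))
  have hN1 : 3 * C / η < N := (le_max_left _ _).trans_lt hN
  have hN2 : 4 * C ^ 2 * V / η ^ 2 < N := (le_max_right _ _).trans_lt hN
  have hNpos : (0 : ℝ) < N := lt_of_le_of_lt (by positivity) hN1
  have hN0 : 0 < N := by exact_mod_cast hNpos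
  rw [div_lt_iff₀ hη] at hN1
  rw [div_lt_iff₀ (by positivity)] at hN2
  -- `N` is now fixed, so the support shrinks with `r`. This makes the `L²` norm of the field and
  -- the `L¹` norm of its gradient small.
  have t1 : Tendsto (fun r : ℝ => C ^ 2 * ((4 ^ N * r) ^ 2 * V)) (𝓝[>] 0) (𝓝 0) := by
    have : Continuous fun r : ℝ => C ^ 2 * ((4 ^ N * r) ^ 2 * V) := by fun_prop
    simpa using (this.tendsto 0).mono_left nhdsWithin_le_nhds
  have t2 : Tendsto (fun r : ℝ => 4 * C * V * (4 ^ N * r)) (𝓝[>] 0) (𝓝 0) := by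
    have : Continuous fun r : ℝ => 4 * C * V * (4 ^ N * r) := by fun_prop
    simpa using (this.tendsto 0).mono_left nhdsWithin_le_nhds
  filter_upwards [t1.eventually_le_const (show 0 < η ^ 2 by positivity),
    t2.eventually_le_const hη, self_mem_nhdsWithin] with r h1 h2 hr
  replace hr : 0 < r := hr
  refine ⟨dyadicField e N r, isCutoffField_dyadicField (Or.inl rfl) hC hC' hN0 hr hη.le ?_ h1 ?_ ?_⟩
  · intro k _
    have hR : 0 < 4 ^ k * r := by positivity
    generalize 4 ^ k * r = R at hR
    have h3 : (5 * R ^ 2 : ℝ) ^ (-((2 : ℕ) / 4 : ℝ)) = (√5 * R)⁻¹ := by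
      rw [Real.rpow_neg (by positivity), show ((2 : ℕ) / 4 : ℝ) = 1 / 2 by norm_num,
        ← Real.sqrt_eq_rpow, Real.sqrt_mul (by norm_num), Real.sqrt_sq hR.le]
    have h5 : √5 ≤ 3 := by
      rw [Real.sqrt_le_left (by norm_num)]; norm_num
    have h50 : 0 < √5 := by positivity
    rw [h3, inv_mul_le_iff₀ hNpos, div_le_iff₀ hR, mul_inv]
    have h6 : N * (η * ((√5)⁻¹ * R⁻¹)) * R = N * η * (√5)⁻¹ := by field_simp
    rw [h6, ← div_eq_mul_inv, le_div_iff₀ h50]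
    nlinarith
  · have h3 : ∀ k, ((N : ℝ)⁻¹ * (C / (4 ^ k * r))) ^ 2 * ((2 * (4 ^ k * r)) ^ 2 * V) =
        (N : ℝ)⁻¹ ^ 2 * (4 * C ^ 2 * V) := fun k => by
      have hR : 0 < 4 ^ k * r := by positivity
      field_simp
      ring
    simp only [← hV, h3, Finset.sum_const, Finset.card_range, nsmul_eq_mul]
    have h4 : (N : ℝ) * ((N : ℝ)⁻¹ ^ 2 * (4 * C ^ 2 * V)) = (N : ℝ)⁻¹ * (4 * C ^ 2 * V) := by
      field_simp
    rw [h4, inv_mul_le_iff₀ hNpos]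
    linarith
  · have h3 : ∀ k ∈ Finset.range N, ((N : ℝ)⁻¹ * (C / (4 ^ k * r))) ^ 1 *
        ((2 * (4 ^ k * r)) ^ 2 * V) ≤ (N : ℝ)⁻¹ * η := fun k hk => by
      have hR : 0 < 4 ^ k * r := by positivity
      have h4 : (4 : ℝ) ^ k ≤ 4 ^ N :=
        pow_le_pow_right₀ (by norm_num) (Finset.mem_range.1 hk).le
      calc ((N : ℝ)⁻¹ * (C / (4 ^ k * r))) ^ 1 * ((2 * (4 ^ k * r)) ^ 2 * V)
          = (N : ℝ)⁻¹ * (4 * C * V * (4 ^ k * r)) := by field_simp; ring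
        _ ≤ (N : ℝ)⁻¹ * (4 * C * V * (4 ^ N * r)) := by gcongr
        _ ≤ _ := by gcongr
    refine (Finset.sum_le_sum h3).trans (le_of_eq ?_)
    simp only [Finset.sum_const, Finset.card_range, nsmul_eq_mul]
    field_simp

end Cutoff

/-! ### Fluid terms of the weak formulation at a fixed time -/

section Remainder

variable {d : ℕ}

/-- The integrand, in the fluid, of the weak formulation tested with a field which moves with
velocity `k`; here `y` is the position relative to the moving frame. -/
def remainder (ν : ℝ) (Φ : Vec d → Vec d) (c₀ c₁ : ℝ) (y k v : Vec d)
    (A : Matrix (Fin d) (Fin d) ℝ) : ℝ :=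
  inner ℝ v (c₀ • Φ y + c₁ • fderiv ℝ Φ y (v - k)) -
    2 * ν * c₁ * contract (symPart A) (symPart (jacobian Φ y))

theorem abs_jacobian_le (Φ : Vec d → Vec d) (y : Vec d) (i j : Fin d) :
    |jacobian Φ y i j| ≤ ‖fderiv ℝ Φ y‖ := by
  refine (abs_coord_le _ i).trans (((fderiv ℝ Φ y).le_opNorm _).trans (le_of_eq ?_))
  simp

theorem contract_symPart_jacobian_le (hd : d = 2 ∨ d = 3) (Φ : Vec d → Vec d) (y : Vec d) :
    contract (symPart (jacobian Φ y)) (symPart (jacobian Φ y)) ≤ 9 * ‖fderiv ℝ Φ y‖ ^ 2 := by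
  have h : ∀ i j, symPart (jacobian Φ y) i j * symPart (jacobian Φ y) i j ≤
      ‖fderiv ℝ Φ y‖ ^ 2 := by
    intro i j
    have h1 := abs_le.1 (abs_jacobian_le Φ y i j)
    have h2 := abs_le.1 (abs_jacobian_le Φ y j i)
    have : symPart (jacobian Φ y) i j = 1 / 2 * (jacobian Φ y i j + jacobian Φ y j i) := rfl
    rw [this]
    nlinarith
  refine (Finset.sum_le_sum fun i _ => Finset.sum_le_sum fun j _ => h i j).trans ?_
  have := sq_nonneg ‖fderiv ℝ Φ y‖
  rcases hd with rfl | rfl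
  · simp; linarith
  · simp; linarith

theorem aestronglyMeasurable_remainder {α : Type*} [MeasurableSpace α] {μ : Measure α} {ν : ℝ}
    {Φ : Vec d → Vec d} (hΦ : ContDiff ℝ (⊤ : ℕ∞) Φ) {c₀ c₁ : α → ℝ} {y k v : α → Vec d}
    {A : α → Matrix (Fin d) (Fin d) ℝ} (h₀ : AEStronglyMeasurable c₀ μ)
    (h₁ : AEStronglyMeasurable c₁ μ) (hy : AEStronglyMeasurable y μ)
    (hk : AEStronglyMeasurable k μ) (hv : AEStronglyMeasurable v μ)
    (hA : ∀ i j, AEStronglyMeasurable (fun a => A a i j) μ) :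
    AEStronglyMeasurable (fun a => remainder ν Φ (c₀ a) (c₁ a) (y a) (k a) (v a) (A a)) μ := by
  have hD : Continuous (fderiv ℝ Φ) := hΦ.continuous_fderiv (by simp)
  have m1 : AEStronglyMeasurable (fun a => Φ (y a)) μ :=
    hΦ.continuous.comp_aestronglyMeasurable hy
  have m2 : AEStronglyMeasurable (fun a => fderiv ℝ Φ (y a) (v a - k a)) μ := by
    have hc : Continuous fun p : Vec d × Vec d => fderiv ℝ Φ p.1 p.2 :=
      (hD.comp continuous_fst).clm_apply continuous_snd
    exact hc.comp_aestronglyMeasurable (hy.prodMk (hv.sub hk))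
  have m3 : ∀ i j, AEStronglyMeasurable (fun a => jacobian Φ (y a) i j) μ := fun i j => by
    have hc : Continuous fun y : Vec d => fderiv ℝ Φ y (EuclideanSpace.single j 1) i :=
      (EuclideanSpace.proj i : Vec d →L[ℝ] ℝ).continuous.comp (hD.clm_apply continuous_const)
    exact hc.comp_aestronglyMeasurable hy
  refine (hv.inner ((h₀.smul m1).add (h₁.smul m2))).sub ((h₁.const_mul _).mul ?_)
  refine Finset.aestronglyMeasurable_fun_sum _ fun i _ =>
    Finset.aestronglyMeasurable_fun_sum _ fun j _ => ?_
  exact (((hA i j).add (hA j i)).const_mul _).mul (((m3 i j).add (m3 j i)).const_mul _)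

/-- Young's inequality with parameter `κ`, balanced so that a field of `H¹` size `κ` leaves terms of
order `κ` after integration. In the convective term `|v| (|v| + K) ≤ 2 |v|² + K²`: the quadratic
part is charged to the weight, the constant part to the `L¹` norm of `∇Φ`. -/
theorem abs_remainder_le (hd : d = 2 ∨ d = 3) {ν : ℝ} (hν : 0 < ν) {Φ : Vec d → Vec d}
    {e : Vec d} {r κ κ' : ℝ} (hΦ : IsCutoffField Φ e r κ κ') (hκ : 0 < κ) {c₀ c₁ : ℝ}
    (h₁ : |c₁| ≤ 1) {K : ℝ} {y k : Vec d} (hk : ‖k‖ ≤ K) (v : Vec d)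
    (A : Matrix (Fin d) (Fin d) ℝ) :
    |remainder ν Φ c₀ c₁ y k v A| ≤
      |c₀| * (κ / 2 * ‖v‖ ^ 2 + (2 * κ)⁻¹ * ‖Φ y‖ ^ 2) + 2 * κ * (weight d r 0 y * ‖v‖ ^ 2) +
        K ^ 2 * ‖fderiv ℝ Φ y‖ +
        ν * (κ * contract (symPart A) (symPart A) + 9 / κ * ‖fderiv ℝ Φ y‖ ^ 2) := by
  have hK : 0 ≤ K := (norm_nonneg _).trans hk
  have hL := norm_nonneg (fderiv ℝ Φ y)
  have hv := norm_nonneg v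
  set L := ‖fderiv ℝ Φ y‖ with hLdef
  have a1 : ‖v‖ * ‖Φ y‖ ≤ κ / 2 * ‖v‖ ^ 2 + (2 * κ)⁻¹ * ‖Φ y‖ ^ 2 := by
    have : κ / 2 * ‖v‖ ^ 2 + (2 * κ)⁻¹ * ‖Φ y‖ ^ 2 - ‖v‖ * ‖Φ y‖ =
        (κ * ‖v‖ - ‖Φ y‖) ^ 2 / (2 * κ) := by field_simp; ring
    have h2 : 0 ≤ (κ * ‖v‖ - ‖Φ y‖) ^ 2 / (2 * κ) := by positivity
    linarith
  have a2 : ‖fderiv ℝ Φ y (v - k)‖ ≤ L * (‖v‖ + K) :=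
    ((fderiv ℝ Φ y).le_opNorm _).trans (mul_le_mul_of_nonneg_left
      ((norm_sub_le _ _).trans (by linarith)) hL)
  have a3 : ‖v‖ * (L * (‖v‖ + K)) ≤ 2 * κ * (weight d r 0 y * ‖v‖ ^ 2) + K ^ 2 * L := by
    have h1 : ‖v‖ * (‖v‖ + K) ≤ 2 * ‖v‖ ^ 2 + K ^ 2 := by nlinarith [sq_nonneg (‖v‖ - K)]
    have h2 := mul_le_mul_of_nonneg_left h1 hL
    have h3 := mul_le_mul_of_nonneg_right (hΦ.grad_le y) (sq_nonneg ‖v‖)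
    nlinarith
  have a4 : 2 * |contract (symPart A) (symPart (jacobian Φ y))| ≤
      κ * contract (symPart A) (symPart A) + 9 / κ * L ^ 2 := by
    have h1 := contract_sq_le (symPart A) (symPart (jacobian Φ y))
    have h2 := contract_symPart_jacobian_le hd Φ y
    have h3 := contract_self_nonneg (symPart A)
    set X := contract (symPart A) (symPart A)
    set Y := contract (symPart (jacobian Φ y)) (symPart (jacobian Φ y))
    have h4 : (2 * contract (symPart A) (symPart (jacobian Φ y))) ^ 2 ≤
        (κ * X + 9 / κ * L ^ 2) ^ 2 := by
      have h5 : κ * X * (9 / κ * L ^ 2) = X * (9 * L ^ 2) := by field_simp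
      nlinarith [mul_le_mul_of_nonneg_left h2 h3, sq_nonneg (κ * X - 9 / κ * L ^ 2)]
    have := abs_le_of_sq_le_sq h4 (by positivity)
    rwa [abs_mul, abs_two] at this
  rw [remainder]
  refine (abs_sub _ _).trans ?_
  have b1 : |inner ℝ v (c₀ • Φ y + c₁ • fderiv ℝ Φ y (v - k))| ≤
      |c₀| * (‖v‖ * ‖Φ y‖) + ‖v‖ * (L * (‖v‖ + K)) := by
    refine (abs_real_inner_le_norm _ _).trans ?_
    have h1 : ‖c₀ • Φ y + c₁ • fderiv ℝ Φ y (v - k)‖ ≤ |c₀| * ‖Φ y‖ + 1 * (L * (‖v‖ + K)) := by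
      refine (norm_add_le _ _).trans (add_le_add ?_ ?_)
      · rw [norm_smul, Real.norm_eq_abs]
      · rw [norm_smul, Real.norm_eq_abs]
        exact mul_le_mul h₁ a2 (norm_nonneg _) zero_le_one
    calc _ ≤ ‖v‖ * (|c₀| * ‖Φ y‖ + 1 * (L * (‖v‖ + K))) := mul_le_mul_of_nonneg_left h1 hv
      _ = _ := by ring
  have b2 : |2 * ν * c₁ * contract (symPart A) (symPart (jacobian Φ y))| ≤
      ν * (2 * |contract (symPart A) (symPart (jacobian Φ y))|) := by
    rw [abs_mul, abs_mul, abs_of_pos (by positivity : 0 < 2 * ν)]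
    have := mul_le_mul_of_nonneg_right h₁ (abs_nonneg (contract (symPart A) (symPart (jacobian Φ y))))
    nlinarith
  have b3 := mul_le_mul_of_nonneg_left a1 (abs_nonneg c₀)
  have b4 := mul_le_mul_of_nonneg_left a4 hν.le
  linarith

variable {S : Set (Vec d)} {ρ : Vec d → ℝ}

theorem IsCutoffField.fderiv_eq_zero {Φ : Vec d → Vec d} {e : Vec d} {r κ κ' : ℝ}
    (hΦ : IsCutoffField Φ e r κ κ') {y : Vec d} (hy : ‖y‖ < r) : fderiv ℝ Φ y = 0 := by
  have : Φ =ᶠ[𝓝 y] fun _ => e := by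
    filter_upwards [Metric.isOpen_ball.mem_nhds (show y ∈ Metric.ball (0 : Vec d) r by simpa)]
      with z hz using hΦ.eq_of_lt z (by simpa using hz)
  rw [this.fderiv_eq, fderiv_fun_const, Pi.zero_apply]

theorem IsCutoffField.jacobian_eq_zero {Φ : Vec d → Vec d} {e : Vec d} {r κ κ' : ℝ}
    (hΦ : IsCutoffField Φ e r κ κ') {y : Vec d} (hy : ‖y‖ < r) : jacobian Φ y = 0 := by
  ext i j
  simp [jacobian, hΦ.fderiv_eq_zero hy]

theorem symPart_zero : symPart (0 : Matrix (Fin d) (Fin d) ℝ) = 0 := by simp [symPart]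

theorem contract_zero_right (A : Matrix (Fin d) (Fin d) ℝ) : contract A 0 = 0 := by simp [contract]

theorem symPart_smul (c : ℝ) (A : Matrix (Fin d) (Fin d) ℝ) :
    symPart (c • A) = c • symPart A := by
  simp [symPart, smul_add, smul_comm c]

theorem contract_smul_right (c : ℝ) (A B : Matrix (Fin d) (Fin d) ℝ) :
    contract A (c • B) = c * contract A B := by
  simp only [contract, Finset.mul_sum, Matrix.smul_apply, smul_eq_mul]
  exact Finset.sum_congr rfl fun i _ => Finset.sum_congr rfl fun j _ => by ring

theorem integrable_contract_symPart {α : Type*} [MeasurableSpace α] {μ : Measure α}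
    {G : α → Matrix (Fin d) (Fin d) ℝ} (hG : ∀ i j, MemLp (fun x => G x i j) 2 μ) :
    Integrable (fun x => contract (symPart (G x)) (symPart (G x))) μ := by
  refine integrable_finsetSum _ fun i _ => integrable_finsetSum _ fun j _ => ?_
  have : MemLp (fun x => symPart (G x) i j) 2 μ := by
    simpa [symPart] using ((hG i j).add (hG j i)).const_mul (2⁻¹ : ℝ)
  exact this.integrable_mul this

theorem integrable_norm_pow_comp_sub {F : Type*} [NormedAddCommGroup F] {f : Vec d → F}
    (hf : Continuous f) (hc : HasCompactSupport f) {p : ℕ} (hp : p ≠ 0) (H : Vec d) :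
    Integrable fun x => ‖f (x - H)‖ ^ p := by
  have h1 : HasCompactSupport fun x => ‖f x‖ ^ p :=
    hc.comp_left (g := fun z => ‖z‖ ^ p) (by simp [hp])
  have h2 : Continuous fun x => ‖f x‖ ^ p := hf.norm.pow p
  exact (h2.integrable_of_hasCompactSupport h1).comp_sub_right H

/-- The remainder at a fixed time is integrable and small. -/
theorem integral_remainder_le (hd : d = 2 ∨ d = 3) {ν : ℝ} (hν : 0 < ν) {v : Vec d → Vec d}
    {G : Vec d → Matrix (Fin d) (Fin d) ℝ}
    (hv : MemLp v 2) (hG : ∀ i j, MemLp (fun x => G x i j) 2) (hw : HasWeakGradient v G)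
    (hdiv : IsWeakDivFree v) {B : Set (Vec d)} (hB : MeasurableSet B)
    (hrig : ∀ᵐ x ∂(volume.restrict B), symPart (G x) = 0) {E : ℝ}
    (hE : ∫ x in Bᶜ, ‖v x‖ ^ 2 ≤ E) {Φ : Vec d → Vec d}
    {e : Vec d} {r κ κ' : ℝ} (hr : 0 < r) (hΦ : IsCutoffField Φ e r κ κ') (hκ : 0 < κ) {c₀ c₁ : ℝ}
    (h₁ : |c₁| ≤ 1) {K : ℝ} {k : Vec d} (hk : ‖k‖ ≤ K) (H : Vec d) :
    Integrable (fun x => remainder ν Φ c₀ c₁ (x - H) k (v x) (G x)) ∧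
    |∫ x in Bᶜ, remainder ν Φ c₀ c₁ (x - H) k (v x) (G x)| ≤
      |c₀| * (κ * ((E + 1) / 2)) + (κ * (128 * E + 9 * ν) + K ^ 2 * κ') +
        κ * (32 + ν) * ∫ x, contract (symPart (G x)) (symPart (G x)) := by
  -- The weight is centred at the moving frame and its scale is the radius of the cutoff. Since `v`
  -- is bounded only outside `B`, it matters that the right-hand side of the inequality sees `v`
  -- only there.
  obtain ⟨iw, bw⟩ := integral_weight_mul_norm_sq_le hd hv hG hw hdiv hB hrig hr H
  have iv : Integrable fun x => ‖v x‖ ^ 2 := hv.integrable_norm_pow (by norm_num)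
  have iD := integrable_contract_symPart hG
  have cΦ : Continuous (fderiv ℝ Φ) := hΦ.smooth.continuous_fderiv (by simp)
  have iΦ : Integrable fun x => ‖Φ (x - H)‖ ^ 2 :=
    integrable_norm_pow_comp_sub hΦ.smooth.continuous hΦ.compactSupport two_ne_zero H
  have iΦ1 : Integrable fun x => ‖fderiv ℝ Φ (x - H)‖ := by
    simpa only [pow_one] using
      integrable_norm_pow_comp_sub cΦ (hΦ.compactSupport.fderiv ℝ) one_ne_zero H
  have iΦ2 : Integrable fun x => ‖fderiv ℝ Φ (x - H)‖ ^ 2 :=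
    integrable_norm_pow_comp_sub cΦ (hΦ.compactSupport.fderiv ℝ) two_ne_zero H
  have eΦ : ∫ x, ‖Φ (x - H)‖ ^ 2 ≤ κ ^ 2 := by
    rw [integral_sub_right_eq_self (fun x => ‖Φ x‖ ^ 2) H]; exact hΦ.sq_le
  have eΦ1 : ∫ x, ‖fderiv ℝ Φ (x - H)‖ ≤ κ' := by
    rw [integral_sub_right_eq_self (fun x => ‖fderiv ℝ Φ x‖) H]; exact hΦ.grad_abs_le
  have eΦ2 : ∫ x, ‖fderiv ℝ Φ (x - H)‖ ^ 2 ≤ κ ^ 2 := by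
    rw [integral_sub_right_eq_self (fun x => ‖fderiv ℝ Φ x‖ ^ 2) H]; exact hΦ.grad_sq_le
  have ww : ∀ x, weight d r 0 (x - H) = weight d r H x := fun x => by simp [weight]
  have bd : ∀ x, |remainder ν Φ c₀ c₁ (x - H) k (v x) (G x)| ≤
      |c₀| * (κ / 2 * ‖v x‖ ^ 2 + (2 * κ)⁻¹ * ‖Φ (x - H)‖ ^ 2) +
        2 * κ * (weight d r H x * ‖v x‖ ^ 2) + K ^ 2 * ‖fderiv ℝ Φ (x - H)‖ +
        ν * (κ * contract (symPart (G x)) (symPart (G x)) +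
          9 / κ * ‖fderiv ℝ Φ (x - H)‖ ^ 2) := fun x => by
    rw [← ww]; exact abs_remainder_le hd hν hΦ hκ h₁ hk (v x) (G x)
  have j1 : Integrable fun x => |c₀| * (κ / 2 * ‖v x‖ ^ 2 + (2 * κ)⁻¹ * ‖Φ (x - H)‖ ^ 2) :=
    ((iv.const_mul _).add (iΦ.const_mul _)).const_mul _
  have j2 : Integrable fun x => 2 * κ * (weight d r H x * ‖v x‖ ^ 2) := iw.const_mul _
  have j3 : Integrable fun x => K ^ 2 * ‖fderiv ℝ Φ (x - H)‖ := iΦ1.const_mul _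
  have j4 : Integrable fun x => ν * (κ * contract (symPart (G x)) (symPart (G x)) +
          9 / κ * ‖fderiv ℝ Φ (x - H)‖ ^ 2) :=
    ((iD.const_mul _).add (iΦ2.const_mul _)).const_mul _
  have j12 : Integrable fun x => |c₀| * (κ / 2 * ‖v x‖ ^ 2 + (2 * κ)⁻¹ * ‖Φ (x - H)‖ ^ 2) +
      2 * κ * (weight d r H x * ‖v x‖ ^ 2) := j1.add j2
  have j123 : Integrable fun x => |c₀| * (κ / 2 * ‖v x‖ ^ 2 + (2 * κ)⁻¹ * ‖Φ (x - H)‖ ^ 2) +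
      2 * κ * (weight d r H x * ‖v x‖ ^ 2) + K ^ 2 * ‖fderiv ℝ Φ (x - H)‖ := j12.add j3
  have j1234 : Integrable fun x =>
      |c₀| * (κ / 2 * ‖v x‖ ^ 2 + (2 * κ)⁻¹ * ‖Φ (x - H)‖ ^ 2) +
        2 * κ * (weight d r H x * ‖v x‖ ^ 2) + K ^ 2 * ‖fderiv ℝ Φ (x - H)‖ +
        ν * (κ * contract (symPart (G x)) (symPart (G x)) +
          9 / κ * ‖fderiv ℝ Φ (x - H)‖ ^ 2) := j123.add j4
  have hmeas : AEStronglyMeasurable (fun x => remainder ν Φ c₀ c₁ (x - H) k (v x) (G x)) volume :=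
    aestronglyMeasurable_remainder hΦ.smooth aestronglyMeasurable_const aestronglyMeasurable_const
      (continuous_id.sub continuous_const).aestronglyMeasurable aestronglyMeasurable_const hv.1
      fun i j => (hG i j).1
  refine ⟨j1234.mono' hmeas (ae_of_all _ bd), ?_⟩
  have step : |∫ x in Bᶜ, remainder ν Φ c₀ c₁ (x - H) k (v x) (G x)| ≤ ∫ x in Bᶜ,
      (|c₀| * (κ / 2 * ‖v x‖ ^ 2 + (2 * κ)⁻¹ * ‖Φ (x - H)‖ ^ 2) +
        2 * κ * (weight d r H x * ‖v x‖ ^ 2) + K ^ 2 * ‖fderiv ℝ Φ (x - H)‖ +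
        ν * (κ * contract (symPart (G x)) (symPart (G x)) +
          9 / κ * ‖fderiv ℝ Φ (x - H)‖ ^ 2)) := by
    rw [← Real.norm_eq_abs]
    exact norm_integral_le_of_norm_le j1234.integrableOn (ae_of_all _ bd)
  refine step.trans ?_
  rw [integral_add j123.integrableOn j4.integrableOn, integral_add j12.integrableOn j3.integrableOn,
    integral_add j1.integrableOn j2.integrableOn, integral_const_mul, integral_const_mul,
    integral_const_mul, integral_const_mul,
    integral_add (iv.const_mul _).integrableOn (iΦ.const_mul _).integrableOn,
    integral_add (iD.const_mul _).integrableOn (iΦ2.const_mul _).integrableOn,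
    integral_const_mul, integral_const_mul, integral_const_mul, integral_const_mul]
  have s1 : ∫ x in Bᶜ, ‖Φ (x - H)‖ ^ 2 ≤ κ ^ 2 :=
    (setIntegral_le_integral iΦ (ae_of_all _ fun x => by positivity)).trans eΦ
  have s2 : ∫ x in Bᶜ, weight d r H x * ‖v x‖ ^ 2 ≤
      64 * E + 16 * ∫ x, contract (symPart (G x)) (symPart (G x)) :=
    (setIntegral_le_integral iw (ae_of_all _ fun x =>
      mul_nonneg (weight_nonneg _ _ _) (sq_nonneg _))).trans (bw.trans (by linarith))
  have s3 : ∫ x in Bᶜ, ‖fderiv ℝ Φ (x - H)‖ ≤ κ' :=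
    (setIntegral_le_integral iΦ1 (ae_of_all _ fun x => by positivity)).trans eΦ1
  have s4 : ∫ x in Bᶜ, ‖fderiv ℝ Φ (x - H)‖ ^ 2 ≤ κ ^ 2 :=
    (setIntegral_le_integral iΦ2 (ae_of_all _ fun x => by positivity)).trans eΦ2
  have s5 : ∫ x in Bᶜ, contract (symPart (G x)) (symPart (G x)) ≤
      ∫ x, contract (symPart (G x)) (symPart (G x)) :=
    setIntegral_le_integral iD (ae_of_all _ fun x => contract_self_nonneg _)
  set D := ∫ x, contract (symPart (G x)) (symPart (G x))
  have t1 : κ / 2 * (∫ x in Bᶜ, ‖v x‖ ^ 2) + (2 * κ)⁻¹ * (∫ x in Bᶜ, ‖Φ (x - H)‖ ^ 2) ≤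
      κ * ((E + 1) / 2) := by
    calc _ ≤ κ / 2 * E + (2 * κ)⁻¹ * κ ^ 2 := by gcongr
      _ = _ := by field_simp
  have t4 : κ * (∫ x in Bᶜ, contract (symPart (G x)) (symPart (G x))) +
      9 / κ * (∫ x in Bᶜ, ‖fderiv ℝ Φ (x - H)‖ ^ 2) ≤ κ * D + 9 * κ := by
    calc _ ≤ κ * D + 9 / κ * κ ^ 2 := by gcongr
      _ = _ := by field_simp
  calc _ ≤ |c₀| * (κ * ((E + 1) / 2)) + 2 * κ * (64 * E + 16 * D) + K ^ 2 * κ' +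
        ν * (κ * D + 9 * κ) := by gcongr
    _ = _ := by ring

/-- The weak formulation at a fixed time: the body contributes its momentum only. -/
theorem integral_weakForm_eq (hS : IsRigidBody S ρ) {ν : ℝ} {Q : Matrix (Fin d) (Fin d) ℝ}
    (hQ : Q ∈ Matrix.orthogonalGroup (Fin d) ℝ) (h ℓ : Vec d) (ω : AngVel d) (u : Vec d → Vec d)
    (G : Vec d → Matrix (Fin d) (Fin d) ℝ) {Φ : Vec d → Vec d} {e : Vec d} {r κ κ' : ℝ}
    (hΦ : IsCutoffField Φ e r κ κ') {c₀ c₁ : ℝ} {k H : Vec d}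
    (hH : movedBody S h Q ⊆ Metric.ball H r)
    (hint : Integrable fun x => remainder ν Φ c₀ c₁ (x - H) k
      (extVel (movedBody S h Q) (rigidVel ℓ ω h) u x) (G x)) :
    ∫ x, (movedDensity S ρ h Q x * inner ℝ (extVel (movedBody S h Q) (rigidVel ℓ ω h) u x)
        (c₀ • Φ (x - H) - c₁ • fderiv ℝ Φ (x - H) k +
          (c₁ • fderiv ℝ Φ (x - H)) (extVel (movedBody S h Q) (rigidVel ℓ ω h) u x)) -
        2 * ν * contract (symPart (G x)) (symPart (c₁ • jacobian Φ (x - H)))) =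
      c₀ * (mass S ρ * inner ℝ ℓ e) + ∫ x in (movedBody S h Q)ᶜ, remainder ν Φ c₀ c₁ (x - H) k
      (extVel (movedBody S h Q) (rigidVel ℓ ω h) u x) (G x) := by
  have hB := (isClosed_movedBody hS.isClosed h Q).measurableSet
  set v := extVel (movedBody S h Q) (rigidVel ℓ ω h) u with hv
  -- On the body `Φ` is the constant `e`, so the transport and viscous terms vanish and only the
  -- term with `c₀` survives.
  have on1 : EqOn (fun x => c₀ * (movedDensity S ρ h Q x * inner ℝ (v x) e)) (fun x =>
      movedDensity S ρ h Q x * inner ℝ (v x) (c₀ • Φ (x - H) - c₁ • fderiv ℝ Φ (x - H) k +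
          (c₁ • fderiv ℝ Φ (x - H)) (v x)) -
        2 * ν * contract (symPart (G x)) (symPart (c₁ • jacobian Φ (x - H))))
        (movedBody S h Q) := fun x hx => by
    have hy : ‖x - H‖ < r := mem_ball_iff_norm.1 (hH hx)
    have h0 : (c₁ • (0 : Vec d →L[ℝ] Vec d)) (v x) = 0 := by simp
    simp only [hΦ.fderiv_eq_zero hy, hΦ.jacobian_eq_zero hy, hΦ.eq_of_lt _ hy, symPart_zero,
      contract_zero_right, smul_zero, zero_apply, mul_zero, sub_zero, h0, add_zero,
      inner_smul_right]
    ring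
  have on2 : EqOn (fun x => remainder ν Φ c₀ c₁ (x - H) k (v x) (G x)) (fun x =>
      movedDensity S ρ h Q x * inner ℝ (v x) (c₀ • Φ (x - H) - c₁ • fderiv ℝ Φ (x - H) k +
          (c₁ • fderiv ℝ Φ (x - H)) (v x)) -
        2 * ν * contract (symPart (G x)) (symPart (c₁ • jacobian Φ (x - H))))
        (movedBody S h Q)ᶜ := fun x hx => by
    simp only [remainder, movedDensity_of_notMem hx, one_mul, symPart_smul, contract_smul_right,
      smul_apply, map_sub, smul_sub]
    congr 1
    · congr 1
      abel
    · ring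
  have i0 : IntegrableOn (fun x => c₀ * (movedDensity S ρ h Q x * inner ℝ (v x) e))
      (movedBody S h Q) := (integrableOn_movedBody_momentum hS hQ h ℓ e ω u).const_mul c₀
  have i1 := i0.congr_fun on1 hB
  have i2 := (hint.integrableOn (s := (movedBody S h Q)ᶜ)).congr_fun on2 hB.compl
  have hi := i1.union i2
  rw [union_compl_self, integrableOn_univ] at hi
  rw [← integral_add_compl hB hi, ← setIntegral_congr_fun hB on1,
    ← setIntegral_congr_fun hB.compl on2, integral_const_mul,
    integral_movedBody_momentum hS hQ h ℓ e ω u]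

end Remainder

/-! ### Smoothing of the trajectory and time cutoffs -/

section Time

open scoped Convolution

variable {d : ℕ}

/-- A Lipschitz curve is uniformly close to a smooth curve with the same bound on its velocity. -/
theorem exists_contDiff_approx {g : ℝ → Vec d} {K : ℝ≥0} (hg : LipschitzWith K g) {δ : ℝ}
    (hδ : 0 < δ) : ∃ H : ℝ → Vec d, ContDiff ℝ (⊤ : ℕ∞) H ∧ (∀ t, dist (H t) (g t) ≤ δ) ∧
      ∀ t, ‖deriv H t‖ ≤ K := by
  -- On this radius a `K`-Lipschitz curve varies by at most `δ`; the `+ 1` covers `K = 0`.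
  let φ : ContDiffBump (0 : ℝ) := ⟨δ / (K + 1) / 2, δ / (K + 1), by positivity,
    half_lt_self (by positivity)⟩
  have hgl : LocallyIntegrable g := hg.continuous.locallyIntegrable
  refine ⟨φ.normed volume ⋆[ContinuousLinearMap.lsmul ℝ ℝ, volume] g, ?_, fun t => ?_,
    fun t => ?_⟩
  · exact φ.hasCompactSupport_normed.contDiff_convolution_left _ φ.contDiff_normed hgl
  · refine φ.dist_normed_convolution_le hg.continuous.aestronglyMeasurable fun x hx => ?_
    refine (hg.dist_le_mul x t).trans ?_
    have h1 : dist x t ≤ δ / (K + 1) := (Metric.mem_ball.1 hx).le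
    calc (K : ℝ) * dist x t ≤ (K + 1) * (δ / (K + 1)) := by
          gcongr
          linarith
      _ = δ := by field_simp
  · refine norm_deriv_le_of_lipschitz (C := K) (LipschitzWith.of_dist_le_mul fun x y => ?_)
    have hex : ∀ x, Integrable fun s => φ.normed volume s • g (x - s) := fun x =>
      (φ.hasCompactSupport_normed.convolutionExists_left (ContinuousLinearMap.lsmul ℝ ℝ)
        (φ.contDiff_normed (n := 0)).continuous hgl x).integrable
    rw [dist_eq_norm]
    simp only [convolution_def, ContinuousLinearMap.lsmul_apply]
    rw [← integral_sub (hex x) (hex y)]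
    have hb : ∀ s, ‖φ.normed volume s • g (x - s) - φ.normed volume s • g (y - s)‖ ≤
        φ.normed volume s * (K * dist x y) := fun s => by
      rw [← smul_sub, norm_smul, Real.norm_of_nonneg (φ.nonneg_normed s), ← dist_eq_norm]
      refine mul_le_mul_of_nonneg_left ((hg.dist_le_mul _ _).trans (le_of_eq ?_))
        (φ.nonneg_normed s)
      rw [dist_sub_right]
    refine (norm_integral_le_of_norm_le (φ.integrable_normed.mul_const _)
      (ae_of_all _ hb)).trans (le_of_eq ?_)
    rw [integral_mul_const, φ.integral_normed, one_mul]

/-- A time cutoff with prescribed nonpositive derivative. -/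
theorem exists_time_cutoff {g : ℝ → ℝ} (hg : ContDiff ℝ (⊤ : ℕ∞) g) (h0 : ∀ t, 0 ≤ g t) {T : ℝ}
    (hT : 0 < T) (hs : ∀ t, t ∉ Ioo 0 T → g t = 0) (h1 : ∫ t, g t = 1) :
    ∃ χ : ℝ → ℝ, ContDiff ℝ (⊤ : ℕ∞) χ ∧ HasCompactSupport χ ∧ χ 0 = 1 ∧
      (∀ t, 0 < t → |χ t| ≤ 1) ∧ (∀ t, 0 < t → deriv χ t = -g t) ∧ ∀ t, T ≤ t → χ t = 0 := by
  have hd : ∀ t, HasDerivAt (fun t => ∫ s in 0..t, g s) (g t) t := fun t =>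
    intervalIntegral.integral_hasDerivAt_right (hg.continuous.intervalIntegrable _ _)
      hg.continuous.aestronglyMeasurable.stronglyMeasurableAtFilter hg.continuous.continuousAt
  have hP : ContDiff ℝ (⊤ : ℕ∞) fun t => ∫ s in 0..t, g s := by
    rw [contDiff_infty_iff_deriv]
    refine ⟨fun t => (hd t).differentiableAt, ?_⟩
    rwa [show deriv (fun t => ∫ s in 0..t, g s) = g from funext fun t => (hd t).deriv]
  -- This factor is `1` for `t ≥ 0` and `0` for `t ≤ -1`. It makes the support compact on the
  -- negative side without changing anything on the half line.
  have hη : ContDiff ℝ (⊤ : ℕ∞) fun t : ℝ => Real.smoothTransition (t + 1) :=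
    Real.smoothTransition.contDiff.comp (contDiff_id.add contDiff_const)
  have hη1 : ∀ t : ℝ, 0 ≤ t → Real.smoothTransition (t + 1) = 1 := fun t ht =>
    Real.smoothTransition.one_of_one_le (by linarith)
  have hgi : Integrable g := by
    by_contra h
    rw [integral_undef h] at h1
    exact zero_ne_one h1
  have hle : ∀ t, 0 ≤ t → ∫ s in 0..t, g s ≤ 1 := fun t ht => by
    rw [intervalIntegral.integral_of_le ht, ← h1]
    exact setIntegral_le_integral hgi (ae_of_all _ h0)
  have hge : ∀ t, 0 ≤ t → 0 ≤ ∫ s in 0..t, g s := fun t ht =>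
    intervalIntegral.integral_nonneg ht fun s _ => h0 s
  have hend : ∀ t, T ≤ t → ∫ s in 0..t, g s = 1 := fun t ht => by
    rw [intervalIntegral.integral_of_le (hT.le.trans ht), ← h1]
    refine setIntegral_eq_integral_of_forall_compl_eq_zero fun s hsn => hs s fun h => hsn ?_
    exact ⟨h.1, h.2.le.trans ht⟩
  refine ⟨fun t => Real.smoothTransition (t + 1) * (1 - ∫ s in 0..t, g s),
    hη.mul (contDiff_const.sub hP), ?_, ?_, fun t ht => ?_, fun t ht => ?_, fun t ht => ?_⟩
  · refine HasCompactSupport.intro (isCompact_Icc (a := -1) (b := T)) fun t ht => ?_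
    rcases lt_or_ge t (-1) with h | h
    · rw [Real.smoothTransition.zero_of_nonpos (by linarith), zero_mul]
    · have : T ≤ t := by
        by_contra h2
        exact ht ⟨h, (not_le.1 h2).le⟩
      rw [hend t this, sub_self, mul_zero]
  · simp
  · simp only
    rw [hη1 t ht.le, one_mul, abs_le]
    constructor <;> linarith [hle t ht.le, hge t ht.le]
  · have : (fun t => Real.smoothTransition (t + 1) * (1 - ∫ s in 0..t, g s)) =ᶠ[𝓝 t]
        fun t => 1 - ∫ s in 0..t, g s := by
      filter_upwards [Ioi_mem_nhds ht] with s hs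
      rw [hη1 s (le_of_lt hs), one_mul]
    rw [this.deriv_eq]
    exact ((hd t).const_sub 1).deriv
  · simp only
    rw [hend t ht, sub_self, mul_zero]

end Time

/-! ### Consequences of the energy inequality -/

section Solution

variable {d : ℕ} {ν : ℝ} {S : Set (Vec d)} {ρ : Vec d → ℝ}
    {u₀ : Vec d → Vec d} {ℓ₀ : Vec d} {ω₀ : AngVel d}
    {u : ℝ → Vec d → Vec d} {ℓ : ℝ → Vec d} {ω : ℝ → AngVel d}
    {h : ℝ → Vec d} {Q : ℝ → Matrix (Fin d) (Fin d) ℝ}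
    {G : ℝ → Vec d → Matrix (Fin d) (Fin d) ℝ} {E : ℝ}

namespace IsHopfLerayWith

theorem ae_memLp (sol : IsHopfLerayWith ν S ρ u₀ ℓ₀ ω₀ u ℓ ω h Q G) :
    ∀ᵐ t ∂(volume.restrict (Ioi (0 : ℝ))), MemLp (globalVel S u ℓ ω h Q t) 2 := by
  obtain ⟨w, -, hw⟩ := sol.weaklyContinuous
  filter_upwards [hw] with t ht
  exact (memLp_congr_ae ht).1 (Lp.memLp (w t))

/-- The energies of the body and of the fluid, and the dissipation, are bounded by the initial
energy. -/
theorem ae_energy_le (sol : IsHopfLerayWith ν S ρ u₀ ℓ₀ ω₀ u ℓ ω h Q G) (hS : IsRigidBody S ρ)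
    (hE : ∫ x, extDensity S ρ x * ‖initialVel S u₀ ℓ₀ ω₀ x‖ ^ 2 ≤ E) :
    ∀ᵐ t ∂(volume.restrict (Ioi (0 : ℝ))),
      mass S ρ * ‖ℓ t‖ ^ 2 +
        (∫ x in (movedBody S (h t) (Q t))ᶜ, ‖globalVel S u ℓ ω h Q t x‖ ^ 2) +
        4 * ν * (∫ s in Ioo 0 t, ∫ x, contract (symPart (G s x)) (symPart (G s x))) ≤ E := by
  filter_upwards [sol.ae_memLp, sol.energy, ae_restrict_mem measurableSet_Ioi] with t h1 h2 h3
  have h3' : (0 : ℝ) ≤ t := le_of_lt h3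
  have h4 := body_fluid_energy_le hS (sol.motion.rotation t h3') (h t) (ℓ t) (ω t) (u t) h1
  rw [intervalIntegral.integral_of_le h3', integral_Ioc_eq_integral_Ioo] at h2
  have h5 := h2.trans hE
  exact (add_le_add_left h4 _).trans h5

theorem dissipation_nonneg (G : ℝ → Vec d → Matrix (Fin d) (Fin d) ℝ) (s : ℝ) :
    0 ≤ ∫ x, contract (symPart (G s x)) (symPart (G s x)) :=
  integral_nonneg fun _ => contract_self_nonneg _

theorem integrableOn_dissipation (sol : IsHopfLerayWith ν S ρ u₀ ℓ₀ ω₀ u ℓ ω h Q G) {T : ℝ}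
    (hT : 0 < T) :
    IntegrableOn (fun s => ∫ x, contract (symPart (G s x)) (symPart (G s x))) (Ioo 0 T) :=
  (integrable_contract_symPart (G := fun p : ℝ × Vec d => G p.1 p.2)
    (sol.gradient_L2 T hT)).integral_prod_left

/-- The energy inequality holds only for almost every time, so it is used at some good time after
`T`; the accumulated dissipation is monotone. -/
theorem dissipation_le (sol : IsHopfLerayWith ν S ρ u₀ ℓ₀ ω₀ u ℓ ω h Q G) (hν : 0 < ν)
    (hS : IsRigidBody S ρ)
    (hE : ∫ x, extDensity S ρ x * ‖initialVel S u₀ ℓ₀ ω₀ x‖ ^ 2 ≤ E) {T : ℝ} (hT : 0 < T) :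
    4 * ν * (∫ s in Ioo 0 T, ∫ x, contract (symPart (G s x)) (symPart (G s x))) ≤ E := by
  have h1 := sol.ae_energy_le hS hE
  have h2 : ∀ᵐ t ∂(volume.restrict (Ioi T)), mass S ρ * ‖ℓ t‖ ^ 2 +
        (∫ x in (movedBody S (h t) (Q t))ᶜ, ‖globalVel S u ℓ ω h Q t x‖ ^ 2) +
        4 * ν * (∫ s in Ioo 0 t, ∫ x, contract (symPart (G s x)) (symPart (G s x))) ≤ E :=
    ae_restrict_of_ae_restrict_of_subset (Ioi_subset_Ioi hT.le) h1
  have h3 : (ae (volume.restrict (Ioi T))).NeBot := by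
    rw [ae_restrict_neBot]; simp
  obtain ⟨t, ht, htT⟩ := (h2.and (ae_restrict_mem measurableSet_Ioi)).exists
  have h4 : ∫ s in Ioo 0 T, ∫ x, contract (symPart (G s x)) (symPart (G s x)) ≤
      ∫ s in Ioo 0 t, ∫ x, contract (symPart (G s x)) (symPart (G s x)) :=
    setIntegral_mono_set (sol.integrableOn_dissipation (hT.trans htT))
      (ae_of_all _ fun s => dissipation_nonneg G s)
      (Ioo_subset_Ioo_right (le_of_lt htT)).eventuallyLE
  have h5 : 0 ≤ mass S ρ * ‖ℓ t‖ ^ 2 := mul_nonneg hS.mass_nonneg (sq_nonneg _)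
  have h6 : 0 ≤ ∫ x in (movedBody S (h t) (Q t))ᶜ, ‖globalVel S u ℓ ω h Q t x‖ ^ 2 :=
    integral_nonneg fun _ => sq_nonneg _
  have h7 := mul_le_mul_of_nonneg_left h4 (by positivity : 0 ≤ 4 * ν)
  linarith

/-- A crude bound, which may blow up as the mass tends to zero. Its square enters the final estimate
only multiplied by `κ'`. -/
theorem ae_norm_velocity_le (sol : IsHopfLerayWith ν S ρ u₀ ℓ₀ ω₀ u ℓ ω h Q G) (hν : 0 < ν)
    (hS : IsRigidBody S ρ) (hm : 0 < mass S ρ)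
    (hE : ∫ x, extDensity S ρ x * ‖initialVel S u₀ ℓ₀ ω₀ x‖ ^ 2 ≤ E) :
    ∀ᵐ t ∂(volume.restrict (Ioi (0 : ℝ))), ‖ℓ t‖ ≤ √(E / mass S ρ) := by
  filter_upwards [sol.ae_energy_le hS hE] with t ht
  refine Real.le_sqrt_of_sq_le ((le_div_iff₀ hm).2 ?_)
  have h6 : 0 ≤ ∫ x in (movedBody S (h t) (Q t))ᶜ, ‖globalVel S u ℓ ω h Q t x‖ ^ 2 :=
    integral_nonneg fun _ => sq_nonneg _
  have h7 : 0 ≤ ∫ s in Ioo 0 t, ∫ x, contract (symPart (G s x)) (symPart (G s x)) :=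
    integral_nonneg fun s => dissipation_nonneg G s
  have h8 := mul_nonneg (by positivity : 0 ≤ 4 * ν) h7
  linarith

theorem ae_memLp_gradient (sol : IsHopfLerayWith ν S ρ u₀ ℓ₀ ω₀ u ℓ ω h Q G) {T : ℝ}
    (hT : 0 < T) :
    ∀ᵐ t ∂(volume.restrict (Ioo 0 T)), ∀ i j, MemLp (fun x => G t x i j) 2 := by
  rw [ae_all_iff]
  intro i
  rw [ae_all_iff]
  intro j
  have h1 := sol.gradient_L2 T hT i j
  filter_upwards [h1.1.prodMk_left, h1.integrable_sq.prod_right_ae] with t h2 h3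
  exact (memLp_two_iff_integrable_sq h2).2 h3

/-- The position of the body, frozen for negative times, is a Lipschitz curve. -/
theorem lipschitzWith_position (sol : IsHopfLerayWith ν S ρ u₀ ℓ₀ ω₀ u ℓ ω h Q G) {K : ℝ≥0}
    (hK : ∀ᵐ t ∂(volume.restrict (Ioi (0 : ℝ))), ‖ℓ t‖ ≤ K) :
    LipschitzWith K fun t => h (max t 0) := by
  have hint : ∀ a b, 0 ≤ a → 0 ≤ b → IntervalIntegrable ℓ volume a b := fun a b ha hb => by
    rw [intervalIntegrable_iff]
    have hsub : uIoc a b ⊆ Ioi 0 := fun t ht => lt_of_le_of_lt (le_min ha hb) ht.1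
    have hfin : IsFiniteMeasure (volume.restrict (uIoc a b)) := by
      rw [uIoc]; infer_instance
    exact Integrable.of_bound (sol.ℓ_bounded.1.mono_measure (Measure.restrict_mono hsub le_rfl)) K
      (ae_restrict_of_ae_restrict_of_subset hsub hK)
  refine LipschitzWith.of_dist_le_mul fun x y => ?_
  have hx : 0 ≤ max x 0 := le_max_right _ _
  have hy : 0 ≤ max y 0 := le_max_right _ _
  rw [dist_eq_norm, sol.motion.position _ hx, sol.motion.position _ hy,
    intervalIntegral.integral_interval_sub_left (hint _ _ le_rfl hx) (hint _ _ le_rfl hy)]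
  refine (intervalIntegral.norm_integral_le_of_norm_le_const_ae (C := K) ?_).trans ?_
  · rw [ae_restrict_iff' measurableSet_Ioi] at hK
    filter_upwards [hK] with t ht hmem
    exact ht (lt_of_le_of_lt (le_min hy hx) hmem.1)
  · refine mul_le_mul_of_nonneg_left ?_ K.2
    rw [Real.dist_eq]
    exact abs_max_sub_max_le_abs x y 0

end IsHopfLerayWith

end Solution

/-! ### Momentum balance tested with the moving cutoff -/

section Momentum

variable {d : ℕ}

theorem hasFDerivAt_smul_comp_sub {Φ : Vec d → Vec d} (hΦ : ContDiff ℝ (⊤ : ℕ∞) Φ) (c : ℝ)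
    (H x : Vec d) : HasFDerivAt (fun y => c • Φ (y - H)) (c • fderiv ℝ Φ (x - H)) x := by
  have h1 := (hΦ.differentiable (by simp) (x - H)).hasFDerivAt
  have h2 : HasFDerivAt (fun y : Vec d => y - H) (ContinuousLinearMap.id ℝ (Vec d)) x :=
    (hasFDerivAt_id x).sub_const H
  have h3 := h1.comp x h2
  rw [ContinuousLinearMap.comp_id] at h3
  exact h3.const_smul c

theorem jacobian_smul_comp_sub {Φ : Vec d → Vec d} (hΦ : ContDiff ℝ (⊤ : ℕ∞) Φ) (c : ℝ)
    (H x : Vec d) : jacobian (fun y => c • Φ (y - H)) x = c • jacobian Φ (x - H) := by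
  ext i j
  simp [jacobian, (hasFDerivAt_smul_comp_sub hΦ c H x).fderiv]

theorem deriv_smul_comp_sub {Φ : Vec d → Vec d} (hΦ : ContDiff ℝ (⊤ : ℕ∞) Φ) {χ : ℝ → ℝ}
    (hχ : ContDiff ℝ (⊤ : ℕ∞) χ) {H : ℝ → Vec d} (hH : ContDiff ℝ (⊤ : ℕ∞) H) (t : ℝ) (x : Vec d) :
    deriv (fun s => χ s • Φ (x - H s)) t =
      deriv χ t • Φ (x - H t) - χ t • fderiv ℝ Φ (x - H t) (deriv H t) := by
  have h1 := (hχ.differentiable (by simp) t).hasDerivAt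
  have h2 := ((hH.differentiable (by simp) t).hasDerivAt).const_sub x
  have h3 := (hΦ.differentiable (by simp) (x - H t)).hasFDerivAt.comp_hasDerivAt t h2
  have h4 := (h1.smul h3).deriv
  have h5 : deriv (fun s => χ s • Φ (x - H s)) t = _ := h4
  rw [h5, map_neg, smul_neg]
  simp only [Function.comp_apply]
  abel

/-- On the ball that contains the body the field is constant in space, hence rigid whatever the
rotation. The centre follows `H` rather than `h` because test fields must be smooth in time. -/
theorem isTestField_moving {S : Set (Vec d)} {h : ℝ → Vec d}
    {Q : ℝ → Matrix (Fin d) (Fin d) ℝ} {Φ : Vec d → Vec d} {e : Vec d} {r κ κ' : ℝ}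
    (hΦ : IsCutoffField Φ e r κ κ') {χ : ℝ → ℝ} (hχ : ContDiff ℝ (⊤ : ℕ∞) χ)
    (hc : HasCompactSupport χ) {H : ℝ → Vec d} (hH : ContDiff ℝ (⊤ : ℕ∞) H)
    (hB : ∀ t, 0 ≤ t → movedBody S (h t) (Q t) ⊆ Metric.ball (H t) r) :
    IsTestField S h Q fun p => χ p.1 • Φ (p.2 - H p.1) where
  smooth := (hχ.comp contDiff_fst).smul
    (hΦ.smooth.comp (contDiff_snd.sub (hH.comp contDiff_fst)))
  compactSupport := by
    have hK : IsCompact ((fun p : ℝ × Vec d => (p.1, H p.1 + p.2)) '' (tsupport χ ×ˢ tsupport Φ)) :=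
      (IsCompact.prod hc hΦ.compactSupport).image
        (continuous_fst.prodMk ((hH.continuous.comp continuous_fst).add continuous_snd))
    refine HasCompactSupport.intro hK fun p hp => ?_
    by_contra hne
    refine hp ⟨(p.1, p.2 - H p.1), ⟨subset_tsupport _ fun h0 => hne ?_,
      subset_tsupport _ fun h0 => hne ?_⟩, ?_⟩
    · simp only at h0
      simp [h0]
    · simp only at h0
      simp [h0]
    · simp
  divFree t _ x := by
    simp only [jacobian_smul_comp_sub hΦ.smooth, Matrix.trace_smul, hΦ.divFree, smul_zero]
  rigid t ht x hx := by
    simp only [jacobian_smul_comp_sub hΦ.smooth,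
      hΦ.jacobian_eq_zero (mem_ball_iff_norm.1 (hB t ht hx)), smul_zero, symPart_zero]

/-- The contribution of the fluid to the momentum tested at a fixed time. -/
theorem integral_inner_cutoff_le {v : Vec d → Vec d} (hv : MemLp v 2) {B : Set (Vec d)} {E : ℝ}
    (hE : ∫ x in Bᶜ, ‖v x‖ ^ 2 ≤ E) {Φ : Vec d → Vec d} {e : Vec d} {r κ κ' : ℝ}
    (hΦ : IsCutoffField Φ e r κ κ') (hκ : 0 < κ) (H : Vec d) :
    Integrable (fun x => inner ℝ (v x) (Φ (x - H))) ∧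
    |∫ x in Bᶜ, inner ℝ (v x) (Φ (x - H))| ≤ κ * ((E + 1) / 2) := by
  have iv : Integrable fun x => ‖v x‖ ^ 2 := hv.integrable_norm_pow (by norm_num)
  have iΦ : Integrable fun x => ‖Φ (x - H)‖ ^ 2 :=
    integrable_norm_pow_comp_sub hΦ.smooth.continuous hΦ.compactSupport two_ne_zero H
  have eΦ : ∫ x, ‖Φ (x - H)‖ ^ 2 ≤ κ ^ 2 := by
    rw [integral_sub_right_eq_self (fun x => ‖Φ x‖ ^ 2) H]; exact hΦ.sq_le
  have s1 : ∫ x in Bᶜ, ‖Φ (x - H)‖ ^ 2 ≤ κ ^ 2 :=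
    (setIntegral_le_integral iΦ (ae_of_all _ fun x => by positivity)).trans eΦ
  have j1 : Integrable fun x => κ / 2 * ‖v x‖ ^ 2 + (2 * κ)⁻¹ * ‖Φ (x - H)‖ ^ 2 :=
    (iv.const_mul _).add (iΦ.const_mul _)
  have bd : ∀ x, ‖inner ℝ (v x) (Φ (x - H))‖ ≤
      κ / 2 * ‖v x‖ ^ 2 + (2 * κ)⁻¹ * ‖Φ (x - H)‖ ^ 2 := fun x => by
    refine (norm_inner_le_norm _ _).trans ?_
    have : κ / 2 * ‖v x‖ ^ 2 + (2 * κ)⁻¹ * ‖Φ (x - H)‖ ^ 2 - ‖v x‖ * ‖Φ (x - H)‖ =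
        (κ * ‖v x‖ - ‖Φ (x - H)‖) ^ 2 / (2 * κ) := by field_simp; ring
    have h2 : 0 ≤ (κ * ‖v x‖ - ‖Φ (x - H)‖) ^ 2 / (2 * κ) := by positivity
    linarith
  have hm : AEStronglyMeasurable (fun x => inner ℝ (v x) (Φ (x - H))) volume :=
    hv.1.inner (hΦ.smooth.continuous.comp
      (continuous_id.sub continuous_const)).aestronglyMeasurable
  refine ⟨j1.mono' hm (ae_of_all _ bd), ?_⟩
  rw [← Real.norm_eq_abs]
  refine (norm_integral_le_of_norm_le j1.integrableOn (ae_of_all _ bd)).trans ?_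
  rw [integral_add (iv.const_mul _).integrableOn (iΦ.const_mul _).integrableOn,
    integral_const_mul, integral_const_mul]
  calc _ ≤ κ / 2 * E + (2 * κ)⁻¹ * κ ^ 2 := by gcongr
    _ = _ := by field_simp

variable {ν : ℝ} {S : Set (Vec d)} {ρ : Vec d → ℝ}
    {u₀ : Vec d → Vec d} {ℓ₀ : Vec d} {ω₀ : AngVel d}
    {u : ℝ → Vec d → Vec d} {ℓ : ℝ → Vec d} {ω : ℝ → AngVel d}
    {h : ℝ → Vec d} {Q : ℝ → Matrix (Fin d) (Fin d) ℝ}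
    {G : ℝ → Vec d → Matrix (Fin d) (Fin d) ℝ} {E : ℝ}

/-- The fixed-time identity at time zero with `ν = 0`, `c₀ = 1` and `c₁ = 0`. It isolates the
momentum of the body, and the fluid contributes only at order `κ`. -/
theorem initial_momentum (data : IsInitialData S ρ u₀ ℓ₀ ω₀)
    (hE : ∫ x, extDensity S ρ x * ‖initialVel S u₀ ℓ₀ ω₀ x‖ ^ 2 ≤ E)
    {Φ : Vec d → Vec d} {e : Vec d} {r κ κ' : ℝ}
    (hΦ : IsCutoffField Φ e r κ κ') (hκ : 0 < κ) {H : Vec d} (hH : S ⊆ Metric.ball H r) :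
    |(∫ x, extDensity S ρ x * inner ℝ (initialVel S u₀ ℓ₀ ω₀ x) (Φ (x - H))) -
      mass S ρ * inner ℝ ℓ₀ e| ≤ κ * ((E + 1) / 2) := by
  have hv := data.finiteEnergy
  rw [initialVel_eq] at hv
  have hen := body_fluid_energy_le data.body (one_mem _) 0 ℓ₀ ω₀ u₀ hv
  rw [movedDensity_zero_one, ← initialVel_eq] at hen
  have hE' : ∫ x in (movedBody S 0 1)ᶜ, ‖initialVel S u₀ ℓ₀ ω₀ x‖ ^ 2 ≤ E := by
    have := mul_nonneg data.body.mass_nonneg (sq_nonneg ‖ℓ₀‖)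
    linarith
  obtain ⟨i1, b1⟩ := integral_inner_cutoff_le data.finiteEnergy hE' hΦ hκ H
  have hrem : ∀ x, remainder 0 Φ 1 0 (x - H) 0 (initialVel S u₀ ℓ₀ ω₀ x) 0 =
      inner ℝ (initialVel S u₀ ℓ₀ ω₀ x) (Φ (x - H)) := fun x => by simp [remainder]
  have i2 : Integrable fun x => remainder 0 Φ 1 0 (x - H) 0
      (extVel (movedBody S 0 1) (rigidVel ℓ₀ ω₀ 0) u₀ x) 0 := by
    simp only [← initialVel_eq, hrem]
    exact i1
  have key := integral_weakForm_eq data.body (ν := 0) (one_mem _) 0 ℓ₀ ω₀ u₀ (fun _ => 0) hΦ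
    (by rwa [movedBody_zero_one]) i2
  simp only [← initialVel_eq, hrem, movedDensity_zero_one] at key
  have h2 : ∀ x : Vec d, ((0 : ℝ) • fderiv ℝ Φ (x - H)) (initialVel S u₀ ℓ₀ ω₀ x) = 0 :=
    fun x => by simp
  simp only [h2, zero_smul, one_smul, sub_zero, add_zero, mul_zero, zero_mul, one_mul]
    at key
  rw [key, add_sub_cancel_left]
  exact b1

/-- The fluid part of the weak formulation is measurable in time. -/
theorem IsHopfLerayWith.aestronglyMeasurable_remainder
    (sol : IsHopfLerayWith ν S ρ u₀ ℓ₀ ω₀ u ℓ ω h Q G) (hS : IsClosed S)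
    {Φ : Vec d → Vec d} (hΦ : ContDiff ℝ (⊤ : ℕ∞) Φ) {c₀ c₁ : ℝ → ℝ} (h₀ : Continuous c₀)
    (h₁ : Continuous c₁) {H k : ℝ → Vec d} (hH : Continuous H) (hk : Continuous k)
    (hh : Continuous fun t => h (max t 0)) {T : ℝ} (hT : 0 < T) :
    AEStronglyMeasurable (fun t => ∫ x in (movedBody S (h t) (Q t))ᶜ,
      remainder ν Φ (c₀ t) (c₁ t) (x - H t) (k t) (globalVel S u ℓ ω h Q t x) (G t x))
      (volume.restrict (Ioo 0 T)) := by
  have hmax : Continuous fun t : ℝ => max t 0 := continuous_id.max continuous_const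
  have hQ : ∀ i j, Continuous fun t => Q (max t 0) i j := fun i j =>
    (sol.motion.rotation_continuous i j).comp_continuous hmax fun t => mem_Ici.2 (le_max_right _ _)
  have hact : Continuous fun p : ℝ × Vec d =>
      act (Q (max p.1 0))ᵀ (p.2 - h (max p.1 0)) := by
    refine (PiLp.continuous_toLp 2 _).comp (continuous_pi fun i => ?_)
    change Continuous fun p : ℝ × Vec d => ∑ j, Q (max p.1 0) j i * (p.2 - h (max p.1 0)) j
    refine continuous_finsetSum _ fun j _ => ?_
    refine ((hQ j i).comp continuous_fst).mul ?_
    exact (EuclideanSpace.proj j : Vec d →L[ℝ] ℝ).continuous.comp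
      (continuous_snd.sub (hh.comp continuous_fst))
  have hset : MeasurableSet {p : ℝ × Vec d | act (Q (max p.1 0))ᵀ (p.2 - h (max p.1 0)) ∈ S} :=
    (hS.preimage hact).measurableSet
  have hac : ((volume.restrict (Ioo 0 T)).prod (volume : Measure (Vec d))) ≪
      (volume.restrict (Ioi 0)).prod volume :=
    (Measure.restrict_mono Ioo_subset_Ioi_self le_rfl).absolutelyContinuous.prod
      Measure.AbsolutelyContinuous.rfl
  have hr : AEStronglyMeasurable (fun p : ℝ × Vec d => remainder ν Φ (c₀ p.1) (c₁ p.1)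
      (p.2 - H p.1) (k p.1) (globalVel S u ℓ ω h Q p.1 p.2) (G p.1 p.2))
      ((volume.restrict (Ioo 0 T)).prod volume) :=
    SmallBody.aestronglyMeasurable_remainder hΦ (h₀.comp continuous_fst).aestronglyMeasurable
      (h₁.comp continuous_fst).aestronglyMeasurable
      (continuous_snd.sub (hH.comp continuous_fst)).aestronglyMeasurable
      (hk.comp continuous_fst).aestronglyMeasurable
      (sol.measurable.mono_ac hac) fun i j => (sol.gradient_L2 T hT i j).1
  refine ((hr.indicator hset.compl).integral_prod_right').congr ?_
  filter_upwards [ae_restrict_mem measurableSet_Ioo] with t ht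
  have hB := (isClosed_movedBody hS (h t) (Q t)).measurableSet
  rw [← integral_indicator hB.compl]
  refine integral_congr_ae (ae_of_all _ fun x => ?_)
  have hiff : (t, x) ∈ {p : ℝ × Vec d | act (Q (max p.1 0))ᵀ (p.2 - h (max p.1 0)) ∈ S} ↔
      x ∈ movedBody S (h t) (Q t) := by
    change act (Q (max t 0))ᵀ (x - h (max t 0)) ∈ S ↔ _
    rw [max_eq_left ht.1.le]
    exact Iff.rfl
  beta_reduce
  by_cases hx : x ∈ movedBody S (h t) (Q t)
  · have hc1 := notMem_compl_iff.2 (hiff.2 hx)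
    have hc2 := notMem_compl_iff.2 hx
    rw [indicator_of_notMem hc1, indicator_of_notMem hc2]
  · have hc1 := mem_compl (mt hiff.1 hx)
    have hc2 := mem_compl hx
    rw [indicator_of_mem hc1, indicator_of_mem hc2]

/-- The core estimate. The term `κ (E + 1)` has one half from the initial fluid momentum and one
half from the time derivative of `χ`, since `g` has integral one. The factor `T` multiplies the
bounds uniform in time, and `E / (4 ν)` bounds the total dissipation. No norm of `g` beyond its
integral appears, so `g` may concentrate at a point. -/
theorem IsHopfLerayWith.momentum_estimate (hd : d = 2 ∨ d = 3)
    (sol : IsHopfLerayWith ν S ρ u₀ ℓ₀ ω₀ u ℓ ω h Q G) (hν : 0 < ν)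
    (data : IsInitialData S ρ u₀ ℓ₀ ω₀) {ε : ℝ} (hε : 0 < ε) (hS : S ⊆ Metric.ball 0 ε)
    (hm : 0 < mass S ρ)
    (hE : ∫ x, extDensity S ρ x * ‖initialVel S u₀ ℓ₀ ω₀ x‖ ^ 2 ≤ E) (hE0 : 0 ≤ E)
    {Φ : Vec d → Vec d} {e : Vec d} {κ κ' : ℝ}
    (hΦ : IsCutoffField Φ e (2 * ε) κ κ') (hκ : 0 < κ) {T : ℝ} (hT : 0 < T) {g : ℝ → ℝ}
    (hg : ContDiff ℝ (⊤ : ℕ∞) g) (g0 : ∀ t, 0 ≤ g t) (gs : ∀ t, t ∉ Ioo 0 T → g t = 0)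
    (g1 : ∫ t, g t = 1) :
    mass S ρ * |(∫ t in Ioo 0 T, g t * inner ℝ (ℓ t) e) - inner ℝ ℓ₀ e| ≤
      κ * (E + 1) + T * (κ * (128 * E + 9 * ν) + E / mass S ρ * κ') +
        κ * (32 + ν) * (E / (4 * ν)) := by
  obtain ⟨χ, χs, χc, χ0, χ1, χd, χT⟩ := exists_time_cutoff hg g0 hT gs g1
  set K : ℝ≥0 := Real.toNNReal √(E / mass S ρ) with hKdef
  have hKc : (K : ℝ) = √(E / mass S ρ) := Real.coe_toNNReal _ (Real.sqrt_nonneg _)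
  have hK2 : (K : ℝ) ^ 2 = E / mass S ρ := by
    rw [hKc, Real.sq_sqrt (by positivity)]
  have hK : ∀ᵐ t ∂(volume.restrict (Ioi (0 : ℝ))), ‖ℓ t‖ ≤ K := by
    rw [hKc]; exact sol.ae_norm_velocity_le hν data.body hm hE
  have hlip := sol.lipschitzWith_position hK
  -- Accuracy `ε` keeps the body, of radius `ε` about `h`, inside the ball of radius `2ε` about `H`.
  obtain ⟨H, Hs, Hc, Hd⟩ := exists_contDiff_approx hlip hε
  have hball : ∀ t, 0 ≤ t → movedBody S (h t) (Q t) ⊆ Metric.ball (H t) (2 * ε) := fun t ht => by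
    refine (movedBody_subset_ball hS (sol.motion.rotation t ht) (h t)).trans
      (Metric.ball_subset_ball' ?_)
    have := Hc t
    simp only [max_eq_left ht, dist_comm] at this
    linarith
  have hh0 : h 0 = 0 := by rw [sol.motion.position 0 le_rfl]; simp
  have hball0 : S ⊆ Metric.ball (H 0) (2 * ε) := by
    refine hS.trans (Metric.ball_subset_ball' ?_)
    have := Hc 0
    rw [dist_comm] at this
    simp only [max_self, hh0] at this
    linarith
  have wf := sol.weakForm _ (isTestField_moving hΦ χs χc Hs hball)
  have in0 := initial_momentum data hE hΦ hκ hball0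
  set R : ℝ → ℝ := fun t => ∫ x in (movedBody S (h t) (Q t))ᶜ,
      remainder ν Φ (-g t) (χ t) (x - H t) (deriv H t) (globalVel S u ℓ ω h Q t x) (G t x)
    with hR
  set D : ℝ → ℝ := fun t => ∫ x, contract (symPart (G t x)) (symPart (G t x)) with hD
  have Dint : IntegrableOn D (Ioo 0 T) := sol.integrableOn_dissipation hT
  have Dle : 4 * ν * ∫ t in Ioo 0 T, D t ≤ E := sol.dissipation_le hν data.body hE hT
  have hsub : Ioo (0 : ℝ) T ⊆ Ioi 0 := Ioo_subset_Ioi_self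
  -- At almost every time, the identity and the bound of the fixed-time analysis with `c₀ = -g t`
  -- and `c₁ = χ t`.
  have good : ∀ᵐ t ∂(volume.restrict (Ioo 0 T)),
      (∫ x, (movedDensity S ρ (h t) (Q t) x *
            inner ℝ (globalVel S u ℓ ω h Q t x)
              (deriv (fun s => χ s • Φ (x - H s)) t +
                fderiv ℝ (fun y => χ t • Φ (y - H t)) x (globalVel S u ℓ ω h Q t x))
          - 2 * ν * contract (symPart (G t x))
            (symPart (jacobian (fun y => χ t • Φ (y - H t)) x)))) =
        -(mass S ρ * (g t * inner ℝ (ℓ t) e)) + R t ∧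
      |R t| ≤ g t * (κ * ((E + 1) / 2)) + (κ * (128 * E + 9 * ν) + E / mass S ρ * κ') +
        κ * (32 + ν) * D t := by
    filter_upwards [ae_restrict_of_ae_restrict_of_subset hsub sol.ae_memLp,
      ae_restrict_of_ae_restrict_of_subset hsub (sol.ae_energy_le data.body hE),
      ae_restrict_of_ae_restrict_of_subset hsub sol.gradient,
      ae_restrict_of_ae_restrict_of_subset hsub sol.divFree,
      ae_restrict_of_ae_restrict_of_subset hsub sol.rigid,
      sol.ae_memLp_gradient hT, ae_restrict_mem measurableSet_Ioo] with t t1 t2 t3 t4 t5 t6 t7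
    have hflu : ∫ x in (movedBody S (h t) (Q t))ᶜ, ‖globalVel S u ℓ ω h Q t x‖ ^ 2 ≤ E := by
      have h5 : 0 ≤ mass S ρ * ‖ℓ t‖ ^ 2 := by positivity
      have h7 : 0 ≤ ∫ s in Ioo 0 t, ∫ x, contract (symPart (G s x)) (symPart (G s x)) :=
        integral_nonneg fun s => IsHopfLerayWith.dissipation_nonneg G s
      have h8 := mul_nonneg (by positivity : 0 ≤ 4 * ν) h7
      linarith
    obtain ⟨ri, rb⟩ := integral_remainder_le hd hν t1 t6 t3 t4
      (isClosed_movedBody data.body.isClosed (h t) (Q t)).measurableSet t5 hflu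
      (by positivity : 0 < 2 * ε) hΦ hκ (c₀ := -g t) (χ1 t t7.1) (Hd t) (H t)
    constructor
    · have := integral_weakForm_eq data.body (sol.motion.rotation t t7.1.le) (h t) (ℓ t) (ω t)
        (u t) (G t) hΦ (hball t t7.1.le) ri
      simp only [deriv_smul_comp_sub hΦ.smooth χs Hs, χd t t7.1,
        (hasFDerivAt_smul_comp_sub hΦ.smooth _ _ _).fderiv, jacobian_smul_comp_sub hΦ.smooth]
      refine this.trans ?_
      simp only [hR]
      congr 1
      ring
    · rw [abs_neg, abs_of_nonneg (g0 t), hK2] at rb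
      exact rb
  have Rm : AEStronglyMeasurable R (volume.restrict (Ioo 0 T)) :=
    sol.aestronglyMeasurable_remainder data.body.isClosed hΦ.smooth hg.continuous.neg
      χs.continuous Hs.continuous (Hs.continuous_deriv (by simp)) hlip.continuous hT
  have gi : Integrable g := by
    by_contra hn
    rw [integral_undef hn] at g1
    exact zero_ne_one g1
  have b1 : IntegrableOn (fun t => g t * (κ * ((E + 1) / 2))) (Ioo 0 T) :=
    (gi.mul_const _).integrableOn
  have b2 : IntegrableOn (fun _ : ℝ => κ * (128 * E + 9 * ν) + E / mass S ρ * κ') (Ioo 0 T) :=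
    integrableOn_const measure_Ioo_lt_top.ne
  have b3 : IntegrableOn (fun t => κ * (32 + ν) * D t) (Ioo 0 T) := Dint.const_mul _
  have b12 : IntegrableOn (fun t => g t * (κ * ((E + 1) / 2)) +
      (κ * (128 * E + 9 * ν) + E / mass S ρ * κ')) (Ioo 0 T) := b1.add b2
  have b123 : IntegrableOn (fun t => g t * (κ * ((E + 1) / 2)) +
      (κ * (128 * E + 9 * ν) + E / mass S ρ * κ') + κ * (32 + ν) * D t) (Ioo 0 T) := b12.add b3
  have Rb : ∀ᵐ t ∂(volume.restrict (Ioo 0 T)), ‖R t‖ ≤ g t * (κ * ((E + 1) / 2)) +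
      (κ * (128 * E + 9 * ν) + E / mass S ρ * κ') + κ * (32 + ν) * D t := by
    filter_upwards [good] with t ht using ht.2
  have Ri : IntegrableOn R (Ioo 0 T) := b123.mono' Rm Rb
  have Rle : |∫ t in Ioo 0 T, R t| ≤ κ * ((E + 1) / 2) +
      T * (κ * (128 * E + 9 * ν) + E / mass S ρ * κ') + κ * (32 + ν) * (E / (4 * ν)) := by
    rw [← Real.norm_eq_abs]
    refine (norm_integral_le_of_norm_le b123 Rb).trans ?_
    rw [integral_add b12 b3, integral_add b1 b2, integral_mul_const, integral_const_mul,
      setIntegral_const, setIntegral_eq_integral_of_forall_compl_eq_zero gs, g1, one_mul]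
    have h1 : ∫ t in Ioo 0 T, D t ≤ E / (4 * ν) := by
      rw [le_div_iff₀ (by positivity)]; linarith
    have h2 : volume.real (Ioo 0 T) = T := by simp [measureReal_def, hT.le]
    rw [h2, smul_eq_mul]
    have h3 : 0 ≤ κ * (32 + ν) := by positivity
    have h4 := mul_le_mul_of_nonneg_left h1 h3
    linarith
  have ℓi : IntegrableOn (fun t => mass S ρ * (g t * inner ℝ (ℓ t) e)) (Ioo 0 T) := by
    refine Integrable.const_mul ?_ _
    refine gi.integrableOn.mul_bdd (c := K * ‖e‖) ?_ ?_
    · exact (sol.ℓ_bounded.1.mono_measure (Measure.restrict_mono hsub le_rfl)).inner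
        aestronglyMeasurable_const
    · filter_upwards [ae_restrict_of_ae_restrict_of_subset hsub hK] with t ht
      exact (norm_inner_le_norm _ _).trans (mul_le_mul_of_nonneg_right ht (norm_nonneg _))
  have ℓi' : IntegrableOn (fun t => -(mass S ρ * (g t * inner ℝ (ℓ t) e))) (Ioo 0 T) := ℓi.neg
  -- From time `T` on both `χ` and its derivative vanish, so the time integral is over `(0, T)`.
  have restr : ∀ t ∈ Ioi (0 : ℝ) \ Ioo 0 T, (∫ x, (movedDensity S ρ (h t) (Q t) x *
            inner ℝ (globalVel S u ℓ ω h Q t x)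
              (deriv (fun s => χ s • Φ (x - H s)) t +
                fderiv ℝ (fun y => χ t • Φ (y - H t)) x (globalVel S u ℓ ω h Q t x))
          - 2 * ν * contract (symPart (G t x))
            (symPart (jacobian (fun y => χ t • Φ (y - H t)) x)))) = 0 := by
    intro t ht
    have ht0 : 0 < t := ht.1
    have htT : T ≤ t := by
      by_contra hlt
      exact ht.2 ⟨ht0, not_le.1 hlt⟩
    refine integral_eq_zero_of_ae (ae_of_all _ fun x => ?_)
    have hj : ∀ x : Vec d, jacobian (fun _ : Vec d => (0 : Vec d)) x = 0 := fun x => by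
      ext i j; simp [jacobian]
    simp only [hj, deriv_smul_comp_sub hΦ.smooth χs Hs, χd t ht0, gs t ht.2, χT t htT, zero_smul,
      neg_zero, sub_zero, fderiv_fun_const, symPart_zero,
      contract_zero_right, Pi.zero_apply, zero_apply, add_zero, inner_zero_right, mul_zero]
  dsimp only at wf
  rw [setIntegral_eq_of_subset_of_forall_sdiff_eq_zero measurableSet_Ioi hsub restr,
    integral_congr_ae (good.mono fun t ht => ht.1), integral_add ℓi' Ri, integral_neg,
    integral_const_mul] at wf
  simp only [χ0, one_smul] at wf
  rw [← wf] at in0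
  set I := ∫ t in Ioo 0 T, g t * inner ℝ (ℓ t) e
  rw [← abs_of_pos hm, ← abs_mul, abs_of_pos hm]
  have e1 : mass S ρ * (I - inner ℝ ℓ₀ e) =
      (-(-(mass S ρ * I) + ∫ t in Ioo 0 T, R t) - mass S ρ * inner ℝ ℓ₀ e) +
        ∫ t in Ioo 0 T, R t := by ring
  rw [e1]
  refine (abs_add_le _ _).trans ((add_le_add in0 Rle).trans (le_of_eq ?_))
  ring

end Momentum

/-! ### From averages in time to almost every time -/

/-- A bound on all smooth averages of a function is a bound on its values. -/
theorem ae_le_of_forall_average_le {f : ℝ → ℝ} {T : ℝ} (hf : IntegrableOn f (Ioo 0 T))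
    {a m b : ℝ}
    (H : ∀ g : ℝ → ℝ, ContDiff ℝ (⊤ : ℕ∞) g → (∀ t, 0 ≤ g t) → (∀ t, t ∉ Ioo 0 T → g t = 0) →
      ∫ t, g t = 1 → m * |(∫ t in Ioo 0 T, g t * f t) - a| ≤ b) :
    ∀ᵐ t ∂(volume.restrict (Ioo 0 T)), m * |f t - a| ≤ b := by
  -- The two radii keep a bounded ratio, as Lebesgue differentiation along bumps requires.
  let φ : ℕ → ContDiffBump (0 : ℝ) := fun n =>
    ⟨1 / (n + 1 : ℝ) / 2, 1 / (n + 1 : ℝ), by positivity, half_lt_self (by positivity)⟩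
  have hφ : Tendsto (fun n => (φ n).rOut) atTop (𝓝 0) := tendsto_one_div_add_atTop_nhds_zero_nat
  have hK : ∀ᶠ n in atTop, (φ n).rOut ≤ 2 * (φ n).rIn := Eventually.of_forall fun n => by
    change 1 / (n + 1 : ℝ) ≤ 2 * (1 / (n + 1 : ℝ) / 2)
    linarith
  have hloc : LocallyIntegrable ((Ioo 0 T).indicator f) volume :=
    ((integrable_indicator_iff measurableSet_Ioo).2 hf).locallyIntegrable
  have hlim := ContDiffBump.ae_convolution_tendsto_right_of_locallyIntegrable hφ hK hloc
  filter_upwards [ae_restrict_of_ae hlim, ae_restrict_mem measurableSet_Ioo] with t ht htm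
  rw [indicator_of_mem htm] at ht
  refine le_of_tendsto (((ht.sub_const a).abs).const_mul m) ?_
  -- For large `n` the bump centred at `t` is supported in `(0, T)`, hence is an admissible density.
  obtain ⟨δ, hδ, hball⟩ := Metric.isOpen_iff.1 isOpen_Ioo t htm
  filter_upwards [hφ.eventually_lt_const hδ] with n hn
  have key := H (fun s => (φ n).normed volume (t - s))
    ((φ n).contDiff_normed.comp (contDiff_const.sub contDiff_id))
    (fun s => (φ n).nonneg_normed _) (fun s hs => ?_) ?_
  · rw [convolution_eq_swap]
    simp only [ContinuousLinearMap.lsmul_apply, smul_eq_mul]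
    have : ∫ s, (φ n).normed volume (t - s) * (Ioo 0 T).indicator f s =
        ∫ s in Ioo 0 T, (φ n).normed volume (t - s) * f s := by
      rw [← integral_indicator measurableSet_Ioo]
      refine integral_congr_ae (ae_of_all _ fun s => ?_)
      by_cases hs : s ∈ Ioo 0 T <;> simp [hs]
    rwa [this]
  · by_contra hne
    have h1 : t - s ∈ Function.support ((φ n).normed volume) := hne
    rw [(φ n).support_normed_eq, mem_ball_zero_iff] at h1
    refine hs (hball ?_)
    rw [Metric.mem_ball, dist_comm, dist_eq_norm]
    exact h1.trans hn
  · rw [integral_sub_left_eq_self ((φ n).normed volume) volume t]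
    exact (φ n).integral_normed

/-! ### Distance of the body velocity from its initial value -/

section Limit

variable {d : ℕ} {ν : ℝ} {S : Set (Vec d)} {ρ : Vec d → ℝ}
    {u₀ : Vec d → Vec d} {ℓ₀ : Vec d} {ω₀ : AngVel d}
    {u : ℝ → Vec d → Vec d} {ℓ : ℝ → Vec d} {ω : ℝ → AngVel d}
    {h : ℝ → Vec d} {Q : ℝ → Matrix (Fin d) (Fin d) ℝ}
    {G : ℝ → Vec d → Matrix (Fin d) (Fin d) ℝ} {E : ℝ}

theorem IsHopfLerayWith.ae_momentum_le (hd : d = 2 ∨ d = 3)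
    (sol : IsHopfLerayWith ν S ρ u₀ ℓ₀ ω₀ u ℓ ω h Q G) (hν : 0 < ν)
    (data : IsInitialData S ρ u₀ ℓ₀ ω₀) {ε : ℝ} (hε : 0 < ε) (hS : S ⊆ Metric.ball 0 ε)
    (hm : 0 < mass S ρ)
    (hE : ∫ x, extDensity S ρ x * ‖initialVel S u₀ ℓ₀ ω₀ x‖ ^ 2 ≤ E) (hE0 : 0 ≤ E)
    {Φ : Vec d → Vec d} {e : Vec d} {κ κ' : ℝ}
    (hΦ : IsCutoffField Φ e (2 * ε) κ κ') (hκ : 0 < κ) {T : ℝ} (hT : 0 < T) :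
    ∀ᵐ t ∂(volume.restrict (Ioo 0 T)), mass S ρ * |inner ℝ (ℓ t) e - inner ℝ ℓ₀ e| ≤
      κ * (E + 1) + T * (κ * (128 * E + 9 * ν) + E / mass S ρ * κ') +
        κ * (32 + ν) * (E / (4 * ν)) := by
  refine ae_le_of_forall_average_le ?_ fun g hg g0 gs g1 =>
    sol.momentum_estimate hd hν data hε hS hm hE hE0 hΦ hκ hT hg g0 gs g1
  have h1 : MemLp ℓ ∞ (volume.restrict (Ioo 0 T)) :=
    sol.ℓ_bounded.mono_measure (Measure.restrict_mono Ioo_subset_Ioi_self le_rfl)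
  have h2 : Integrable ℓ (volume.restrict (Ioo 0 T)) := h1.integrable le_top
  exact h2.inner_const e

/-- If the cutoff constants in all coordinate directions are small compared with the mass, then the
velocity of the body stays close to its initial value. -/
theorem IsHopfLerayWith.ae_norm_sub_le (hd : d = 2 ∨ d = 3)
    (sol : IsHopfLerayWith ν S ρ u₀ ℓ₀ ω₀ u ℓ ω h Q G) (hν : 0 < ν)
    (data : IsInitialData S ρ u₀ ℓ₀ ω₀) {ε : ℝ} (hε : 0 < ε) (hS : S ⊆ Metric.ball 0 ε)
    (hm : 0 < mass S ρ)
    (hE : ∫ x, extDensity S ρ x * ‖initialVel S u₀ ℓ₀ ω₀ x‖ ^ 2 ≤ E) (hE0 : 0 ≤ E)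
    {η : ℝ} (hΦ : ∀ j : Fin d, ∃ (Φ : Vec d → Vec d) (κ κ' : ℝ),
      IsCutoffField Φ (EuclideanSpace.single j 1) (2 * ε) κ κ' ∧ 0 < κ ∧
        κ / mass S ρ ≤ η ∧ κ' / mass S ρ ^ 2 ≤ η) {T : ℝ} (hT : 0 < T) :
    ∀ᵐ t ∂(volume.restrict (Ioo 0 T)), ‖ℓ t - ℓ₀‖ ≤
      d * (η * (E + 1 + T * (128 * E + 9 * ν) + (32 + ν) * (E / (4 * ν)) + T * E)) := by
  have key : ∀ j, ∀ᵐ t ∂(volume.restrict (Ioo 0 T)), |(ℓ t - ℓ₀) j| ≤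
      η * (E + 1 + T * (128 * E + 9 * ν) + (32 + ν) * (E / (4 * ν)) + T * E) := fun j => by
    obtain ⟨Φ, κ, κ', hΦ, hκ, h1, h2⟩ := hΦ j
    filter_upwards [sol.ae_momentum_le hd hν data hε hS hm hE hE0 hΦ hκ hT] with t ht
    have e1 : (ℓ t - ℓ₀) j =
        inner ℝ (ℓ t) (EuclideanSpace.single j 1) - inner ℝ ℓ₀ (EuclideanSpace.single j 1) := by
      simp [EuclideanSpace.inner_single_right]
    -- Factor out the mass. The squared velocity bound already carries `1/m`, which is why `κ'` is
    -- compared with `m²`.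
    have e2 : κ * (E + 1) + T * (κ * (128 * E + 9 * ν) + E / mass S ρ * κ') +
        κ * (32 + ν) * (E / (4 * ν)) = mass S ρ *
          (κ / mass S ρ * (E + 1 + T * (128 * E + 9 * ν) + (32 + ν) * (E / (4 * ν))) +
            κ' / mass S ρ ^ 2 * (T * E)) := by
      field_simp
      ring
    rw [e2] at ht
    rw [e1]
    have h3 := mul_le_mul_of_nonneg_right h1
      (by positivity : 0 ≤ E + 1 + T * (128 * E + 9 * ν) + (32 + ν) * (E / (4 * ν)))
    have h4 := mul_le_mul_of_nonneg_right h2 (by positivity : 0 ≤ T * E)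
    linarith [le_of_mul_le_mul_left ht hm]
  filter_upwards [ae_all_iff.2 key] with t ht
  have h1 : ‖ℓ t - ℓ₀‖ ≤ ∑ j, |(ℓ t - ℓ₀) j| := by
    have h2 : ℓ t - ℓ₀ = ∑ j, EuclideanSpace.single j ((ℓ t - ℓ₀) j) := by
      ext k
      simp [Finset.sum_apply, Pi.single_apply]
    conv_lhs => rw [h2]
    refine (norm_sum_le _ _).trans (le_of_eq ?_)
    simp
  refine h1.trans ((Finset.sum_le_card_nsmul _ _ _ fun j _ => ht j).trans (le_of_eq ?_))
  simp

/-- The initial energy is controlled by the energy of the body and the `L²` norm of the velocity. -/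
theorem IsInitialData.initial_energy_le (hd : d = 2 ∨ d = 3) (data : IsInitialData S ρ u₀ ℓ₀ ω₀)
    {A : ℝ≥0} (hA : eLpNorm (initialVel S u₀ ℓ₀ ω₀) 2 volume ≤ A) :
    ∫ x, extDensity S ρ x * ‖initialVel S u₀ ℓ₀ ω₀ x‖ ^ 2 ≤
      mass S ρ * ‖ℓ₀‖ ^ 2 + (inertia d S ρ *ᵥ WithLp.ofLp ω₀) ⬝ᵥ WithLp.ofLp ω₀ + A ^ 2 := by
  rw [initial_energy_eq hd data]
  have hi : Integrable fun x => ‖initialVel S u₀ ℓ₀ ω₀ x‖ ^ 2 :=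
    data.finiteEnergy.integrable_norm_pow (by norm_num)
  have h1 : ∫ x in Sᶜ, ‖initialVel S u₀ ℓ₀ ω₀ x‖ ^ 2 ≤ ∫ x, ‖initialVel S u₀ ℓ₀ ω₀ x‖ ^ 2 :=
    setIntegral_le_integral hi (ae_of_all _ fun x => by positivity)
  have h2 : ∫ x, ‖initialVel S u₀ ℓ₀ ω₀ x‖ ^ 2 ≤ (A : ℝ) ^ 2 := by
    have h3 := data.finiteEnergy.eLpNorm_eq_integral_rpow_norm (by norm_num) (by norm_num)
    rw [h3] at hA
    have h4 := ENNReal.toReal_mono ENNReal.coe_ne_top hA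
    rw [ENNReal.toReal_ofReal (by positivity)] at h4
    simp only [ENNReal.toReal_ofNat, Real.rpow_ofNat, ENNReal.coe_toReal] at h4
    rw [← one_div, ← Real.sqrt_eq_rpow, Real.sqrt_le_left A.coe_nonneg] at h4
    exact h4
  linarith

end Limit

/-! ### Cutoff constants compared with the mass -/

section Smallness

variable {ι : Type*} {l : Filter ι} {ε m : ι → ℝ}

/-- Both constants can be taken below `min (η c) (η c²)` once `ε` is small, so a lower bound on the
mass is enough. -/
theorem eventually_exists_cutoff_two (hε : ∀ i, 0 < ε i) (hε0 : Tendsto ε l (𝓝 0)) {c : ℝ}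
    (hc : 0 < c) (hm : ∀ i, c ≤ m i) (e : Vec 2) {η : ℝ} (hη : 0 < η) :
    ∀ᶠ i in l, ∃ (Φ : Vec 2 → Vec 2) (κ κ' : ℝ), IsCutoffField Φ e (2 * ε i) κ κ' ∧ 0 < κ ∧
      κ / m i ≤ η ∧ κ' / m i ^ 2 ≤ η := by
  have h2 : Tendsto (fun i => 2 * ε i) l (𝓝[>] 0) := by
    refine tendsto_nhdsWithin_iff.2 ⟨by simpa using hε0.const_mul 2, ?_⟩
    exact Eventually.of_forall fun i => mul_pos two_pos (hε i)
  have hμ : 0 < min (η * c) (η * c ^ 2) := lt_min (by positivity) (by positivity)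
  filter_upwards [h2.eventually (exists_isCutoffField_two e hμ)] with i ⟨Φ, hΦ⟩
  have hi : 0 < m i := hc.trans_le (hm i)
  refine ⟨Φ, _, _, hΦ, hμ, ?_, ?_⟩
  · rw [div_le_iff₀ hi]
    exact (min_le_left _ _).trans (mul_le_mul_of_nonneg_left (hm i) hη.le)
  · rw [div_le_iff₀ (by positivity)]
    exact (min_le_right _ _).trans
      (mul_le_mul_of_nonneg_left (pow_le_pow_left₀ hc.le (hm i) 2) hη.le)

/-- Here `κ` is of order `√ε`, so `κ/m` is small because `m/√ε` is large. As `κ'` is of order `ε²`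
and `m² ≥ ε` eventually, `κ'/m²` is of order `ε`. -/
theorem eventually_exists_cutoff_three (hε : ∀ i, 0 < ε i) (hε0 : Tendsto ε l (𝓝 0))
    (hm : Tendsto (fun i => m i / √(ε i)) l atTop) (e : Vec 3) {η : ℝ} (hη : 0 < η) :
    ∀ᶠ i in l, ∃ (Φ : Vec 3 → Vec 3) (κ κ' : ℝ), IsCutoffField Φ e (2 * ε i) κ κ' ∧ 0 < κ ∧
      κ / m i ≤ η ∧ κ' / m i ^ 2 ≤ η := by
  obtain ⟨C, hC, hΦ⟩ := exists_isCutoffField_three e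
  filter_upwards [hm.eventually_ge_atTop 1, hm.eventually_ge_atTop (C * √2 / η),
    hε0.eventually_le_const (by norm_num : (0 : ℝ) < 1 / 2),
    hε0.eventually_le_const (by positivity : 0 < η / (4 * C))] with i h1 h2 h3 h4
  have hs : 0 < √(ε i) := Real.sqrt_pos.2 (hε i)
  rw [le_div_iff₀ hs] at h1 h2
  have hi : 0 < m i := by linarith
  obtain ⟨Φ, hΦ⟩ := hΦ (2 * ε i) (by linarith [hε i]) (by linarith)
  have h5 : √(2 * ε i) = √2 * √(ε i) := Real.sqrt_mul two_pos.le _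
  refine ⟨Φ, _, _, hΦ, by rw [h5]; positivity, ?_, ?_⟩
  · rw [div_le_iff₀ hi, h5]
    have := mul_le_mul_of_nonneg_left h2 hη.le
    calc C * (√2 * √(ε i)) = η * (C * √2 / η * √(ε i)) := by field_simp
      _ ≤ _ := this
  · rw [div_le_iff₀ (by positivity)]
    have h6 : ε i ≤ m i ^ 2 := by
      have := pow_le_pow_left₀ (by positivity) h1 2
      rwa [one_mul, Real.sq_sqrt (hε i).le] at this
    rw [le_div_iff₀ (by positivity)] at h4
    calc C * (2 * ε i) ^ 2 = ε i * (4 * C) * ε i := by ring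
      _ ≤ η * m i ^ 2 := mul_le_mul h4 h6 (hε i).le hη.le

end Smallness

end SmallBody

end

/-! ### The convergence theorem -/

open SmallBody

theorem theorem1p3 {d : ℕ} (hd : d = 2 ∨ d = 3) {ν : ℝ} (hν : 0 < ν)
    {ι : Type*} {l : Filter ι} {ε : ι → ℝ} (hε : ∀ i, 0 < ε i) (hε0 : Tendsto ε l (𝓝 0))
    {S : ι → Set (Vec d)} {ρ : ι → Vec d → ℝ}
    {u₀ : ι → Vec d → Vec d} {ℓ₀ : ι → Vec d} {ω₀ : ι → AngVel d}
    {u : ι → ℝ → Vec d → Vec d} {ℓ : ι → ℝ → Vec d} {ω : ι → ℝ → AngVel d}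
    (hdata : ∀ i, IsInitialData (S i) (ρ i) (u₀ i) (ℓ₀ i) (ω₀ i))
    (hsol : ∀ i, IsHopfLeraySolution ν (S i) (ρ i) (u₀ i) (ℓ₀ i) (ω₀ i) (u i) (ℓ i) (ω i))
    -- the assumptions of the vanishing-body theorem
    (hsmall : ∀ i, S i ⊆ Metric.ball 0 (ε i))
    (hmass : Tendsto (fun i => mass (S i) (ρ i) / ε i ^ d) l atTop)
    {uin : Vec d → Vec d} (huin : MemLp uin 2)
    (hconv : Tendsto
      (fun i => eLpNorm (fun x => initialVel (S i) (u₀ i) (ℓ₀ i) (ω₀ i) x - uin x) 2 volume) l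
      (𝓝 0))
    {E : ℝ}
    (henergy : Tendsto
      (fun i => mass (S i) (ρ i) * ‖ℓ₀ i‖ ^ 2 +
        (inertia d (S i) (ρ i) *ᵥ WithLp.ofLp (ω₀ i)) ⬝ᵥ WithLp.ofLp (ω₀ i)) l (𝓝 (2 * E)))
    -- the additional assumptions
    (hmass3 : d = 3 → Tendsto (fun i => mass (S i) (ρ i) / Real.sqrt (ε i)) l atTop)
    (hmass2 : d = 2 → ∃ C : ℝ, 0 < C ∧ ∀ i, C ≤ mass (S i) (ρ i))
    {ℓin : Vec d} (hℓ : Tendsto ℓ₀ l (𝓝 ℓin)) :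
    ∀ T : ℝ, 0 < T →
      Tendsto (fun i => eLpNorm (fun t => ℓ i t - ℓin) ∞ (volume.restrict (Ioo 0 T))) l
        (𝓝 0) := by
  intro T hT
  have hcut : ∀ η : ℝ, 0 < η → ∀ᶠ i in l, 0 < mass (S i) (ρ i) ∧
      ∀ j : Fin d, ∃ (Φ : Vec d → Vec d) (κ κ' : ℝ),
        IsCutoffField Φ (EuclideanSpace.single j 1) (2 * ε i) κ κ' ∧ 0 < κ ∧
          κ / mass (S i) (ρ i) ≤ η ∧ κ' / mass (S i) (ρ i) ^ 2 ≤ η := fun η hη => by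
    refine Eventually.and ?_ (eventually_all.2 fun j => ?_)
    · filter_upwards [hmass.eventually_gt_atTop 0] with i hi
      exact (div_pos_iff_of_pos_right (pow_pos (hε i) d)).1 hi
    · rcases hd with rfl | rfl
      · obtain ⟨C, hC, hm⟩ := hmass2 rfl
        exact eventually_exists_cutoff_two hε hε0 hC hm _ hη
      · exact eventually_exists_cutoff_three hε hε0 (hmass3 rfl) _ hη
  -- Eventual bound for the `L²` norms of the initial velocities. With the limit of the body
  -- energies it bounds the initial energies uniformly by `F`; the maximum with `0` only secures `F
  -- ≥ 0`.
  obtain ⟨A, hA⟩ : ∃ A : ℝ≥0, eLpNorm uin 2 volume + 1 = A :=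
    ⟨_, (ENNReal.coe_toNNReal (ENNReal.add_ne_top.2 ⟨huin.2.ne, ENNReal.one_ne_top⟩)).symm⟩
  set F : ℝ := max (2 * E + 1 + A ^ 2) 0 with hF
  have hF0 : 0 ≤ F := le_max_right _ _
  have hen : ∀ᶠ i in l, ∫ x, extDensity (S i) (ρ i) x *
      ‖initialVel (S i) (u₀ i) (ℓ₀ i) (ω₀ i) x‖ ^ 2 ≤ F := by
    filter_upwards [henergy.eventually_le_const (lt_add_one (2 * E)),
      hconv.eventually_le_const one_pos] with i h1 h2
    refine ((hdata i).initial_energy_le hd (A := A) ?_).trans (le_max_of_le_left (by linarith))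
    rw [← hA, add_comm]
    have h3 := (hdata i).finiteEnergy
    have h4 := eLpNorm_add_le (h3.1.sub huin.1) huin.1 (p := 2) one_le_two
    rw [sub_add_cancel] at h4
    exact h4.trans (add_le_add_left h2 _)
  rw [ENNReal.tendsto_nhds_zero]
  intro δ hδ
  rcases eq_or_ne δ ⊤ with rfl | hδt
  · exact Eventually.of_forall fun _ => le_top
  have hδ' : 0 < δ.toReal := ENNReal.toReal_pos hδ.ne' hδt
  set B : ℝ := d * (F + 1 + T * (128 * F + 9 * ν) + (32 + ν) * (F / (4 * ν)) + T * F) with hB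
  have hB0 : 0 ≤ B := by positivity
  -- With this `η` the estimate gives `η B ≤ δ/2`; the other half of `δ` pays for the distance from
  -- `ℓ₀ i` to `ℓin`.
  have hη : 0 < δ.toReal / 2 / (B + 1) := by positivity
  filter_upwards [hcut _ hη, hen, (Metric.tendsto_nhds.1 hℓ) _ (half_pos hδ')]
    with i ⟨hm, hΦ⟩ hE hi
  obtain ⟨h, Q, G, sol⟩ := hsol i
  rw [dist_eq_norm] at hi
  have hae := sol.ae_norm_sub_le hd hν (hdata i) (hε i) (hsmall i) hm hE hF0 hΦ hT
  have hle : ∀ᵐ t ∂(volume.restrict (Ioo 0 T)), ‖ℓ i t - ℓin‖ ≤ δ.toReal := by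
    filter_upwards [hae] with t ht
    have h1 : ‖ℓ i t - ℓin‖ ≤ ‖ℓ i t - ℓ₀ i‖ + ‖ℓ₀ i - ℓin‖ := norm_sub_le_norm_sub_add_norm_sub ..
    have h2 : δ.toReal / 2 / (B + 1) * B ≤ δ.toReal / 2 := by
      rw [div_mul_eq_mul_div, div_le_iff₀ (by positivity)]
      exact mul_le_mul_of_nonneg_left (by linarith) (by positivity)
    rw [mul_left_comm, ← hB] at ht
    linarith
  rw [eLpNorm_exponent_top]
  refine (eLpNormEssSup_le_of_ae_bound hle).trans (le_of_eq (ENNReal.ofReal_toReal hδt))
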